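/- Let $\Omega\subset\mathbb{R}^d$ be a bounded open set and $\mu$ a finite measure on $\Omega$ that is equivalent to Lebesgue measure on $\Omega$ and whose Radon--Nikodym derivative has an (essentially) bounded logarithm. For a multi-index $\alpha$ let $D_\alpha$ be the weak derivative, let $\mathcal{H}^2$ be the space of all $u\in L^2(\mu)$ with $\|u\|_{\mathcal{H}^2}:=\sum_{|\alpha|\le 2}\|D_\alpha u\|_{L^2(\mu)}<\infty$, and let $\mathcal{H}^2_{(0)}=\mathcal{H}^2\cap \mathcal{H}^1_0$, where $\mathcal{H}^1_0$ is the closure of $C_c^\infty(\Omega)$ in $\mathcal{H}^1$. Let $\mathcal{A}=\sum_{|\alpha|\le 2}a_\alpha D_\alpha$ be a linear second-order differential operator with measurable coefficients such that, for some $k>0$, $|\mathcal{A}f_1(x)-\mathcal{A}f_2(x)|\le k\sum_{|\alpha|\le 2}|D_\alpha f_1(x)-D_\alpha f_2(x)|$ for all $x\in\Omega$ (that is, the coefficients are bounded on $\Omega$). Let $g\in L^2(\mu)$, let $\eta\in C_b^3(\mathbb{R}^d)$ vanish on $\partial\Omega$, and let $\sigma\in C_b^4(\mathbb{R})$, where $C_b^n$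 denotes the $C^n$ functions that are bounded together with their derivatives of order at most $n$. Let $\tfrac12<\beta<1$ and $0<\delta<\epsilon$ with $\epsilon+\delta<\frac{1-\beta}{2}$. Call $(h^N)_{N\ge1}$ a family of smooth clipping functions with parameter $\gamma\in\mathbb{R}$ if for every $N\ge 1$ the function $h^N\in C_b^2(\mathbb{R})$ is increasing, $|h^N|\le 2N^\gamma$, $h^N(x)=x$ for $|x|\le N^\gamma$, and $|(h^N)'|\le 1$. Let $(\psi^N)$ and $(\phi^N)$ be such families with parameters $\delta$ and $\epsilon-\beta$. For $\theta=(c^i,w^i,b^i)_{i=1}^N$ with $c^i,b^i\in\mathbb{R}$, $w^i\in\mathbb{R}^d$, let $$Q^N(x;\theta)=\eta(x)\,\frac1{N^\beta}\sum_{i=1}^N c^i\sigma(w^i\cdot x+b^i).$$ Let the initial triples $(c_0^i,w_0^i,b_0^i)$, $i\ge1$, be i.i.d. random variables such that $c_0^i$ is independent of $(w_0^i,b_0^i)$, $|c_0^i|<K_0$ almost surely for a constant $K_0$, $\mathbb{E}[c_0^i]=0$, and $\mathbb{E}[|(w_0^i)_k|^4]<\infty$ for every component $k$. For each $N$ let $\theta^N_t$,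 $t\ge0$, solve the clipped gradient descent for the residual $\|\mathcal{A}Q^N-g\|^2_{L^2(\mu)}$ started at $(c_0^i,w_0^i,b_0^i)_{i=1}^N$: for every component $\theta_j$ of $\theta$, $$\frac{d\theta^N_{t,j}}{dt}=-N^{2\beta-1}\int_\Omega\psi^N\big(\mathcal{A}Q^N(x;\theta^N_t)-g(x)\big)\,\phi^N\big(\partial_{\theta_j}\mathcal{A}Q^N(x;\theta^N_t)\big)\,d\mu(x),$$ and put $Q^N_t=Q^N(\cdot;\theta^N_t)$. Let $$U(x,y)=\mathbb{E}\Big[\nabla_{c,w,b}\,\mathcal{A}[\eta\, c\,\sigma(w\cdot{}+b)](x)\cdot\nabla_{c,w,b}\,\big[\eta(y)\,c\,\sigma(w\cdot y+b)\big]\Big],\qquad (\mathcal{U}f)(y)=\int_\Omega f(x)U(x,y)\,d\mu(x),$$ where $(c,w,b)$ has the law of $(c_0^1,w_0^1,b_0^1)$. Then the linear ODE $$\frac{dQ_t}{dt}=-\mathcal{U}[\mathcal{A}Q_t-g],\qquad Q_0=0,$$ has a unique solution $(Q_t)_{t\ge0}$ in $\mathcal{H}^2_{(0)}$ (the time derivative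 being taken in the $\mathcal{H}^2$ norm), and for every $t\ge0$ $$\lim_{N\to\infty}\mathbb{E}\big[\|Q_t^N-Q_t\|_{\mathcal{H}^2}\big]=0 .$$ -/

import Mathlib

open MeasureTheory ProbabilityTheory Filter Topology Set
open scoped ENNReal ContDiff

noncomputable section

/-- Euclidean space `ℝ^d`. -/
abbrev Space (d : ℕ) := EuclideanSpace ℝ (Fin d)

/-- The multi-indices `α` on `ℝ^d` with `|α| ≤ 2`: the empty one, the first-order ones `e_i`, and the
second-order ones `e_i + e_j`, each listed once (with `i ≤ j`). -/
abbrev MIdx (d : ℕ) := Unit ⊕ Fin d ⊕ {p : Fin d × Fin d // p.1 ≤ p.2}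

/-- The order `|α|`. -/
def MIdx.order {d : ℕ} : MIdx d → ℕ
  | .inl _ => 0
  | .inr (.inl _) => 1
  | .inr (.inr _) => 2

/-- The classical partial derivative `∂_i f`. -/
def partialD {d : ℕ} (i : Fin d) (f : Space d → ℝ) : Space d → ℝ :=
  fun x => fderiv ℝ f x (EuclideanSpace.single i 1)

/-- The classical derivative `D_α f`, `|α| ≤ 2`. -/
def classicalD {d : ℕ} : MIdx d → (Space d → ℝ) → Space d → ℝ
  | .inl _, f => f
  | .inr (.inl i), f => partialD i f
  | .inr (.inr p), f => partialD p.1.1 (partialD p.1.2 f)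

/-- `f ∈ C_b^n`: `f` is `C^n` and all its derivatives of order at most `n` are bounded. -/
def IsCb {E : Type*} [NormedAddCommGroup E] [NormedSpace ℝ E] (n : ℕ) (f : E → ℝ) : Prop :=
  ContDiff ℝ n f ∧ ∀ m ≤ n, ∃ C : ℝ, ∀ x, ‖iteratedFDeriv ℝ m f x‖ ≤ C

/-- `μ` is equivalent to Lebesgue measure on `Ω`, and the logarithm of its Radon-Nikodym derivative
is (essentially) bounded. -/
def HasBoundedLogDensity {d : ℕ} (μ : Measure (Space d)) (Ω : Set (Space d)) : Prop :=
  μ ≪ volume.restrict Ω ∧ volume.restrict Ω ≪ μ ∧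
    ∃ C : ℝ, ∀ᵐ x ∂(volume.restrict Ω),
      |Real.log ((μ.rnDeriv (volume.restrict Ω) x).toReal)| ≤ C

/-- Test functions: `φ ∈ C_c^∞(Ω)`. -/
def IsTestFunction {d : ℕ} (Ω : Set (Space d)) (φ : Space d → ℝ) : Prop :=
  ContDiff ℝ ∞ φ ∧ HasCompactSupport φ ∧ tsupport φ ⊆ Ω

/-- `v` is the weak derivative `D_α u` on `Ω`. -/
def IsWeakD {d : ℕ} (Ω : Set (Space d)) (α : MIdx d) (u v : Space d → ℝ) : Prop :=
  ∀ φ : Space d → ℝ, IsTestFunction Ω φ →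
    ∫ x in Ω, u x * classicalD α φ x = (-1) ^ α.order * ∫ x in Ω, v x * φ x

/-- Families `(u_α)_{|α| ≤ 2}` in `L²(μ)`, normed by `∑_α ‖u_α‖_{L²(μ)}`. -/
abbrev JetL2 {d : ℕ} (μ : Measure (Space d)) := PiLp 1 (fun _ : MIdx d => Lp ℝ 2 μ)

/-- The Sobolev space `H²(Ω)`. A function `u` in it is represented by the family `(D_α u)_{|α| ≤ 2}`
of its weak derivatives (the member with `α = 0` is `u` itself), so that the norm of `JetL2 μ`
is the norm `‖u‖_{H²} = ∑_{|α| ≤ 2} ‖D_α u‖_{L²(μ)}`. -/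
def H2 {d : ℕ} (Ω : Set (Space d)) (μ : Measure (Space d)) : Set (JetL2 μ) :=
  {u | ∀ α, IsWeakD Ω α (u (.inl ())) (u α)}

/-- `H²_{(0)} = H² ∩ H¹_0`, where `H¹_0` is the closure of `C_c^∞(Ω)` in `H¹`. -/
def H2zero {d : ℕ} (Ω : Set (Space d)) (μ : Measure (Space d)) : Set (JetL2 μ) :=
  {u | u ∈ H2 Ω μ ∧ ∀ ε : ℝ≥0∞, 0 < ε → ∃ φ : Space d → ℝ, IsTestFunction Ω φ ∧
    ∀ α : MIdx d, α.order ≤ 1 → eLpNorm (fun x => u α x - classicalD α φ x) 2 μ < ε}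

/-- `‖f - u‖_{H²}` for a function `f` of class `C²` and `u ∈ H²`. -/
def h2Dist {d : ℕ} {μ : Measure (Space d)} (f : Space d → ℝ) (u : JetL2 μ) : ℝ≥0∞ :=
  ∑ α : MIdx d, eLpNorm (fun x => classicalD α f x - u α x) 2 μ

/-- The linear second-order operator `∑_{|α| ≤ 2} a_α(x) D_α`, as a function of the point `x`
and of the values `ξ_α = D_α f(x)`. -/
def pdeSymbol {d : ℕ} (a : MIdx d → Space d → ℝ) (x : Space d) (ξ : MIdx d → ℝ) : ℝ :=
  ∑ α, a α x * ξ α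

/-- `(𝒜 f)(x)` for a function `f` of class `C²`. -/
def pdeOp {d : ℕ} (a : MIdx d → Space d → ℝ) (f : Space d → ℝ) (x : Space d) : ℝ :=
  pdeSymbol a x (fun α => classicalD α f x)

/-- The Lipschitz condition on `𝒜`. -/
def LipschitzCondition {d : ℕ} (Ω : Set (Space d)) (a : MIdx d → Space d → ℝ) : Prop :=
  ∃ k > 0, ∀ x ∈ Ω, ∀ ξ ζ : MIdx d → ℝ,
    |pdeSymbol a x ξ - pdeSymbol a x ζ| ≤ k * ∑ α, |ξ α - ζ α|

/-- The coordinates of the parameter `(c, w, b)` of one hidden unit: `c = p (.inl ())`,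
`w_k = p (.inr (.inl k))` and `b = p (.inr (.inr ()))`. -/
abbrev Par (d : ℕ) := Unit ⊕ Fin d ⊕ Unit

/-- `c σ(w · x + b)`. -/
def hiddenUnit {d : ℕ} (σ : ℝ → ℝ) (p : Par d → ℝ) (x : Space d) : ℝ :=
  p (.inl ()) * σ (∑ k, p (.inr (.inl k)) * x k + p (.inr (.inr ())))

/-- The network `Q^N(x; θ) = η(x) N^{-β} ∑_i c^i σ(w^i · x + b^i)`. -/
def network {d : ℕ} (η : Space d → ℝ) (σ : ℝ → ℝ) (β : ℝ) (N : ℕ)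
    (θ : Fin N × Par d → ℝ) (x : Space d) : ℝ :=
  η x * ((N : ℝ) ^ (-β) * ∑ i, hiddenUnit σ (fun k => θ (i, k)) x)

/-- The partial derivative of `F` with respect to the `j`-th parameter, at `θ`. -/
def parD {ι : Type*} [DecidableEq ι] (F : (ι → ℝ) → ℝ) (j : ι) (θ : ι → ℝ) : ℝ :=
  deriv (fun s => F (Function.update θ j s)) (θ j)

/-- A family of smooth clipping functions with parameter `γ`. -/
def IsClipping (γ : ℝ) (h : ℕ → ℝ → ℝ) : Prop :=
  ∀ N : ℕ, 1 ≤ N →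
    IsCb 2 (h N) ∧ Monotone (h N) ∧ (∀ x, |h N x| ≤ 2 * (N : ℝ) ^ γ) ∧
    (∀ x, |x| ≤ (N : ℝ) ^ γ → h N x = x) ∧ ∀ x, |deriv (h N) x| ≤ 1

/-- The `j`-th component of the clipped gradient of the residual `‖𝒜 Q^N - g‖²_{L²(μ)}`:
`∫ ψ(𝒜 Q^N(x; θ) - g(x)) ϕ(∂_{θ_j} 𝒜 Q^N(x; θ)) dμ(x)`. -/
def clippedGrad {d : ℕ} (μ : Measure (Space d)) (a : MIdx d → Space d → ℝ) (g η : Space d → ℝ)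
    (σ : ℝ → ℝ) (β : ℝ) (ψ ϕ : ℝ → ℝ) (N : ℕ) (j : Fin N × Par d) (θ : Fin N × Par d → ℝ) : ℝ :=
  ∫ x, ψ (pdeOp a (network η σ β N θ) x - g x) *
    ϕ (parD (fun θ' => pdeOp a (network η σ β N θ') x) j θ) ∂μ

/-- `t ↦ θ t`, `t ≥ 0`, is the clipped gradient descent started at `θ₀`, with learning
rate `N^{2β-1}`. -/
def IsTraining {d : ℕ} (μ : Measure (Space d)) (a : MIdx d → Space d → ℝ) (g η : Space d → ℝ)
    (σ : ℝ → ℝ) (β : ℝ) (ψ ϕ : ℝ → ℝ) (N : ℕ) (θ₀ : Fin N × Par d → ℝ)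
    (θ : ℝ → Fin N × Par d → ℝ) : Prop :=
  θ 0 = θ₀ ∧ ∀ t : ℝ, 0 ≤ t → ∀ j, HasDerivWithinAt (fun s => θ s j)
    (-((N : ℝ) ^ (2 * β - 1) * clippedGrad μ a g η σ β ψ ϕ N j (θ t))) (Ici 0) t

/-- The kernel `U(x, y) = E[∇_{c,w,b} 𝒜[η c σ(w · + b)](x) ⬝ ∇_{c,w,b} [η(y) c σ(w · y + b)]]`,
where `(c, w, b)` has law `ν`. -/
def kernelU {d : ℕ} (a : MIdx d → Space d → ℝ) (η : Space d → ℝ) (σ : ℝ → ℝ)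
    (ν : Measure (Par d → ℝ)) (x y : Space d) : ℝ :=
  ∫ p, ∑ k, parD (fun q => pdeOp a (fun z => η z * hiddenUnit σ q z) x) k p *
    parD (fun q => η y * hiddenUnit σ q y) k p ∂ν

/-- `Q : [0, ∞) → H²_{(0)}` solves `dQ_t/dt = -𝒰[𝒜 Q_t - g]`, `Q_0 = 0`, where
`(𝒰 f)(y) = ∫ f(x) U(x, y) dμ(x)`; the time derivative is taken in the `H²` norm. -/
def IsWideLimit {d : ℕ} (Ω : Set (Space d)) (μ : Measure (Space d)) (a : MIdx d → Space d → ℝ)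
    (g η : Space d → ℝ) (σ : ℝ → ℝ) (ν : Measure (Par d → ℝ)) (Q : ℝ → JetL2 μ) : Prop :=
  Q 0 = 0 ∧ ∀ t : ℝ, 0 ≤ t → Q t ∈ H2zero Ω μ ∧
    ∃ V ∈ H2zero Ω μ, HasDerivWithinAt Q V (Ici 0) t ∧
      (fun y => V (.inl ()) y) =ᵐ[μ] fun y =>
        -∫ x, (pdeSymbol a x (fun α => Q t α x) - g x) * kernelU a η σ ν x y ∂μ

/-- The initial parameters `X i = (c_0^i, w_0^i, b_0^i)` of the hidden units: the triples are
independent and identically distributed, `c_0^i` is independent of `(w_0^i, b_0^i)`, bounded and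
centred, and the components of `w_0^i` have a finite fourth moment. -/
structure IsInitialization {d : ℕ} {S : Type*} [MeasurableSpace S] (P : Measure S)
    (X : ℕ → S → Par d → ℝ) : Prop where
  measurable : ∀ i, Measurable (X i)
  indep : iIndepFun X P
  identDistrib : ∀ i, IdentDistrib (X i) (X 0) P P
  indep_c : IndepFun (fun s => X 0 s (.inl ())) (fun s => fun k : Fin d ⊕ Unit => X 0 s (.inr k)) P
  bounded_c : ∃ K₀ : ℝ, ∀ᵐ s ∂P, |X 0 s (.inl ())| < K₀
  mean_c : ∫ s, X 0 s (.inl ()) ∂P = 0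
  moment_w : ∀ k : Fin d, Integrable (fun s => |X 0 s (.inr (.inl k))| ^ 4) P

end

/-! Replacing a function by the family of its derivatives turns the statement into one about Hilbert
spaces. Let E be `JetH μ`, H = L²(μ), A : E → H the bounded operator `jetOp`, F(p) the jet of one
unit η c σ(w · x + b), and J_k(p) the jets of its parameter derivatives. The network is N^(-β) ∑
F(p_i). Its parameter gradient carries a factor N^(-β), so clipping at N^(ε-β) means clipping A J_k
at N^ε; call this Φ, and let Ψ be the clipping of the residual at N^δ. By the chain rule the powers
of N combine to 1/N: the jet of Q^N moves with velocity -U^N Ψ(A Q^N - g), where U^N = N⁻¹ ∑_i ∑_k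
⟨Φ(A J_k(p_i)), ·⟩ J_k(p_i) is taken at the current parameters. The limit moves with velocity -U(A Q
- g), where U is the unclipped mean of the same operators under the initial law.

Grönwall's inequality (`IsHilbertTraining.norm_sub_le`) reduces the convergence to the following
errors, up to constants; `tendsto_lintegral_netE_sub` collects them. (1) The initial network is
N^(-β) times a sum of N independent centred vectors, of expected norm at most N^(1/2-β). (2)
Clipping bounds the speed of every parameter by N^(β-1+δ+ε), so U^N changes by at most N^ε
N^(β-1+δ+ε); applied to a residual of norm at most N^δ this gives N^(2(δ+ε)-(1-β)), which tends to 0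
exactly because ε + δ < (1-β)/2. (3) At time 0 the difference between U^N and its mean is controlled
in Hilbert-Schmidt norm by a variance computation: N^(-1/2) N^ε, times N^δ for the residual. (4)
Clipping disappears in the limit: in the mean kernel by dominated convergence (`tendsto_meanOp`),
and in the residual uniformly on the compact curve t ↦ A Q_t - g
(`IsClipFamily.exists_tendsto_bound`). All parameter estimates use the weight (1+|c|)(1+∑|w_k|)²,
whose square is integrable thanks to the fourth moments of w and the bound on c.

The limit equation is affine with bounded coefficients on E, hence uniquely solvable. The solution
stays in H²_(0) because this is a closed subspace (`isClosed_H2zeroSub`) containing the range of U: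
every J_k(p) is the jet of a C² function vanishing on ∂Ω, and such jets lie in H²_(0) without any
regularity of ∂Ω (`jet_mem_H2zeroSub`). Uniqueness of weak derivatives (`H2.eq_of_ae_eq`) makes the
equation for functions equivalent to the equation for jets, and `meanOp_apply_ae_eq` identifies U
with the integral operator of the kernel. -/

/-! ### Sums of independent centred Hilbert space valued random variables -/

section IID

variable {S 𝒳 K : Type*} [MeasurableSpace S] [MeasurableSpace 𝒳]
  [NormedAddCommGroup K] [InnerProductSpace ℝ K] [CompleteSpace K]

/-- By independence the joint law is ν ⊗ ν; Fubini then turns the expectation into an integral of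
inner products with the mean of Y, which is zero. -/
theorem integral_inner_eq_zero_of_indepFun {P : Measure S} [IsProbabilityMeasure P]
    {X₁ X₂ : S → 𝒳} {ν : Measure 𝒳} [IsProbabilityMeasure ν] (h₁ : Measurable X₁)
    (h₂ : Measurable X₂) (hν₁ : P.map X₁ = ν) (hν₂ : P.map X₂ = ν) (hind : IndepFun X₁ X₂ P)
    {Y : 𝒳 → K} (hYm : StronglyMeasurable Y) (hY : MemLp Y 2 ν) (hY0 : ∫ p, Y p ∂ν = 0) :
    ∫ s, inner ℝ (Y (X₁ s)) (Y (X₂ s)) ∂P = 0 := by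
  have hmap : P.map (fun s => (X₁ s, X₂ s)) = ν.prod ν := by
    rw [(indepFun_iff_map_prod_eq_prod_map_map h₁.aemeasurable h₂.aemeasurable).1 hind, hν₁, hν₂]
  have hsm : StronglyMeasurable fun z : 𝒳 × 𝒳 => inner ℝ (Y z.1) (Y z.2) :=
    (hYm.comp_measurable measurable_fst).inner (hYm.comp_measurable measurable_snd)
  have h := integral_map (μ := P) (h₁.prodMk h₂).aemeasurable
    (f := fun z : 𝒳 × 𝒳 => inner ℝ (Y z.1) (Y z.2)) hsm.aestronglyMeasurable
  have hYi : Integrable Y ν := hY.integrable (by norm_num)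
  simp only at h
  rw [← h, hmap, integral_prod]
  · simp only [integral_inner hYi, hY0, inner_zero_right, integral_zero]
  · refine (hYi.norm.mul_prod hYi.norm).mono hsm.aestronglyMeasurable ?_
    refine Eventually.of_forall fun z => ?_
    simpa using (norm_inner_le_norm (𝕜 := ℝ) (Y z.1) (Y z.2))

/-- Expanding the square leaves only the diagonal, the cross terms being zero by independence. This
is where the Hilbert space structure is indispensable. -/
theorem integral_norm_sq_sum_eq {P : Measure S} [IsProbabilityMeasure P]
    {X : ℕ → S → 𝒳} {ν : Measure 𝒳} [IsProbabilityMeasure ν] (hm : ∀ i, Measurable (X i))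
    (hν : ∀ i, P.map (X i) = ν) (hind : iIndepFun X P)
    {Y : 𝒳 → K} (hYm : StronglyMeasurable Y) (hY : MemLp Y 2 ν) (hY0 : ∫ p, Y p ∂ν = 0) (N : ℕ) :
    ∫ s, ‖∑ i : Fin N, Y (X i s)‖ ^ 2 ∂P = N * ∫ p, ‖Y p‖ ^ 2 ∂ν := by
  have hL : ∀ i, MemLp (fun s => Y (X i s)) 2 P := fun i =>
    (show MemLp Y 2 (P.map (X i)) by rw [hν i]; exact hY).comp_of_map (hm i).aemeasurable
  have hint : ∀ i j : ℕ, Integrable (fun s => inner ℝ (Y (X i s)) (Y (X j s))) P := fun i j =>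
    ((hL i).norm.integrable_mul (hL j).norm).mono ((hL i).1.inner (hL j).1)
      (Eventually.of_forall fun s => by
        simpa using norm_inner_le_norm (𝕜 := ℝ) (Y (X i s)) (Y (X j s)))
  have hself : ∀ i, ∫ s, inner ℝ (Y (X i s)) (Y (X i s)) ∂P = ∫ p, ‖Y p‖ ^ 2 ∂ν := by
    intro i
    simp only [real_inner_self_eq_norm_sq]
    rw [← hν i, integral_map (hm i).aemeasurable]
    exact (hYm.norm.pow 2).aestronglyMeasurable
  have hcross : ∀ i j : ℕ, i ≠ j → ∫ s, inner ℝ (Y (X i s)) (Y (X j s)) ∂P = 0 := fun i j hij =>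
    integral_inner_eq_zero_of_indepFun (hm i) (hm j) (hν i) (hν j) (hind.indepFun hij) hYm hY hY0
  simp_rw [← real_inner_self_eq_norm_sq (F := K)] at hself ⊢
  simp_rw [sum_inner, inner_sum]
  rw [integral_finsetSum _ fun i _ => integrable_finsetSum _ fun j _ => hint _ _]
  have : ∀ i : Fin N, ∫ s, ∑ j : Fin N, inner ℝ (Y (X i s)) (Y (X j s)) ∂P
      = ∫ p, inner ℝ (Y p) (Y p) ∂ν := by
    intro i
    rw [integral_finsetSum _ fun j _ => hint _ _, Finset.sum_eq_single i, hself]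
    · intro j _ hji
      exact hcross i j fun h => hji (Fin.ext h.symm)
    · simp
  simp [this]

/-- On a probability space the L¹ norm is at most the L² norm, which the variance identity computes.
Applied to the features, it controls the initial network. -/
theorem lintegral_enorm_sum_le {P : Measure S} [IsProbabilityMeasure P]
    {X : ℕ → S → 𝒳} {ν : Measure 𝒳} [IsProbabilityMeasure ν] (hm : ∀ i, Measurable (X i))
    (hν : ∀ i, P.map (X i) = ν) (hind : iIndepFun X P)
    {Y : 𝒳 → K} (hYm : StronglyMeasurable Y) (hY : MemLp Y 2 ν) (hY0 : ∫ p, Y p ∂ν = 0) (N : ℕ) :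
    ∫⁻ s, ‖∑ i : Fin N, Y (X i s)‖ₑ ∂P ≤ ENNReal.ofReal (√N * √(∫ p, ‖Y p‖ ^ 2 ∂ν)) := by
  have hL : MemLp (fun s => ∑ i : Fin N, Y (X i s)) 2 P := by
    refine memLp_finsetSum _ fun i _ => ?_
    exact (show MemLp Y 2 (P.map (X i)) by rw [hν i]; exact hY).comp_of_map (hm i).aemeasurable
  calc ∫⁻ s, ‖∑ i : Fin N, Y (X i s)‖ₑ ∂P
      = eLpNorm (fun s => ∑ i : Fin N, Y (X i s)) 1 P := by rw [eLpNorm_one_eq_lintegral_enorm]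
    _ ≤ eLpNorm (fun s => ∑ i : Fin N, Y (X i s)) 2 P :=
        eLpNorm_le_eLpNorm_of_exponent_le (by norm_num) hL.1
    _ = ENNReal.ofReal (√N * √(∫ p, ‖Y p‖ ^ 2 ∂ν)) := by
        rw [hL.eLpNorm_eq_integral_rpow_norm (by norm_num) (by norm_num),
          ← Real.sqrt_mul (Nat.cast_nonneg N), ← integral_norm_sq_sum_eq hm hν hind hYm hY hY0,
          Real.sqrt_eq_rpow]
        norm_num

/-- The non-centred version: empirical means concentrate around the mean. -/
theorem lintegral_enorm_mean_sub_le {P : Measure S} [IsProbabilityMeasure P]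
    {X : ℕ → S → 𝒳} {ν : Measure 𝒳} [IsProbabilityMeasure ν] (hm : ∀ i, Measurable (X i))
    (hν : ∀ i, P.map (X i) = ν) (hind : iIndepFun X P)
    {Y : 𝒳 → K} (hYm : StronglyMeasurable Y) {B : ℝ} (hB : 0 ≤ B) {w : 𝒳 → ℝ}
    (hw : MemLp w 2 ν) (hYw : ∀ p, ‖Y p‖ ≤ B * w p) {N : ℕ} (hN : 1 ≤ N) :
    ∫⁻ s, ‖(N : ℝ)⁻¹ • ∑ i : Fin N, Y (X i s) - ∫ p, Y p ∂ν‖ₑ ∂P ≤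
      ENNReal.ofReal ((N : ℝ) ^ (-(1 / 2 : ℝ)) * (2 * B * (eLpNorm w 2 ν).toReal)) := by
  have hY : MemLp Y 2 ν := (hw.const_mul B).mono' hYm.aestronglyMeasurable
    (Eventually.of_forall hYw)
  obtain ⟨e, he⟩ : ∃ e, e = ∫ p, Y p ∂ν := ⟨_, rfl⟩
  rw [← he]
  have hN0 : (0 : ℝ) < N := by exact_mod_cast hN
  have hY' : MemLp (fun p => Y p - e) 2 ν := hY.sub (memLp_const e)
  have h0 : ∫ p, (Y p - e) ∂ν = 0 := by
    rw [integral_sub (hY.integrable (by norm_num)) (integrable_const _)]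
    simp [he]
  have h : ∫⁻ s, ‖∑ i : Fin N, (Y (X i s) - e)‖ₑ ∂P ≤
      ENNReal.ofReal (√N * √(∫ p, ‖Y p - e‖ ^ 2 ∂ν)) :=
    lintegral_enorm_sum_le hm hν hind (hYm.sub stronglyMeasurable_const) hY' h0 N
  have hpt : ∀ s, (N : ℝ)⁻¹ • ∑ i : Fin N, Y (X i s) - e
      = (N : ℝ)⁻¹ • ∑ i : Fin N, (Y (X i s) - e) := by
    intro s
    rw [Finset.sum_sub_distrib, smul_sub]
    simp [← Nat.cast_smul_eq_nsmul ℝ, smul_smul, hN0.ne']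
  have hnormY : eLpNorm Y 2 ν ≤ ENNReal.ofReal B * eLpNorm w 2 ν := by
    refine eLpNorm_le_mul_eLpNorm_of_ae_le_mul (Eventually.of_forall fun p => ?_) 2
    exact (hYw p).trans (by gcongr; exact le_abs_self _)
  have hnormY' : (eLpNorm Y 2 ν).toReal ≤ B * (eLpNorm w 2 ν).toReal := by
    have := ENNReal.toReal_mono (ENNReal.mul_ne_top ENNReal.ofReal_ne_top hw.2.ne) hnormY
    rwa [ENNReal.toReal_mul, ENNReal.toReal_ofReal hB] at this
  have hsq : √(∫ p, ‖Y p - e‖ ^ 2 ∂ν) = (eLpNorm (fun p => Y p - e) 2 ν).toReal := by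
    rw [hY'.eLpNorm_eq_integral_rpow_norm (by norm_num) (by norm_num), Real.sqrt_eq_rpow,
      ENNReal.toReal_ofReal (by positivity)]
    norm_num
  -- The mean is bounded by the L² norm, so centring at most doubles that norm; hence the factor 2
  -- in the statement.
  have hee : ‖e‖ ≤ (eLpNorm Y 2 ν).toReal := by
    have h1 : ‖e‖ₑ ≤ eLpNorm Y 2 ν := by
      calc ‖e‖ₑ = ‖∫ p, Y p ∂ν‖ₑ := by rw [he]
        _ ≤ ∫⁻ p, ‖Y p‖ₑ ∂ν := enorm_integral_le_lintegral_enorm _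
        _ = eLpNorm Y 1 ν := by rw [eLpNorm_one_eq_lintegral_enorm]
        _ ≤ eLpNorm Y 2 ν := eLpNorm_le_eLpNorm_of_exponent_le (by norm_num) hY.1
    simpa using ENNReal.toReal_mono hY.2.ne h1
  have hsq' : √(∫ p, ‖Y p - e‖ ^ 2 ∂ν) ≤ 2 * B * (eLpNorm w 2 ν).toReal := by
    rw [hsq]
    have h1 : eLpNorm (fun p => Y p - e) 2 ν ≤ eLpNorm Y 2 ν + ‖e‖ₑ := by
      refine (eLpNorm_sub_le hY.1 aestronglyMeasurable_const (by norm_num)).trans ?_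
      gcongr
      rw [eLpNorm_const _ (by norm_num) (IsProbabilityMeasure.ne_zero ν)]
      simp
    have h2 := ENNReal.toReal_mono (ENNReal.add_ne_top.2 ⟨hY.2.ne, enorm_ne_top⟩) h1
    rw [ENNReal.toReal_add hY.2.ne enorm_ne_top, toReal_enorm] at h2
    linarith
  calc ∫⁻ s, ‖(N : ℝ)⁻¹ • ∑ i : Fin N, Y (X i s) - e‖ₑ ∂P
      = ENNReal.ofReal (N : ℝ)⁻¹ * ∫⁻ s, ‖∑ i : Fin N, (Y (X i s) - e)‖ₑ ∂P := by
        rw [← lintegral_const_mul' _ _ ENNReal.ofReal_ne_top]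
        refine lintegral_congr fun s => ?_
        rw [hpt, enorm_smul, Real.enorm_of_nonneg (by positivity)]
    _ ≤ ENNReal.ofReal (N : ℝ)⁻¹ * ENNReal.ofReal (√N * √(∫ p, ‖Y p - e‖ ^ 2 ∂ν)) := by
        gcongr
    _ ≤ _ := by
        rw [← ENNReal.ofReal_mul (by positivity)]
        refine ENNReal.ofReal_le_ofReal ?_
        rw [← mul_assoc]
        have : (N : ℝ)⁻¹ * √N = (N : ℝ) ^ (-(1 / 2 : ℝ)) := by
          rw [Real.sqrt_eq_rpow, ← Real.rpow_neg_one, ← Real.rpow_add hN0]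
          norm_num
        rw [this]
        gcongr

end IID

/-! ### The completed tensor product of Hilbert spaces -/

section Tensor

variable (H E : Type*) [NormedAddCommGroup H] [InnerProductSpace ℝ H]
  [NormedAddCommGroup E] [InnerProductSpace ℝ E]

/-- The Hilbert space tensor product. -/
abbrev HilbertTensor := UniformSpace.Completion (TensorProduct ℝ H E)

variable {H E}

/-- Pure tensors in the Hilbert space tensor product. -/
noncomputable def htmul (h : H) (e : E) : HilbertTensor H E :=
  ((TensorProduct.mk ℝ H E h e : TensorProduct ℝ H E) : HilbertTensor H E)

theorem continuous_htmul : Continuous fun z : H × E => htmul z.1 z.2 :=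
  (UniformSpace.Completion.continuous_coe _).comp TensorProduct.continuous_tmul

theorem inner_htmul (h h' : H) (e e' : E) :
    inner ℝ (htmul h e) (htmul h' e') = inner ℝ h h' * inner ℝ e e' := by
  simp [htmul, UniformSpace.Completion.inner_coe]

theorem norm_htmul (h : H) (e : E) : ‖htmul h e‖ = ‖h‖ * ‖e‖ := by
  simp [htmul, UniformSpace.Completion.norm_coe]

/-- The Hilbert-Schmidt norm dominates the operator norm: if `v` acts on `h` as the tensor `T`,
then `‖v‖ ≤ ‖h‖ ‖T‖`. -/
theorem norm_le_of_inner_eq_htmul {h : H} {v : E} {T : HilbertTensor H E}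
    (hT : ∀ e, inner ℝ e v = inner ℝ (htmul h e) T) : ‖v‖ ≤ ‖h‖ * ‖T‖ := by
  rcases eq_or_ne v 0 with rfl | hv
  · simp; positivity
  have hpos : 0 < ‖v‖ := norm_pos_iff.2 hv
  have h1 : ‖v‖ * ‖v‖ ≤ (‖h‖ * ‖T‖) * ‖v‖ := by
    -- Duality: the hypothesis is tested on e = v.
    rw [← real_inner_self_eq_norm_mul_norm, hT v]
    refine (real_inner_le_norm _ _).trans (le_of_eq ?_)
    rw [norm_htmul]; ring
  exact le_of_mul_le_mul_right h1 hpos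

end Tensor

/-! ### Measurability of the flow of a bounded vector field -/

theorem norm_sub_le_of_hasDerivWithinAt_Ici {W : Type*} [NormedAddCommGroup W] [NormedSpace ℝ W]
    {x x' : ℝ → W} {B : ℝ} (hx : ∀ t, 0 ≤ t → HasDerivWithinAt x (x' t) (Ici 0) t)
    (hB : ∀ t, 0 ≤ t → ‖x' t‖ ≤ B) {t : ℝ} (ht : 0 ≤ t) : ‖x t - x 0‖ ≤ B * t := by
  have := (convex_Ici (0 : ℝ)).norm_image_sub_le_of_norm_hasDerivWithin_le
    (fun y hy => hx y hy) (fun y hy => hB y hy) (mem_Ici.2 le_rfl) (mem_Ici.2 ht)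
  simpa [abs_of_nonneg ht] using this

/-- The value at time t is a function of the initial value alone, and a continuous one: trajectories
starting in a ball stay in a larger ball where the field is Lipschitz, and Grönwall compares them.
Measurability then follows from that of the initial value, with no flow defined outside the initial
values that occur. -/
theorem measurable_flow {S W : Type*} [MeasurableSpace S] [NormedAddCommGroup W] [NormedSpace ℝ W]
    [MeasurableSpace W] [BorelSpace W] {v : W → W} {B : ℝ} (hB : ∀ w, ‖v w‖ ≤ B)
    (hv : ∀ R, ∃ K : NNReal, LipschitzOnWith K v (Metric.closedBall 0 R))
    {x : S → ℝ → W} (hx : ∀ s t, 0 ≤ t → HasDerivWithinAt (x s) (v (x s t)) (Ici 0) t)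
    (h0 : Measurable fun s => x s 0) {t : ℝ} (ht : 0 ≤ t) : Measurable fun s => x s t := by
  have hB0 : 0 ≤ B := (norm_nonneg _).trans (hB 0)
  have key : ∀ R, ∃ C, ∀ s s', ‖x s 0‖ ≤ R → ‖x s' 0‖ ≤ R →
      dist (x s t) (x s' t) ≤ dist (x s 0) (x s' 0) * C := by
    intro R
    -- With speed at most B, a trajectory started within radius R stays within radius R + B t up to
    -- time t.
    obtain ⟨K, hK⟩ := hv (R + B * t)
    have hmem : ∀ s, ‖x s 0‖ ≤ R → ∀ r ∈ Ico 0 t, x s r ∈ Metric.closedBall (0 : W) (R + B * t) := by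
      intro s hs r hr
      rw [mem_closedBall_zero_iff]
      have h1 := norm_sub_le_of_hasDerivWithinAt_Ici (hx s) (fun r _ => hB _) hr.1
      have h2 : ‖x s r‖ ≤ ‖x s r - x s 0‖ + ‖x s 0‖ := by
        simpa using norm_add_le (x s r - x s 0) (x s 0)
      have h3 : B * r ≤ B * t := by gcongr; exact hr.2.le
      linarith
    refine ⟨Real.exp (K * (t - 0)), fun s s' hs hs' => ?_⟩
    exact dist_le_of_trajectories_ODE_of_mem (v := fun _ => v) (a := 0) (b := t)
      (s := fun _ => Metric.closedBall (0 : W) (R + B * t)) (fun _ _ => hK)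
      (fun r hr => ((hx s r hr.1).continuousWithinAt.mono Icc_subset_Ici_self))
      (fun r hr => (hx s r hr.1).mono (Ici_subset_Ici.2 hr.1)) (hmem s hs)
      (fun r hr => ((hx s' r hr.1).continuousWithinAt.mono Icc_subset_Ici_self))
      (fun r hr => (hx s' r hr.1).mono (Ici_subset_Ici.2 hr.1)) (hmem s' hs') le_rfl
      t (right_mem_Icc.2 ht)
  let D := range fun s => x s 0
  -- An arbitrary sample with the given initial value is chosen; `key` shows that the choice does
  -- not matter.
  let φ : D → W := fun z => x z.2.choose t
  have hφ : ∀ s, x s t = φ ⟨x s 0, mem_range_self s⟩ := by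
    intro s
    have hch : x (mem_range_self (f := fun s => x s 0) s).choose 0 = x s 0 :=
      (mem_range_self (f := fun s => x s 0) s).choose_spec
    obtain ⟨C, hC⟩ := key ‖x s 0‖
    have := hC s _ le_rfl (le_of_eq (congrArg norm hch))
    rw [hch, dist_self, zero_mul] at this
    exact dist_le_zero.1 this
  have hcont : Continuous φ := by
    rw [continuous_iff_continuousAt]
    intro z
    obtain ⟨C, hC⟩ := key (‖(z : W)‖ + 1)
    have hev : ∀ᶠ y : D in 𝓝 z, dist (φ y) (φ z) ≤ dist (y : W) z * C := by
      have : ∀ᶠ y : D in 𝓝 z, ‖(y : W)‖ < ‖(z : W)‖ + 1 :=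
        (continuous_subtype_val.norm.tendsto z).eventually (gt_mem_nhds (by linarith))
      filter_upwards [this] with y hy
      have h1 := y.2.choose_spec
      have h2 := z.2.choose_spec
      simp only at h1 h2
      have := hC y.2.choose z.2.choose (by rw [h1]; exact hy.le) (by rw [h2]; linarith)
      rwa [h1, h2] at this
    rw [ContinuousAt, tendsto_iff_dist_tendsto_zero]
    refine squeeze_zero' (Eventually.of_forall fun _ => dist_nonneg) hev ?_
    have : Continuous fun y : D => dist (y : W) z * C := by fun_prop
    simpa using this.tendsto z
  have : (fun s => x s t) = fun s => φ ⟨x s 0, mem_range_self s⟩ := funext hφ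
  rw [this]
  exact hcont.measurable.comp (h0.subtype_mk)

/-! ### Finite rank operators and the corresponding tensors -/

section FiniteRank

variable {κ : Type*} [Fintype κ] {H E : Type*} [NormedAddCommGroup H] [InnerProductSpace ℝ H]
  [NormedAddCommGroup E] [InnerProductSpace ℝ E]

/-- The operator `h ↦ ∑ k, ⟪u k, h⟫ j k`. -/
noncomputable def finRankOp (u : κ → H) (j : κ → E) : H →L[ℝ] E :=
  ∑ k, (innerSL ℝ (u k)).smulRight (j k)

/-- The tensor of the operator `finRankOp u j`. -/
noncomputable def finRankTensor (u : κ → H) (j : κ → E) : HilbertTensor H E :=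
  ∑ k, htmul (u k) (j k)

theorem finRankOp_apply (u : κ → H) (j : κ → E) (h : H) :
    finRankOp u j h = ∑ k, inner ℝ (u k) h • j k := by
  simp [finRankOp]

/-- This duality links operator and tensor. Fluctuations of random operators can thus be measured in
the tensor product, a Hilbert space, where variances can be computed. -/
theorem inner_finRankOp (u : κ → H) (j : κ → E) (h : H) (e : E) :
    inner ℝ e (finRankOp u j h) = inner ℝ (htmul h e) (finRankTensor u j) := by
  simp only [finRankOp_apply, finRankTensor, inner_sum, inner_htmul, inner_smul_right]
  exact Finset.sum_congr rfl fun k _ => by rw [real_inner_comm]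

theorem norm_finRankOp_le (u : κ → H) (j : κ → E) :
    ‖finRankOp u j‖ ≤ ∑ k, ‖u k‖ * ‖j k‖ := by
  refine (norm_sum_le _ _).trans (Finset.sum_le_sum fun k _ => ?_)
  rw [ContinuousLinearMap.norm_smulRight_apply, innerSL_apply_norm]

theorem norm_finRankTensor_le (u : κ → H) (j : κ → E) :
    ‖finRankTensor u j‖ ≤ ∑ k, ‖u k‖ * ‖j k‖ := by
  refine (norm_sum_le _ _).trans (Finset.sum_le_sum fun k _ => ?_)
  rw [norm_htmul]

/-- From u'j' - uj = u'(j' - j) + (u' - u)j. In this split only u', which will be a clipped vector,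
is left undifferenced at the perturbed parameter. -/
theorem norm_finRankOp_sub_le (u u' : κ → H) (j j' : κ → E) :
    ‖finRankOp u' j' - finRankOp u j‖ ≤
      ∑ k, (‖u' k‖ * ‖j' k - j k‖ + ‖u' k - u k‖ * ‖j k‖) := by
  have : finRankOp u' j' - finRankOp u j = finRankOp u' (j' - j) + finRankOp (u' - u) j := by
    ext h
    simp only [_root_.sub_apply, _root_.add_apply, finRankOp_apply,
      ← Finset.sum_sub_distrib, ← Finset.sum_add_distrib]
    refine Finset.sum_congr rfl fun k _ => ?_
    simp only [Pi.sub_apply, inner_sub_left, smul_sub, sub_smul]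
    abel
  rw [this, Finset.sum_add_distrib]
  exact (norm_add_le _ _).trans (add_le_add (norm_finRankOp_le _ _) (norm_finRankOp_le _ _))

/-- Continuity in operator norm provides the strong measurability needed to integrate these
operators over the parameters. -/
theorem Continuous.finRankOp {X : Type*} [TopologicalSpace X] {u : κ → X → H} {j : κ → X → E}
    (hu : ∀ k, Continuous (u k)) (hj : ∀ k, Continuous (j k)) :
    Continuous fun x => finRankOp (fun k => u k x) (fun k => j k x) := by
  rw [continuous_iff_continuousAt]
  intro x
  rw [ContinuousAt, tendsto_iff_norm_sub_tendsto_zero]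
  refine squeeze_zero (fun _ => norm_nonneg _) (fun y => norm_finRankOp_sub_le _ _ _ _) ?_
  have : Continuous fun y => ∑ k, (‖u k y‖ * ‖j k y - j k x‖ + ‖u k y - u k x‖ * ‖j k x‖) := by
    fun_prop
  simpa using this.tendsto x

theorem Continuous.finRankTensor {X : Type*} [TopologicalSpace X] {u : κ → X → H} {j : κ → X → E}
    (hu : ∀ k, Continuous (u k)) (hj : ∀ k, Continuous (j k)) :
    Continuous fun x => finRankTensor (fun k => u k x) (fun k => j k x) :=
  continuous_finsetSum _ fun k _ => continuous_htmul.comp ((hu k).prodMk (hj k))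

end FiniteRank

/-! ### Feature maps, clipping families, and the training dynamics in Hilbert spaces -/

/-- A feature map `F` with partial derivatives `J k`, controlled by a square integrable weight. -/
structure IsFeatureMap {κ E : Type*} [Fintype κ] [NormedAddCommGroup E] [NormedSpace ℝ E]
    (ν : Measure (κ → ℝ)) (F : (κ → ℝ) → E) (J : κ → (κ → ℝ) → E) (m : (κ → ℝ) → ℝ) : Prop where
  hasFDerivAt : ∀ p, HasFDerivAt F
    (∑ k, (ContinuousLinearMap.proj (R := ℝ) (φ := fun _ : κ => ℝ) k).smulRight (J k p)) p
  one_le : ∀ p, 1 ≤ m p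
  norm_J_le : ∀ k p, ‖J k p‖ ≤ m p
  lipschitz_J : ∀ k p p', ‖p' - p‖ ≤ 1 → ‖J k p' - J k p‖ ≤ m p * ‖p' - p‖
  continuous_weight : Continuous m
  memLp_weight : MemLp m 2 ν
  memLp_F : MemLp F 2 ν
  integral_F : ∫ p, F p ∂ν = 0

/-- Maps `Φ N` of a normed space that clip at the level `C N ^ γ`. -/
structure IsClipFamily {H : Type*} [NormedAddCommGroup H] (C γ : ℝ) (Φ : ℕ → H → H) : Prop where
  lipschitz : ∀ N, 1 ≤ N → LipschitzWith 1 (Φ N)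
  map_zero : ∀ N, 1 ≤ N → Φ N 0 = 0
  norm_le : ∀ N : ℕ, 1 ≤ N → ∀ v, ‖Φ N v‖ ≤ C * (N : ℝ) ^ γ
  tendsto : ∀ v, Tendsto (fun N => Φ N v) atTop (𝓝 v)

section Feature

variable {κ H E : Type*} [Fintype κ] [NormedAddCommGroup H] [InnerProductSpace ℝ H]
  [NormedAddCommGroup E] [InnerProductSpace ℝ E]
  {ν : Measure (κ → ℝ)} {F : (κ → ℝ) → E} {J : κ → (κ → ℝ) → E} {m : (κ → ℝ) → ℝ}

/-- The parameters of the `i`-th unit. -/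
def unitPar {κ : Type*} {N : ℕ} (θ : Fin N × κ → ℝ) (i : Fin N) : κ → ℝ := fun k => θ (i, k)

/-- The network `N ^ (-β) ∑ i, F (p i)`. -/
noncomputable def netE (F : (κ → ℝ) → E) (β : ℝ) (N : ℕ) (θ : Fin N × κ → ℝ) : E :=
  (N : ℝ) ^ (-β) • ∑ i, F (unitPar θ i)

/-- The vector field of the clipped gradient descent. -/
noncomputable def clippedField (F : (κ → ℝ) → E) (J : κ → (κ → ℝ) → E) (A : E →L[ℝ] H) (g : H)
    (Ψ Φ : H → H) (β : ℝ) (N : ℕ) (θ : Fin N × κ → ℝ) (j : Fin N × κ) : ℝ :=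
  -((N : ℝ) ^ (2 * β - 1) * ((N : ℝ) ^ (-β) *
    inner ℝ (Φ (A (J j.2 (unitPar θ j.1)))) (Ψ (A (netE F β N θ) - g))))

/-- The empirical tangent kernel, as an operator. -/
noncomputable def empOp (J : κ → (κ → ℝ) → E) (A : E →L[ℝ] H) (Φ : H → H) (N : ℕ)
    (θ : Fin N × κ → ℝ) : H →L[ℝ] E :=
  (N : ℝ)⁻¹ • ∑ i, finRankOp (fun k => Φ (A (J k (unitPar θ i)))) (fun k => J k (unitPar θ i))

/-- The mean tangent kernel, as an operator. -/
noncomputable def meanOp (ν : Measure (κ → ℝ)) (J : κ → (κ → ℝ) → E) (A : E →L[ℝ] H)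
    (Φ : H → H) : H →L[ℝ] E :=
  ∫ p, finRankOp (fun k => Φ (A (J k p))) (fun k => J k p) ∂ν

namespace IsFeatureMap

theorem continuous_J (h : IsFeatureMap ν F J m) (k : κ) : Continuous (J k) := by
  rw [continuous_iff_continuousAt]
  intro p
  rw [ContinuousAt, tendsto_iff_norm_sub_tendsto_zero]
  have hev : ∀ᶠ p' in 𝓝 p, ‖J k p' - J k p‖ ≤ m p * ‖p' - p‖ := by
    filter_upwards [Metric.closedBall_mem_nhds p one_pos] with p' hp'
    exact h.lipschitz_J k p p' (by rwa [← dist_eq_norm])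
  refine squeeze_zero' (Eventually.of_forall fun _ => norm_nonneg _) hev ?_
  have : Continuous fun p' => m p * ‖p' - p‖ := by fun_prop
  simpa using this.tendsto p

theorem continuous_F (h : IsFeatureMap ν F J m) : Continuous F :=
  continuous_iff_continuousAt.2 fun p => (h.hasFDerivAt p).continuousAt

theorem continuous_netE (h : IsFeatureMap ν F J m) (β : ℝ) (N : ℕ) :
    Continuous (netE F β N) := by
  have hF := h.continuous_F
  unfold netE unitPar
  fun_prop

theorem integrable_weight_sq (h : IsFeatureMap ν F J m) : Integrable (fun p => m p ^ 2) ν :=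
  h.memLp_weight.integrable_sq

theorem exists_bound_on_ball (h : IsFeatureMap ν F J m) (R : ℝ) :
    ∃ M, 1 ≤ M ∧ ∀ p ∈ Metric.closedBall (0 : κ → ℝ) R, m p ≤ M := by
  obtain ⟨M, hM⟩ := (isCompact_closedBall (0 : κ → ℝ) R).exists_bound_of_continuousOn
    h.continuous_weight.continuousOn
  exact ⟨max M 1, le_max_right _ _, fun p hp =>
    (le_abs_self _).trans ((hM p hp).trans (le_max_left _ _))⟩

theorem lipschitz_on_ball (h : IsFeatureMap ν F J m) (R : ℝ) :
    ∃ L, 0 ≤ L ∧ ∀ p ∈ Metric.closedBall (0 : κ → ℝ) R, ∀ p' ∈ Metric.closedBall (0 : κ → ℝ) R,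
      ‖F p' - F p‖ ≤ L * ‖p' - p‖ ∧ ∀ k, ‖J k p' - J k p‖ ≤ L * ‖p' - p‖ := by
  obtain ⟨M, hM1, hM⟩ := h.exists_bound_on_ball R
  refine ⟨Fintype.card κ * M + 2 * M, by positivity, fun p hp p' hp' => ⟨?_, fun k => ?_⟩⟩
  · have h1 : ‖F p' - F p‖ ≤ (Fintype.card κ * M) * ‖p' - p‖ := by
      refine (convex_closedBall (0 : κ → ℝ) R).norm_image_sub_le_of_norm_hasFDerivWithin_le
        (fun x _ => (h.hasFDerivAt x).hasFDerivWithinAt) (fun x hx => ?_) hp hp'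
      calc _ ≤ ∑ k : κ, M := (norm_sum_le _ _).trans (Finset.sum_le_sum fun k _ => ?_)
        _ = _ := by simp
      rw [ContinuousLinearMap.norm_smulRight_apply]
      calc _ ≤ 1 * ‖J k x‖ := by
            gcongr
            refine ContinuousLinearMap.opNorm_le_bound _ zero_le_one fun y => ?_
            simpa using norm_le_pi_norm y k
        _ ≤ M := by rw [one_mul]; exact (h.norm_J_le k x).trans (hM x hx)
    refine h1.trans ?_
    gcongr
    linarith
  · have h0 : 0 ≤ (Fintype.card κ : ℝ) * M := by positivity
    -- The local Lipschitz bound reaches only to distance 1; beyond that, the sup bound 2M is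
    -- already at most 2M times the distance.
    rcases le_or_gt ‖p' - p‖ 1 with hle | hgt
    · refine (h.lipschitz_J k p p' hle).trans ?_
      gcongr
      linarith [hM p hp]
    · have h1 : ‖J k p' - J k p‖ ≤ 2 * M := by
        refine (norm_sub_le _ _).trans ?_
        linarith [h.norm_J_le k p, h.norm_J_le k p', hM p hp, hM p' hp']
      nlinarith

end IsFeatureMap

end Feature

set_option linter.unusedSectionVars false

/-! ### Clipped gradient descent: speed of the parameters, evolution of the network, stability of
the empirical kernel. -/

section Dynamics

variable {κ H E : Type*} [Fintype κ] [NormedAddCommGroup H] [InnerProductSpace ℝ H]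
  [NormedAddCommGroup E] [InnerProductSpace ℝ E]
  {ν : Measure (κ → ℝ)} {F : (κ → ℝ) → E} {J : κ → (κ → ℝ) → E} {m : (κ → ℝ) → ℝ}
  {A : E →L[ℝ] H} {g : H} {β : ℝ}

theorem norm_unitPar_sub_le {N : ℕ} {θ θ' : Fin N × κ → ℝ} {r : ℝ} (hr : 0 ≤ r)
    (h : ∀ j, |θ' j - θ j| ≤ r) (i : Fin N) : ‖unitPar θ' i - unitPar θ i‖ ≤ r :=
  (pi_norm_le_iff_of_nonneg hr).2 fun k => h (i, k)

theorem norm_unitPar_sub_le_norm {N : ℕ} (θ θ' : Fin N × κ → ℝ) (i : Fin N) :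
    ‖unitPar θ' i - unitPar θ i‖ ≤ ‖θ' - θ‖ :=
  norm_unitPar_sub_le (norm_nonneg _) (fun j => norm_le_pi_norm (θ' - θ) j) i

theorem IsClipFamily.norm_sub_le {H : Type*} [NormedAddCommGroup H] {C γ : ℝ}
    {Φ : ℕ → H → H} (h : IsClipFamily C γ Φ) {N : ℕ}
    (hN : 1 ≤ N) (u v : H) : ‖Φ N u - Φ N v‖ ≤ ‖u - v‖ := by
  simpa [dist_eq_norm] using (h.lipschitz N hN).dist_le_mul u v

theorem IsClipFamily.norm_le_norm {H : Type*} [NormedAddCommGroup H] {C γ : ℝ}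
    {Φ : ℕ → H → H} (h : IsClipFamily C γ Φ) {N : ℕ}
    (hN : 1 ≤ N) (u : H) : ‖Φ N u‖ ≤ ‖u‖ := by
  simpa [h.map_zero N hN] using h.norm_sub_le hN u 0

theorem IsClipFamily.nonneg {H : Type*} [NormedAddCommGroup H] {C γ : ℝ}
    {Φ : ℕ → H → H} (h : IsClipFamily C γ Φ) : 0 ≤ C := by
  simpa [h.map_zero 1 le_rfl] using h.norm_le 1 le_rfl 0

/-- The speed at which a parameter can move. -/
noncomputable def speedBound (C C' β δ ε : ℝ) (N : ℕ) : ℝ :=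
  (N : ℝ) ^ (2 * β - 1) * ((N : ℝ) ^ (-β) * ((C' * (N : ℝ) ^ ε) * (C * (N : ℝ) ^ δ)))

theorem abs_clippedField_le {κ : Type*} {F : (κ → ℝ) → E} {J : κ → (κ → ℝ) → E}
    {C C' δ ε : ℝ} {Ψ Φ : ℕ → H → H} (hΨ : IsClipFamily C δ Ψ)
    (hΦ : IsClipFamily C' ε Φ) {N : ℕ} (hN : 1 ≤ N) (θ : Fin N × κ → ℝ) (j : Fin N × κ) :
    |clippedField F J A g (Ψ N) (Φ N) β N θ j| ≤ speedBound C C' β δ ε N := by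
  unfold clippedField speedBound
  rw [abs_neg, abs_mul, abs_mul, abs_of_nonneg (by positivity : 0 ≤ (N : ℝ) ^ (2 * β - 1)),
    abs_of_nonneg (by positivity : 0 ≤ (N : ℝ) ^ (-β))]
  gcongr
  refine (abs_real_inner_le_norm _ _).trans ?_
  have hC' := hΦ.nonneg
  gcongr
  · exact hΦ.norm_le N hN _
  · exact hΨ.norm_le N hN _

/-- The training dynamics in the parameter space. -/
def IsHilbertTraining (F : (κ → ℝ) → E) (J : κ → (κ → ℝ) → E) (A : E →L[ℝ] H) (g : H)
    (Ψ Φ : H → H) (β : ℝ) (N : ℕ) (θ : ℝ → Fin N × κ → ℝ) : Prop :=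
  ∀ t : ℝ, 0 ≤ t → HasDerivWithinAt θ (clippedField F J A g Ψ Φ β N (θ t)) (Ici 0) t

theorem IsHilbertTraining.abs_sub_le {C C' δ ε : ℝ} {Ψ Φ : ℕ → H → H}
    (hΨ : IsClipFamily C δ Ψ) (hΦ : IsClipFamily C' ε Φ) {N : ℕ} (hN : 1 ≤ N)
    {θ : ℝ → Fin N × κ → ℝ} (hθ : IsHilbertTraining F J A g (Ψ N) (Φ N) β N θ)
    {t : ℝ} (ht : 0 ≤ t) (j : Fin N × κ) :
    |θ t j - θ 0 j| ≤ speedBound C C' β δ ε N * t :=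
  norm_sub_le_of_hasDerivWithinAt_Ici (fun r hr => hasDerivWithinAt_pi.1 (hθ r hr) j)
    (fun _ _ => abs_clippedField_le hΨ hΦ hN _ j) ht

/-- The chain rule rewrites parameter dynamics as dynamics of the network itself: the inner products
of the gradient are the coefficients of the tangent kernel. -/
theorem IsHilbertTraining.hasDerivWithinAt_netE (hF : IsFeatureMap ν F J m) {Ψ Φ : H → H} {N : ℕ}
    (hN : 1 ≤ N) {θ : ℝ → Fin N × κ → ℝ} (hθ : IsHilbertTraining F J A g Ψ Φ β N θ) {t : ℝ}
    (ht : 0 ≤ t) :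
    HasDerivWithinAt (fun r => netE F β N (θ r))
      (-(empOp J A Φ N (θ t) (Ψ (A (netE F β N (θ t)) - g)))) (Ici 0) t := by
  have hN0 : (0 : ℝ) < N := by exact_mod_cast hN
  have hp : ∀ i, HasDerivWithinAt (fun r => unitPar (θ r) i)
      (fun k => clippedField F J A g Ψ Φ β N (θ t) (i, k)) (Ici 0) t := fun i =>
    hasDerivWithinAt_pi.2 fun k => hasDerivWithinAt_pi.1 (hθ t ht) (i, k)
  have h1 := fun i => (hF.hasFDerivAt (unitPar (θ t) i)).comp_hasDerivWithinAt t (hp i)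
  have h2 := (HasDerivWithinAt.fun_sum (u := Finset.univ) fun i _ => h1 i).const_smul
    ((N : ℝ) ^ (-β))
  refine h2.congr_deriv ?_
  simp only [empOp, clippedField, FunLike.coe_smul, Pi.smul_apply,
    _root_.sum_apply, finRankOp_apply, Finset.smul_sum, ← Finset.sum_neg_distrib,
    ContinuousLinearMap.smulRight_apply, ContinuousLinearMap.proj_apply, smul_smul]
  refine Finset.sum_congr rfl fun i _ => Finset.sum_congr rfl fun k _ => ?_
  rw [← neg_smul]
  congr 1
  -- The factors are the network normalisation, the learning rate and the normalisation inside the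
  -- gradient; together they turn the sum over units into a mean.
  have : (N : ℝ) ^ (-β) * ((N : ℝ) ^ (2 * β - 1) * (N : ℝ) ^ (-β)) = (N : ℝ)⁻¹ := by
    rw [← Real.rpow_add hN0, ← Real.rpow_add hN0, ← Real.rpow_neg_one]
    congr 1; ring
  rw [← this]; ring

/-- The field is built from inner products of two bounded maps, each Lipschitz on balls. The
Lipschitz constant depends on N and serves only the measurability of the trained parameters. -/
theorem lipschitzOnWith_clippedField (hF : IsFeatureMap ν F J m) {C C' δ ε : ℝ}
    {Ψ Φ : ℕ → H → H} (hΨ : IsClipFamily C δ Ψ) (hΦ : IsClipFamily C' ε Φ) {N : ℕ} (hN : 1 ≤ N)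
    (R : ℝ) : ∃ K : NNReal, LipschitzOnWith K (clippedField F J A g (Ψ N) (Φ N) β N)
      (Metric.closedBall 0 R) := by
  obtain ⟨L, hL0, hL⟩ := hF.lipschitz_on_ball R
  have hC := hΨ.nonneg
  have hC' := hΦ.nonneg
  let c : ℝ := (N : ℝ) ^ (2 * β - 1) * ((N : ℝ) ^ (-β) * (C' * (N : ℝ) ^ ε * (‖A‖ *
    ((N : ℝ) ^ (-β) * (N * L))) + ‖A‖ * L * (C * (N : ℝ) ^ δ)))
  have hc : 0 ≤ c := by positivity
  refine ⟨c.toNNReal, LipschitzOnWith.of_dist_le_mul fun θ hθ θ' hθ' => ?_⟩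
  rw [dist_eq_norm, dist_eq_norm, Real.coe_toNNReal _ hc]
  refine (pi_norm_le_iff_of_nonneg (by positivity)).2 fun j => ?_
  have hmem : ∀ θ ∈ Metric.closedBall (0 : Fin N × κ → ℝ) R, ∀ i,
      unitPar θ i ∈ Metric.closedBall (0 : κ → ℝ) R := by
    intro θ hθ i
    rw [mem_closedBall_zero_iff] at hθ ⊢
    exact (pi_norm_le_iff_of_nonneg ((norm_nonneg _).trans hθ)).2 fun k =>
      (norm_le_pi_norm θ (i, k)).trans hθ
  have hnet : ‖netE F β N θ - netE F β N θ'‖ ≤ (N : ℝ) ^ (-β) * (N * L) * ‖θ - θ'‖ := by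
    unfold netE
    rw [← smul_sub, ← Finset.sum_sub_distrib, norm_smul, Real.norm_of_nonneg (by positivity),
      mul_assoc]
    gcongr
    calc _ ≤ ∑ i : Fin N, L * ‖θ - θ'‖ := by
          refine (norm_sum_le _ _).trans (Finset.sum_le_sum fun i _ => ?_)
          refine ((hL _ (hmem θ' hθ' i) _ (hmem θ hθ i)).1).trans ?_
          gcongr
          exact norm_unitPar_sub_le_norm _ _ i
      _ = _ := by simp [mul_assoc]
  have hJ : ‖J j.2 (unitPar θ j.1) - J j.2 (unitPar θ' j.1)‖ ≤ L * ‖θ - θ'‖ := by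
    refine ((hL _ (hmem θ' hθ' _) _ (hmem θ hθ _)).2 j.2).trans ?_
    gcongr
    exact norm_unitPar_sub_le_norm _ _ _
  have hu : ‖Φ N (A (J j.2 (unitPar θ j.1))) - Φ N (A (J j.2 (unitPar θ' j.1)))‖ ≤
      ‖A‖ * L * ‖θ - θ'‖ := by
    refine (hΦ.norm_sub_le hN _ _).trans ?_
    rw [← map_sub]
    refine (A.le_opNorm _).trans ?_
    rw [mul_assoc]
    gcongr
  have hv : ‖Ψ N (A (netE F β N θ) - g) - Ψ N (A (netE F β N θ') - g)‖ ≤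
      ‖A‖ * ((N : ℝ) ^ (-β) * (N * L)) * ‖θ - θ'‖ := by
    refine (hΨ.norm_sub_le hN _ _).trans ?_
    rw [sub_sub_sub_cancel_right, ← map_sub]
    refine (A.le_opNorm _).trans ?_
    rw [mul_assoc]
    gcongr
  have hin : |inner ℝ (Φ N (A (J j.2 (unitPar θ j.1)))) (Ψ N (A (netE F β N θ) - g)) -
      inner ℝ (Φ N (A (J j.2 (unitPar θ' j.1)))) (Ψ N (A (netE F β N θ') - g))| ≤
      (C' * (N : ℝ) ^ ε) * (‖A‖ * ((N : ℝ) ^ (-β) * (N * L)) * ‖θ - θ'‖) +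
        (‖A‖ * L * ‖θ - θ'‖) * (C * (N : ℝ) ^ δ) := by
    have : inner ℝ (Φ N (A (J j.2 (unitPar θ j.1)))) (Ψ N (A (netE F β N θ) - g)) -
      inner ℝ (Φ N (A (J j.2 (unitPar θ' j.1)))) (Ψ N (A (netE F β N θ') - g)) =
      inner ℝ (Φ N (A (J j.2 (unitPar θ j.1))))
        (Ψ N (A (netE F β N θ) - g) - Ψ N (A (netE F β N θ') - g)) +
      inner ℝ (Φ N (A (J j.2 (unitPar θ j.1))) - Φ N (A (J j.2 (unitPar θ' j.1))))
        (Ψ N (A (netE F β N θ') - g)) := by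
      rw [inner_sub_left, inner_sub_right]; ring
    rw [this]
    refine (abs_add_le _ _).trans (add_le_add ?_ ?_)
    · refine (abs_real_inner_le_norm _ _).trans ?_
      gcongr
      exact hΦ.norm_le N hN _
    · refine (abs_real_inner_le_norm _ _).trans ?_
      gcongr
      exact hΨ.norm_le N hN _
  have heq : ‖(clippedField F J A g (Ψ N) (Φ N) β N θ - clippedField F J A g (Ψ N) (Φ N) β N θ') j‖
      = (N : ℝ) ^ (2 * β - 1) * ((N : ℝ) ^ (-β) *
      |inner ℝ (Φ N (A (J j.2 (unitPar θ j.1)))) (Ψ N (A (netE F β N θ) - g)) -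
      inner ℝ (Φ N (A (J j.2 (unitPar θ' j.1)))) (Ψ N (A (netE F β N θ') - g))|) := by
    rw [Pi.sub_apply, Real.norm_eq_abs, ← abs_of_nonneg (by positivity : 0 ≤ (N : ℝ) ^ (2 * β - 1)),
      ← abs_of_nonneg (by positivity : 0 ≤ (N : ℝ) ^ (-β)), ← abs_mul, ← abs_mul,
      ← abs_neg]
    unfold clippedField
    congr 1; ring
  rw [heq]
  calc _ ≤ (N : ℝ) ^ (2 * β - 1) * ((N : ℝ) ^ (-β) * ((C' * (N : ℝ) ^ ε) *
        (‖A‖ * ((N : ℝ) ^ (-β) * (N * L)) * ‖θ - θ'‖) +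
        (‖A‖ * L * ‖θ - θ'‖) * (C * (N : ℝ) ^ δ))) := by gcongr
    _ = c * ‖θ - θ'‖ := by simp only [c]; ring

/-- The trained parameters depend measurably on the sample. -/
theorem measurable_of_isHilbertTraining {S : Type*} [MeasurableSpace S] (hF : IsFeatureMap ν F J m)
    {C C' δ ε : ℝ} {Ψ Φ : ℕ → H → H} (hΨ : IsClipFamily C δ Ψ) (hΦ : IsClipFamily C' ε Φ) {N : ℕ}
    (hN : 1 ≤ N) {θ : S → ℝ → Fin N × κ → ℝ}
    (hθ : ∀ s, IsHilbertTraining F J A g (Ψ N) (Φ N) β N (θ s))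
    (h0 : Measurable fun s => θ s 0) {t : ℝ} (ht : 0 ≤ t) : Measurable fun s => θ s t := by
  refine measurable_flow (v := clippedField F J A g (Ψ N) (Φ N) β N)
    (B := speedBound C C' β δ ε N) (fun w => ?_)
    (fun R => lipschitzOnWith_clippedField hF hΨ hΦ hN R) hθ h0 ht
  have hC := hΨ.nonneg
  have hC' := hΦ.nonneg
  exact (pi_norm_le_iff_of_nonneg (by unfold speedBound; positivity)).2
    fun j => abs_clippedField_le hΨ hΦ hN w j

/-- Moving a parameter by r changes J by at most m r and Φ(A J) by at most ‖A‖ m r, while the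
remaining clipped factor is at most C' N^ε. All weights are taken at the base point θ, which will be
the initial one, where their mean square has a known expectation. -/
theorem norm_empOp_sub_le (hF : IsFeatureMap ν F J m) {C' ε : ℝ} {Φ : ℕ → H → H}
    (hΦ : IsClipFamily C' ε Φ) {N : ℕ} (hN : 1 ≤ N) {θ θ' : Fin N × κ → ℝ} {r : ℝ} (hr : 0 ≤ r)
    (hr1 : r ≤ 1) (h : ∀ j, |θ' j - θ j| ≤ r) :
    ‖empOp J A (Φ N) N θ' - empOp J A (Φ N) N θ‖ ≤
      Fintype.card κ * (C' * (N : ℝ) ^ ε + ‖A‖) * r * ((N : ℝ)⁻¹ * ∑ i, m (unitPar θ i) ^ 2) := by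
  have hC' := hΦ.nonneg
  unfold empOp
  rw [← smul_sub, ← Finset.sum_sub_distrib, norm_smul, Real.norm_of_nonneg (by positivity),
    mul_left_comm, Finset.mul_sum]
  gcongr
  refine (norm_sum_le _ _).trans (Finset.sum_le_sum fun i _ => ?_)
  refine (norm_finRankOp_sub_le _ _ _ _).trans ?_
  have hm := hF.one_le (unitPar θ i)
  have hd := norm_unitPar_sub_le hr h i
  calc _ ≤ ∑ k : κ, (C' * (N : ℝ) ^ ε + ‖A‖) * r * m (unitPar θ i) ^ 2 := by
        refine Finset.sum_le_sum fun k _ => ?_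
        have h1 : ‖J k (unitPar θ' i) - J k (unitPar θ i)‖ ≤ m (unitPar θ i) * r := by
          refine (hF.lipschitz_J k _ _ (hd.trans hr1)).trans ?_
          gcongr
        have h2 : ‖Φ N (A (J k (unitPar θ' i))) - Φ N (A (J k (unitPar θ i)))‖ ≤
            ‖A‖ * (m (unitPar θ i) * r) := by
          refine (hΦ.norm_sub_le hN _ _).trans ?_
          rw [← map_sub]
          exact (A.le_opNorm _).trans (by gcongr)
        have h3 : ‖Φ N (A (J k (unitPar θ' i)))‖ ≤ C' * (N : ℝ) ^ ε := hΦ.norm_le N hN _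
        have h4 := hF.norm_J_le k (unitPar θ i)
        -- The weight is at least 1, so the term linear in it is absorbed by the quadratic one.
        have h5 : m (unitPar θ i) ≤ m (unitPar θ i) ^ 2 := by nlinarith
        calc _ ≤ (C' * (N : ℝ) ^ ε) * (m (unitPar θ i) * r) +
              (‖A‖ * (m (unitPar θ i) * r)) * m (unitPar θ i) := by gcongr
          _ ≤ (C' * (N : ℝ) ^ ε) * (m (unitPar θ i) ^ 2 * r) +
              (‖A‖ * (m (unitPar θ i) * r)) * m (unitPar θ i) := by gcongr
          _ = _ := by ring
    _ = _ := by simp; ring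

end Dynamics

set_option linter.unusedSectionVars false

/-! ### Mean kernel, its fluctuations, and the pathwise Grönwall estimate. -/

section Comparison

variable {κ H E : Type*} [Fintype κ] [NormedAddCommGroup H] [InnerProductSpace ℝ H]
  [NormedAddCommGroup E] [InnerProductSpace ℝ E] [CompleteSpace E]
  {ν : Measure (κ → ℝ)} {F : (κ → ℝ) → E} {J : κ → (κ → ℝ) → E} {m : (κ → ℝ) → ℝ}
  {A : E →L[ℝ] H} {g : H} {β : ℝ}

/-- The tensor of the tangent kernel of a single unit. -/
noncomputable def tangentTensor (J : κ → (κ → ℝ) → E) (A : E →L[ℝ] H) (Φ : H → H)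
    (p : κ → ℝ) : HilbertTensor H E :=
  finRankTensor (fun k => Φ (A (J k p))) (fun k => J k p)

theorem IsFeatureMap.continuous_clip (hF : IsFeatureMap ν F J m) {Φ : H → H} (hΦ : Continuous Φ)
    (k : κ) : Continuous fun p => Φ (A (J k p)) :=
  hΦ.comp (A.continuous.comp (hF.continuous_J k))

theorem IsFeatureMap.sum_norm_le (hF : IsFeatureMap ν F J m) {Φ : H → H}
    (hΦ : ∀ u, ‖Φ u‖ ≤ ‖u‖) (p : κ → ℝ) :
    ∑ k, ‖Φ (A (J k p))‖ * ‖J k p‖ ≤ Fintype.card κ * ‖A‖ * m p ^ 2 := by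
  have hm : 0 ≤ m p := zero_le_one.trans (hF.one_le p)
  calc _ ≤ ∑ k : κ, (‖A‖ * m p) * m p := by
        refine Finset.sum_le_sum fun k _ => ?_
        have := hF.norm_J_le k p
        gcongr
        exact (hΦ _).trans ((A.le_opNorm _).trans (by gcongr))
    _ = _ := by simp; ring

theorem IsFeatureMap.integrable_finRankOp (hF : IsFeatureMap ν F J m) {Φ : H → H}
    (hΦc : Continuous Φ) (hΦ : ∀ u, ‖Φ u‖ ≤ ‖u‖) :
    Integrable (fun p => finRankOp (fun k => Φ (A (J k p))) (fun k => J k p)) ν :=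
  (hF.integrable_weight_sq.const_mul (Fintype.card κ * ‖A‖)).mono'
    (Continuous.finRankOp (fun k => hF.continuous_clip hΦc k)
      hF.continuous_J).stronglyMeasurable.aestronglyMeasurable
    (Eventually.of_forall fun p => (norm_finRankOp_le _ _).trans (hF.sum_norm_le hΦ p))

theorem IsFeatureMap.continuous_tangentTensor (hF : IsFeatureMap ν F J m) {Φ : H → H}
    (hΦc : Continuous Φ) : Continuous (tangentTensor J A Φ) :=
  Continuous.finRankTensor (fun k => hF.continuous_clip hΦc k) hF.continuous_J

theorem IsFeatureMap.integrable_tangentTensor (hF : IsFeatureMap ν F J m) {Φ : H → H}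
    (hΦc : Continuous Φ) (hΦ : ∀ u, ‖Φ u‖ ≤ ‖u‖) : Integrable (tangentTensor J A Φ) ν :=
  (hF.integrable_weight_sq.const_mul (Fintype.card κ * ‖A‖)).mono'
    (hF.continuous_tangentTensor hΦc).stronglyMeasurable.aestronglyMeasurable
    (Eventually.of_forall fun p => (norm_finRankTensor_le _ _).trans (hF.sum_norm_le hΦ p))

theorem IsFeatureMap.meanOp_apply (hF : IsFeatureMap ν F J m) {Φ : H → H}
    (hΦc : Continuous Φ) (hΦ : ∀ u, ‖Φ u‖ ≤ ‖u‖) (h : H) :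
    meanOp ν J A Φ h = ∫ p, ∑ k, inner ℝ (Φ (A (J k p))) h • J k p ∂ν := by
  rw [meanOp, ContinuousLinearMap.integral_apply (hF.integrable_finRankOp hΦc hΦ)]
  simp only [finRankOp_apply]

/-- The operator norm is not Hilbertian and has no variance identity; it is bounded by the norm of
the associated tensor, an empirical mean minus its expectation in a Hilbert space. -/
theorem norm_empOp_sub_meanOp_apply_le (hF : IsFeatureMap ν F J m) {Φ : H → H}
    (hΦc : Continuous Φ) (hΦ : ∀ u, ‖Φ u‖ ≤ ‖u‖) {N : ℕ} (θ : Fin N × κ → ℝ) (v : H) :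
    ‖(empOp J A Φ N θ - meanOp ν J A Φ) v‖ ≤
      ‖v‖ * ‖(N : ℝ)⁻¹ • ∑ i, tangentTensor J A Φ (unitPar θ i) - ∫ p, tangentTensor J A Φ p ∂ν‖ := by
  have hint := hF.integrable_finRankOp (A := A) hΦc hΦ
  refine norm_le_of_inner_eq_htmul fun e => ?_
  rw [_root_.sub_apply, inner_sub_right, inner_sub_right, empOp, inner_smul_right]
  congr 1
  · simp only [_root_.smul_apply, _root_.sum_apply, inner_smul_right, inner_sum, inner_finRankOp,
      tangentTensor]
  · rw [meanOp, ContinuousLinearMap.integral_apply hint,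
      ← integral_inner (hint.apply_continuousLinearMap v),
      ← integral_inner (hF.integrable_tangentTensor hΦc hΦ)]
    exact integral_congr_ae (Eventually.of_forall fun p => inner_finRankOp _ _ _ _)

theorem IsClipFamily.continuous {H : Type*} [NormedAddCommGroup H] {C γ : ℝ} {Φ : ℕ → H → H}
    (h : IsClipFamily C γ Φ) {N : ℕ} (hN : 1 ≤ N) : Continuous (Φ N) :=
  (h.lipschitz N hN).continuous

/-- Clipping never increases norms, so a multiple of m², independent of N, dominates the integrands,
and the clipped kernels of a single unit converge pointwise. -/
theorem tendsto_meanOp (hF : IsFeatureMap ν F J m) {C γ : ℝ} {Φ : ℕ → H → H}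
    (hΦ : IsClipFamily C γ Φ) :
    Tendsto (fun N => meanOp ν J A (Φ N)) atTop (𝓝 (meanOp ν J A id)) := by
  unfold meanOp
  refine tendsto_integral_filter_of_dominated_convergence
    (fun p => Fintype.card κ * ‖A‖ * m p ^ 2) ?_ ?_ (hF.integrable_weight_sq.const_mul _) ?_
  · filter_upwards [eventually_ge_atTop 1] with N hN
    exact (hF.integrable_finRankOp (hΦ.continuous hN) (hΦ.norm_le_norm hN)).1
  · filter_upwards [eventually_ge_atTop 1] with N hN
    exact Eventually.of_forall fun p =>
      (norm_finRankOp_le _ _).trans (hF.sum_norm_le (hΦ.norm_le_norm hN) p)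
  · refine Eventually.of_forall fun p => ?_
    rw [tendsto_iff_norm_sub_tendsto_zero]
    refine squeeze_zero (fun _ => norm_nonneg _) (fun N => norm_finRankOp_sub_le _ _ _ _) ?_
    have : Tendsto (fun N => ∑ k, (‖Φ N (A (J k p))‖ * ‖J k p - J k p‖ +
        ‖Φ N (A (J k p)) - id (A (J k p))‖ * ‖J k p‖)) atTop (𝓝 (∑ k : κ,
          (‖A (J k p)‖ * ‖J k p - J k p‖ + ‖A (J k p) - id (A (J k p))‖ * ‖J k p‖))) := by
      refine tendsto_finsetSum _ fun k _ => ?_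
      have h1 := hΦ.tendsto (A (J k p))
      exact (h1.norm.mul_const _).add ((h1.sub_const _).norm.mul_const _)
    simpa using this

/-- Clipping is uniformly close to the identity on compact sets. -/
theorem IsClipFamily.exists_tendsto_bound {H : Type*} [NormedAddCommGroup H] {C γ : ℝ}
    {Ψ : ℕ → H → H} (hΨ : IsClipFamily C γ Ψ) {K : Set H} (hK : IsCompact K) :
    ∃ ρ : ℕ → ℝ, Tendsto ρ atTop (𝓝 0) ∧ (∀ N, 0 ≤ ρ N) ∧
      ∀ N, 1 ≤ N → ∀ v ∈ K, ‖Ψ N v - v‖ ≤ ρ N := by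
  refine ⟨fun N => ⨆ v : K, ‖Ψ N v - v‖, ?_, fun N => Real.iSup_nonneg fun _ => norm_nonneg _, ?_⟩
  · rw [Metric.tendsto_atTop]
    intro τ hτ
    -- Equicontinuity argument: with the 1-Lipschitz bound, the error at v exceeds that at the
    -- nearest point of the finite net by at most twice the mesh, so the total is at most 3τ/8.
    obtain ⟨t, htK, hcov⟩ := hK.elim_nhds_subcover (fun v => Metric.ball v (τ / 8))
      (fun v _ => Metric.ball_mem_nhds v (by positivity))
    have hev : ∀ᶠ N in atTop, ∀ v ∈ t, ‖Ψ N v - v‖ < τ / 8 := by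
      refine (t.eventually_all).2 fun v _ => ?_
      have := (tendsto_iff_norm_sub_tendsto_zero.1 (hΨ.tendsto v))
      exact this.eventually (gt_mem_nhds (by positivity))
    obtain ⟨N₀, hN₀⟩ := eventually_atTop.1 (hev.and (eventually_ge_atTop 1))
    refine ⟨N₀, fun N hN => ?_⟩
    obtain ⟨h1, hN1⟩ := hN₀ N hN
    have hle : (⨆ v : K, ‖Ψ N v - v‖) ≤ τ / 2 := by
      refine Real.iSup_le (fun v => ?_) (by positivity)
      obtain ⟨w, hw, hvw⟩ := mem_iUnion₂.1 (hcov v.2)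
      rw [Metric.mem_ball, dist_eq_norm] at hvw
      have h2 := hΨ.norm_sub_le hN1 (v : H) w
      have h3 := h1 w hw
      have h4 : Ψ N v - v = (Ψ N v - Ψ N w) + (Ψ N w - w) + (w - v) := by abel
      rw [h4]
      have h5 := norm_add₃_le (a := Ψ N v - Ψ N w) (b := Ψ N w - w) (c := w - v)
      rw [norm_sub_rev w] at h5
      linarith
    rw [Real.dist_eq, sub_zero, abs_of_nonneg (Real.iSup_nonneg fun _ => norm_nonneg _)]
    linarith
  · intro N hN v hv
    refine le_ciSup (f := fun v : K => ‖Ψ N v - v‖) ?_ ⟨v, hv⟩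
    obtain ⟨M, hM⟩ := hK.exists_bound_of_continuousOn
      (f := fun v => Ψ N v - v) ((hΨ.continuous hN).sub continuous_id).continuousOn
    exact ⟨M, by rintro _ ⟨w, rfl⟩; exact hM w w.2⟩

/-- The pathwise comparison of the network with the solution of the limit equation. -/
theorem IsHilbertTraining.norm_sub_le (hF : IsFeatureMap ν F J m) {C C' δ ε : ℝ}
    {Ψ Φ : ℕ → H → H} (hΨ : IsClipFamily C δ Ψ) (hΦ : IsClipFamily C' ε Φ) {N : ℕ} (hN : 1 ≤ N)
    {θ : ℝ → Fin N × κ → ℝ} (hθ : IsHilbertTraining F J A g (Ψ N) (Φ N) β N θ)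
    {Q : ℝ → E} (hQ0 : Q 0 = 0)
    (hQ : ∀ t, 0 ≤ t → HasDerivWithinAt Q (-(meanOp ν J A id (A (Q t) - g))) (Ici 0) t)
    {T : ℝ} (hT : 0 ≤ T) (hr : speedBound C C' β δ ε N * T ≤ 1) {M ρ b L : ℝ}
    (hM : ∀ t ∈ Icc 0 T, ‖A (Q t) - g‖ ≤ M)
    (hρ : ∀ t ∈ Icc 0 T, ‖Ψ N (A (Q t) - g) - (A (Q t) - g)‖ ≤ ρ)
    (hb : ‖meanOp ν J A (Φ N) - meanOp ν J A id‖ ≤ b)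
    (hL : (b + ‖meanOp ν J A id‖) * ‖A‖ ≤ L) :
    ‖netE F β N (θ T) - Q T‖ ≤ gronwallBound ‖netE F β N (θ 0)‖ L
      (C * (N : ℝ) ^ δ * (Fintype.card κ * (C' * (N : ℝ) ^ ε + ‖A‖) *
          (speedBound C C' β δ ε N * T) * ((N : ℝ)⁻¹ * ∑ i, m (unitPar (θ 0) i) ^ 2) +
        ‖(N : ℝ)⁻¹ • ∑ i, tangentTensor J A (Φ N) (unitPar (θ 0) i) -
          ∫ p, tangentTensor J A (Φ N) p ∂ν‖) + (b * M + ‖meanOp ν J A id‖ * ρ)) T := by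
  have hC := hΨ.nonneg
  have hC' := hΦ.nonneg
  have hs : 0 ≤ speedBound C C' β δ ε N := by unfold speedBound; positivity
  have hb0 : 0 ≤ b := (norm_nonneg _).trans hb
  have hd : ∀ t, 0 ≤ t → HasDerivWithinAt (fun r => netE F β N (θ r) - Q r)
      (-(empOp J A (Φ N) N (θ t) (Ψ N (A (netE F β N (θ t)) - g))) -
        -(meanOp ν J A id (A (Q t) - g))) (Ici 0) t := fun t ht =>
    (hθ.hasDerivWithinAt_netE hF hN ht).sub (hQ t ht)
  have := norm_le_gronwallBound_of_norm_deriv_right_le (a := 0) (b := T)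
    (f := fun r => netE F β N (θ r) - Q r) (δ := ‖netE F β N (θ 0)‖) (K := L)
    (fun t ht => ((hd t ht.1).continuousWithinAt.mono Icc_subset_Ici_self))
    (fun t ht => (hd t ht.1).mono (Ici_subset_Ici.2 ht.1)) (by simp [hQ0])
    (ε := C * (N : ℝ) ^ δ * (Fintype.card κ * (C' * (N : ℝ) ^ ε + ‖A‖) *
          (speedBound C C' β δ ε N * T) * ((N : ℝ)⁻¹ * ∑ i, m (unitPar (θ 0) i) ^ 2) +
        ‖(N : ℝ)⁻¹ • ∑ i, tangentTensor J A (Φ N) (unitPar (θ 0) i) -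
          ∫ p, tangentTensor J A (Φ N) p ∂ν‖) + (b * M + ‖meanOp ν J A id‖ * ρ)) ?_
    T (right_mem_Icc.2 hT)
  · simpa using this
  intro t ht
  have htI : t ∈ Icc 0 T := ⟨ht.1, ht.2.le⟩
  set q := netE F β N (θ t) with hq
  set v := Ψ N (A q - g) with hv
  set h := A (Q t) - g with hh
  -- Four sources of error: motion of the parameters since time 0, sampling of the initial
  -- parameters, clipping inside the kernel, and the difference of residuals, which contains both
  -- the feedback and the clipping of the residual.
  have hdec : -(empOp J A (Φ N) N (θ t) v) - -(meanOp ν J A id h) =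
      -((empOp J A (Φ N) N (θ t) - empOp J A (Φ N) N (θ 0)) v +
        (empOp J A (Φ N) N (θ 0) - meanOp ν J A (Φ N)) v +
        (meanOp ν J A (Φ N) - meanOp ν J A id) v + meanOp ν J A id (v - h)) := by
    simp only [_root_.sub_apply, map_sub]
    abel
  have hAD : ‖A q - g - h‖ ≤ ‖A‖ * ‖q - Q t‖ := by
    rw [hh, sub_sub_sub_cancel_right, ← map_sub]
    exact A.le_opNorm _
  -- The clipping level bounds v where the operator difference is small by a power of N; the bound
  -- `hv2` by the distance to Q is used where only convergence to 0 without a rate is known.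
  have hv1 : ‖v‖ ≤ C * (N : ℝ) ^ δ := hΨ.norm_le N hN _
  have hv2 : ‖v‖ ≤ ‖A‖ * ‖q - Q t‖ + M := by
    refine (hΨ.norm_le_norm hN _).trans ?_
    have h1 : ‖A q - g‖ ≤ ‖A q - g - h‖ + ‖h‖ := by simpa using norm_add_le (A q - g - h) h
    linarith [hM t htI]
  have hvh : ‖v - h‖ ≤ ‖A‖ * ‖q - Q t‖ + ρ := by
    have h1 : v - h = (v - Ψ N h) + (Ψ N h - h) := by abel
    rw [h1]
    refine (norm_add_le _ _).trans (add_le_add ?_ (hρ t htI))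
    exact (hΨ.norm_sub_le hN _ _).trans hAD
  have e1 : ‖(empOp J A (Φ N) N (θ t) - empOp J A (Φ N) N (θ 0)) v‖ ≤
      C * (N : ℝ) ^ δ * (Fintype.card κ * (C' * (N : ℝ) ^ ε + ‖A‖) *
          (speedBound C C' β δ ε N * T) * ((N : ℝ)⁻¹ * ∑ i, m (unitPar (θ 0) i) ^ 2)) := by
    refine (ContinuousLinearMap.le_opNorm _ _).trans ?_
    rw [mul_comm]
    have h1 := norm_empOp_sub_le (A := A) hF hΦ hN (by positivity) hr
      (θ := θ 0) (θ' := θ t) fun j => (hθ.abs_sub_le hΨ hΦ hN ht.1 j).trans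
        (by gcongr; exact ht.2.le)
    gcongr
  have e2 : ‖(empOp J A (Φ N) N (θ 0) - meanOp ν J A (Φ N)) v‖ ≤ C * (N : ℝ) ^ δ *
      ‖(N : ℝ)⁻¹ • ∑ i, tangentTensor J A (Φ N) (unitPar (θ 0) i) -
          ∫ p, tangentTensor J A (Φ N) p ∂ν‖ := by
    refine (norm_empOp_sub_meanOp_apply_le hF (hΦ.continuous hN) (hΦ.norm_le_norm hN)
      (θ 0) v).trans ?_
    gcongr
  have e3 : ‖(meanOp ν J A (Φ N) - meanOp ν J A id) v‖ ≤ b * (‖A‖ * ‖q - Q t‖ + M) :=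
    (ContinuousLinearMap.le_opNorm _ _).trans (by gcongr)
  have e4 : ‖meanOp ν J A id (v - h)‖ ≤ ‖meanOp ν J A id‖ * (‖A‖ * ‖q - Q t‖ + ρ) :=
    (ContinuousLinearMap.le_opNorm _ _).trans (by gcongr)
  have e5 : (b + ‖meanOp ν J A id‖) * ‖A‖ * ‖q - Q t‖ ≤ L * ‖q - Q t‖ := by gcongr
  rw [hdec, norm_neg]
  refine (norm_add_le _ _).trans ?_
  have e6 := norm_add₃_le (a := (empOp J A (Φ N) N (θ t) - empOp J A (Φ N) N (θ 0)) v)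
    (b := (empOp J A (Φ N) N (θ 0) - meanOp ν J A (Φ N)) v)
    (c := (meanOp ν J A (Φ N) - meanOp ν J A id) v)
  linarith

end Comparison

set_option linter.unusedSectionVars false

/-! ### Convergence in expectation of the network to the solution of the limit equation. -/

section Limit

variable {κ H E : Type*} [Fintype κ] [NormedAddCommGroup H] [InnerProductSpace ℝ H]
  [NormedAddCommGroup E] [InnerProductSpace ℝ E] [CompleteSpace E]
  {ν : Measure (κ → ℝ)} {F : (κ → ℝ) → E} {J : κ → (κ → ℝ) → E} {m : (κ → ℝ) → ℝ}
  {A : E →L[ℝ] H} {g : H} {β : ℝ}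

/-- Clipping one of the two factors makes the tensor linear instead of quadratic in the weight, at
the price of N^ε. A square integrable weight then suffices for the variance bound. -/
theorem norm_tangentTensor_le (hF : IsFeatureMap ν F J m) {C' ε : ℝ} {Φ : ℕ → H → H}
    (hΦ : IsClipFamily C' ε Φ) {N : ℕ} (hN : 1 ≤ N) (p : κ → ℝ) :
    ‖tangentTensor J A (Φ N) p‖ ≤ (Fintype.card κ * (C' * (N : ℝ) ^ ε)) * m p := by
  have hC' := hΦ.nonneg
  refine (norm_finRankTensor_le _ _).trans ?_
  calc _ ≤ ∑ k : κ, (C' * (N : ℝ) ^ ε) * m p := by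
        refine Finset.sum_le_sum fun k _ => ?_
        gcongr
        · exact hΦ.norm_le N hN _
        · exact hF.norm_J_le k p
    _ = _ := by simp; ring

theorem tendsto_natCast_rpow_of_neg {c : ℝ} (hc : c < 0) :
    Tendsto (fun N : ℕ => (N : ℝ) ^ c) atTop (𝓝 0) := by
  have := (tendsto_rpow_neg_atTop (neg_pos.2 hc)).comp tendsto_natCast_atTop_atTop
  simpa [Function.comp_def] using this

theorem ofReal_linear_combination {G a x c W e f d : ℝ} (hG : 0 ≤ G) (ha : 0 ≤ a) (hx : 0 ≤ x)
    (hc : 0 ≤ c) (hW : 0 ≤ W) (he : 0 ≤ e) (hf : 0 ≤ f) (hd : 0 ≤ d) :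
    ENNReal.ofReal (G * (a * x + (c * W + e * f + d))) =
      ENNReal.ofReal G * (ENNReal.ofReal a * ENNReal.ofReal x +
        (ENNReal.ofReal c * ENNReal.ofReal W + ENNReal.ofReal e * ENNReal.ofReal f +
          ENNReal.ofReal d)) := by
  rw [ENNReal.ofReal_mul hG, ENNReal.ofReal_add (by positivity) (by positivity),
    ENNReal.ofReal_add (by positivity) hd, ENNReal.ofReal_add (by positivity) (by positivity),
    ENNReal.ofReal_mul ha, ENNReal.ofReal_mul hc, ENNReal.ofReal_mul he]

/-- The condition 1 ≤ L removes the division by L in the Grönwall bound and leaves an expression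
linear in the errors, ready to be integrated over the sample. -/
theorem gronwallBound_le {x L e T : ℝ} (hL : 1 ≤ L) (he : 0 ≤ e) :
    gronwallBound x L e T ≤ Real.exp (L * T) * (x + e) := by
  rw [gronwallBound_of_K_ne_0 (by positivity)]
  have h1 : e / L * (Real.exp (L * T) - 1) ≤ e * Real.exp (L * T) := by
    have h2 : e / L ≤ e := div_le_self he hL
    have h3 := Real.exp_pos (L * T)
    have h4 : 0 ≤ e / L := by positivity
    nlinarith
  nlinarith

theorem speedBound_eq (C C' β δ ε : ℝ) {N : ℕ} (hN : 1 ≤ N) :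
    speedBound C C' β δ ε N = C * C' * (N : ℝ) ^ (β - 1 + δ + ε) := by
  have hN0 : (0 : ℝ) < N := by exact_mod_cast hN
  have : (N : ℝ) ^ (β - 1 + δ + ε) =
      (N : ℝ) ^ (2 * β - 1) * (N : ℝ) ^ (-β) * (N : ℝ) ^ δ * (N : ℝ) ^ ε := by
    rw [← Real.rpow_add hN0, ← Real.rpow_add hN0, ← Real.rpow_add hN0]
    congr 1; ring
  rw [this, speedBound]; ring

variable {S : Type*} [MeasurableSpace S] {P : Measure S} [IsProbabilityMeasure P]
  [IsProbabilityMeasure ν] {X : ℕ → S → κ → ℝ}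

theorem lintegral_mean_weight_sq (hF : IsFeatureMap ν F J m) (hXm : ∀ i, Measurable (X i))
    (hXν : ∀ i, P.map (X i) = ν) {N : ℕ} (hN : 1 ≤ N) :
    ∫⁻ s, ENNReal.ofReal ((N : ℝ)⁻¹ * ∑ i : Fin N, m (X i s) ^ 2) ∂P =
      ENNReal.ofReal (∫ p, m p ^ 2 ∂ν) := by
  have hN0 : (0 : ℝ) < N := by exact_mod_cast hN
  have hi : ∀ i, Integrable (fun s => m (X i s) ^ 2) P := fun i =>
    (show Integrable (fun p => m p ^ 2) (P.map (X i)) by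
      rw [hXν i]; exact hF.integrable_weight_sq).comp_measurable (hXm i)
  rw [← ofReal_integral_eq_lintegral_ofReal
    ((integrable_finsetSum Finset.univ fun (i : Fin N) _ => hi i).const_mul _)
    (Eventually.of_forall fun s => by positivity)]
  congr 1
  rw [integral_const_mul, integral_finsetSum Finset.univ fun (i : Fin N) _ => hi i]
  have : ∀ i : Fin N, ∫ s, m (X i s) ^ 2 ∂P = ∫ p, m p ^ 2 ∂ν := fun i => by
    rw [← hXν i, integral_map (hXm i).aemeasurable]
    exact (hF.continuous_weight.pow 2).aestronglyMeasurable
  simp [this, hN0.ne']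

/-- The expectation of the pathwise bound is a constant times x₀ + c₁ W + x₂ + x₃: initial network,
parameter motion, sampling fluctuation, and clipping. Each of x₀, c₁, x₂, x₃ tends to 0. -/
theorem tendsto_lintegral_netE_sub (hF : IsFeatureMap ν F J m) {C C' δ ε : ℝ}
    {Ψ Φ : ℕ → H → H} (hΨ : IsClipFamily C δ Ψ) (hΦ : IsClipFamily C' ε Φ)
    (hβ : 1 / 2 < β) (hδ : 0 ≤ δ) (hε : 0 ≤ ε) (hεδ : ε + δ < (1 - β) / 2)
    (hXm : ∀ i, Measurable (X i)) (hXν : ∀ i, P.map (X i) = ν) (hind : iIndepFun X P)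
    {θ : (N : ℕ) → S → ℝ → Fin N × κ → ℝ} (h0 : ∀ N s j, θ N s 0 j = X j.1 s j.2)
    (hθ : ∀ N, 1 ≤ N → ∀ s, IsHilbertTraining F J A g (Ψ N) (Φ N) β N (θ N s))
    {Q : ℝ → E} (hQ0 : Q 0 = 0)
    (hQ : ∀ t, 0 ≤ t → HasDerivWithinAt Q (-(meanOp ν J A id (A (Q t) - g))) (Ici 0) t)
    {T : ℝ} (hT : 0 ≤ T) :
    Tendsto (fun N => ∫⁻ s, ‖netE F β N (θ N s T) - Q T‖ₑ ∂P) atTop (𝓝 0) := by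
  have hC := hΨ.nonneg
  have hC' := hΦ.nonneg
  have hup : ∀ N s i, unitPar (θ N s 0) i = X i s := fun N s i => funext fun k => h0 N s (i, k)
  have hQc : ContinuousOn (fun t => A (Q t) - g) (Icc 0 T) := fun t ht =>
    ((A.continuous.continuousAt.comp_continuousWithinAt
      ((hQ t ht.1).continuousWithinAt.mono Icc_subset_Ici_self)).sub continuousWithinAt_const)
  obtain ⟨M, hM⟩ := isCompact_Icc.exists_bound_of_continuousOn hQc
  obtain ⟨ρ, hρ0, hρn, hρ⟩ := hΨ.exists_tendsto_bound (isCompact_Icc.image_of_continuousOn hQc)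
  have hM0 : 0 ≤ M := (norm_nonneg _).trans (hM 0 (left_mem_Icc.2 hT))
  set U := meanOp ν J A id with hU
  set b : ℕ → ℝ := fun N => ‖meanOp ν J A (Φ N) - U‖ with hb
  have hb0 : Tendsto b atTop (𝓝 0) := tendsto_iff_norm_sub_tendsto_zero.1 (tendsto_meanOp hF hΦ)
  -- The 1 next to ‖U‖ dominates b N for large N; the final 1 ensures 1 ≤ L for `gronwallBound_le`.
  set L : ℝ := (1 + ‖U‖) * ‖A‖ + 1 with hL
  set G : ℝ := Real.exp (L * T) with hG
  set c₁ : ℕ → ℝ := fun N => C * (N : ℝ) ^ δ * (Fintype.card κ * (C' * (N : ℝ) ^ ε + ‖A‖) *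
    (speedBound C C' β δ ε N * T)) with hc₁
  set x₀ : ℕ → ℝ := fun N => (N : ℝ) ^ (-β) * (√N * √(∫ p, ‖F p‖ ^ 2 ∂ν)) with hx₀
  set x₂ : ℕ → ℝ := fun N => C * (N : ℝ) ^ δ * ((N : ℝ) ^ (-(1 / 2 : ℝ)) *
    (2 * (Fintype.card κ * (C' * (N : ℝ) ^ ε)) * (eLpNorm m 2 ν).toReal)) with hx₂
  set x₃ : ℕ → ℝ := fun N => b N * M + ‖U‖ * ρ N with hx₃
  have hs0 : ∀ N, 0 ≤ speedBound C C' β δ ε N := fun N => by unfold speedBound; positivity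
  have hc₁n : ∀ N, 0 ≤ c₁ N := fun N => by have := hs0 N; simp only [hc₁]; positivity
  have hx₃n : ∀ N, 0 ≤ x₃ N := fun N => by have := hρn N; simp only [hx₃, hb]; positivity
  set W : ℝ := ∫ p, m p ^ 2 ∂ν with hW
  have hWn : 0 ≤ W := integral_nonneg fun p => by positivity
  have hspeed : Tendsto (fun N => speedBound C C' β δ ε N * T) atTop (𝓝 0) := by
    have h1 : Tendsto (fun N : ℕ => C * C' * (N : ℝ) ^ (β - 1 + δ + ε) * T) atTop (𝓝 0) := by
      simpa using ((tendsto_natCast_rpow_of_neg (by linarith)).const_mul (C * C')).mul_const T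
    refine h1.congr' ?_
    filter_upwards [eventually_ge_atTop 1] with N hN
    rw [speedBound_eq _ _ _ _ _ hN]
  -- The larger exponent is 2(δ + ε) - (1 - β), and its negativity is the hypothesis on ε + δ.
  have hc₁0 : Tendsto c₁ atTop (𝓝 0) := by
    have h1 : Tendsto (fun N : ℕ => C * Fintype.card κ * (C * C') * T *
        (C' * (N : ℝ) ^ (δ + ε + (β - 1 + δ + ε)) + ‖A‖ * (N : ℝ) ^ (δ + (β - 1 + δ + ε))))
        atTop (𝓝 0) := by
      have := (((tendsto_natCast_rpow_of_neg (c := δ + ε + (β - 1 + δ + ε))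
        (by linarith)).const_mul C').add ((tendsto_natCast_rpow_of_neg
        (c := δ + (β - 1 + δ + ε)) (by linarith)).const_mul ‖A‖)).const_mul
          (C * Fintype.card κ * (C * C') * T)
      simpa using this
    refine h1.congr' ?_
    filter_upwards [eventually_ge_atTop 1] with N hN
    have hN0 : (0 : ℝ) < N := by exact_mod_cast hN
    simp only [hc₁]
    rw [speedBound_eq _ _ _ _ _ hN, Real.rpow_add hN0 (δ + ε), Real.rpow_add hN0 δ ε,
      Real.rpow_add hN0 δ (β - 1 + δ + ε)]
    ring
  -- The exponent is 1/2 - β: this is where β > 1/2 enters.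
  have hx₀0 : Tendsto x₀ atTop (𝓝 0) := by
    have h1 : Tendsto (fun N : ℕ => (N : ℝ) ^ (1 / 2 - β) * √(∫ p, ‖F p‖ ^ 2 ∂ν)) atTop (𝓝 0) := by
      simpa using (tendsto_natCast_rpow_of_neg (c := 1 / 2 - β) (by linarith)).mul_const
        (√(∫ p, ‖F p‖ ^ 2 ∂ν))
    refine h1.congr' ?_
    filter_upwards [eventually_ge_atTop 1] with N hN
    have hN0 : (0 : ℝ) < N := by exact_mod_cast hN
    simp only [hx₀]
    rw [← mul_assoc, Real.sqrt_eq_rpow (N : ℝ), ← Real.rpow_add hN0]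
    congr 2; ring
  -- The exponent δ + ε - 1/2 is negative since β > 1/2 already forces ε + δ < 1/4.
  have hx₂0 : Tendsto x₂ atTop (𝓝 0) := by
    have h1 : Tendsto (fun N : ℕ => (N : ℝ) ^ (δ + ε + -(1 / 2)) *
        (C * 2 * Fintype.card κ * C' * (eLpNorm m 2 ν).toReal)) atTop (𝓝 0) := by
      simpa using (tendsto_natCast_rpow_of_neg (c := δ + ε + -(1 / 2)) (by linarith)).mul_const
        (C * 2 * Fintype.card κ * C' * (eLpNorm m 2 ν).toReal)
    refine h1.congr' ?_
    filter_upwards [eventually_ge_atTop 1] with N hN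
    have hN0 : (0 : ℝ) < N := by exact_mod_cast hN
    simp only [hx₂]
    rw [Real.rpow_add hN0, Real.rpow_add hN0 δ]
    ring
  have hx₃0 : Tendsto x₃ atTop (𝓝 0) := by
    simpa using (hb0.mul_const M).add (hρ0.const_mul ‖U‖)
  have hlim : Tendsto (fun N => ENNReal.ofReal (G * (x₀ N + (c₁ N * W + x₂ N + x₃ N)))) atTop
      (𝓝 0) := by
    have h1 : Tendsto (fun N => G * (x₀ N + (c₁ N * W + x₂ N + x₃ N))) atTop (𝓝 0) := by
      simpa using (hx₀0.add (((hc₁0.mul_const W).add hx₂0).add hx₃0)).const_mul G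
    simpa using ENNReal.tendsto_ofReal h1
  refine tendsto_of_tendsto_of_tendsto_of_le_of_le' tendsto_const_nhds hlim
    (Eventually.of_forall fun _ => zero_le) ?_
  -- N is so large that no parameter moves by more than 1 up to time T, which is the range of the
  -- Lipschitz bound on J, and that b N < 1.
  filter_upwards [eventually_ge_atTop 1, hspeed.eventually (gt_mem_nhds one_pos),
    hb0.eventually (gt_mem_nhds one_pos)] with N hN hsp hb1
  set Fl : S → HilbertTensor H E := fun s => (N : ℝ)⁻¹ • ∑ i : Fin N,
    tangentTensor J A (Φ N) (X i s) - ∫ p, tangentTensor J A (Φ N) p ∂ν with hFl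
  set Wm : S → ℝ := fun s => (N : ℝ)⁻¹ * ∑ i : Fin N, m (X i s) ^ 2 with hWm
  have hWmn : ∀ s, 0 ≤ Wm s := fun s => by simp only [hWm]; positivity
  have hpt : ∀ s, ‖netE F β N (θ N s T) - Q T‖ₑ ≤ ENNReal.ofReal G *
      (ENNReal.ofReal ((N : ℝ) ^ (-β)) * ‖∑ i : Fin N, F (X i s)‖ₑ +
        (ENNReal.ofReal (c₁ N) * ENNReal.ofReal (Wm s) +
          ENNReal.ofReal (C * (N : ℝ) ^ δ) * ‖Fl s‖ₑ + ENNReal.ofReal (x₃ N))) := by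
    intro s
    have h1 := (hθ N hN s).norm_sub_le (L := L) (M := M) (ρ := ρ N) (b := b N)
      hF hΨ hΦ hN hQ0 hQ hT hsp.le hM
      (fun t ht => hρ N hN _ (mem_image_of_mem _ ht)) le_rfl (by
        have : (b N + ‖U‖) * ‖A‖ ≤ (1 + ‖U‖) * ‖A‖ := by gcongr
        linarith)
    have h2 : netE F β N (θ N s 0) = (N : ℝ) ^ (-β) • ∑ i : Fin N, F (X i s) := by
      simp only [netE, hup]
    simp only [hup] at h1
    have h3 : ‖netE F β N (θ N s T) - Q T‖ ≤ G * ((N : ℝ) ^ (-β) * ‖∑ i : Fin N, F (X i s)‖ +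
        (c₁ N * Wm s + C * (N : ℝ) ^ δ * ‖Fl s‖ + x₃ N)) := by
      refine h1.trans ((gronwallBound_le ?_ ?_).trans (le_of_eq ?_))
      · have : 0 ≤ (1 + ‖U‖) * ‖A‖ := by positivity
        linarith
      · have := hs0 N
        have := hWmn s
        have := hx₃n N
        exact add_nonneg (by positivity) this
      · rw [h2, norm_smul, Real.norm_of_nonneg (by positivity)]
        simp only [hc₁, hx₃, hWm, hFl, hG]
        ring
    rw [← ofReal_norm, ← ofReal_norm, ← ofReal_norm, ← ofReal_linear_combination
      (Real.exp_pos _).le (by positivity) (norm_nonneg _) (hc₁n N) (hWmn s) (by positivity)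
      (norm_nonneg _) (hx₃n N)]
    exact ENNReal.ofReal_le_ofReal h3
  have hTc : Continuous (tangentTensor J A (Φ N)) := hF.continuous_tangentTensor (hΦ.continuous hN)
  have hWmeas : Measurable Wm := by
    have hm := hF.continuous_weight.measurable
    exact (Finset.measurable_fun_sum Finset.univ fun (i : Fin N) _ => (hm.comp (hXm i)).pow_const 2).const_mul _
  have hFmeas : Measurable fun s => ‖∑ i : Fin N, F (X i s)‖ₑ := by
    have : StronglyMeasurable fun s => ∑ i : Fin N, F (X i s) :=
      Finset.stronglyMeasurable_fun_sum _ fun i _ =>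
        hF.continuous_F.stronglyMeasurable.comp_measurable (hXm i)
    exact this.enorm
  have i1 : ∫⁻ s, ‖∑ i : Fin N, F (X i s)‖ₑ ∂P ≤ ENNReal.ofReal (√N * √(∫ p, ‖F p‖ ^ 2 ∂ν)) :=
    lintegral_enorm_sum_le hXm hXν hind hF.continuous_F.stronglyMeasurable hF.memLp_F
      hF.integral_F N
  have i2 : ∫⁻ s, ENNReal.ofReal (Wm s) ∂P = ENNReal.ofReal W :=
    lintegral_mean_weight_sq hF hXm hXν hN
  have i3 : ∫⁻ s, ‖Fl s‖ₑ ∂P ≤ ENNReal.ofReal ((N : ℝ) ^ (-(1 / 2 : ℝ)) *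
      (2 * (Fintype.card κ * (C' * (N : ℝ) ^ ε)) * (eLpNorm m 2 ν).toReal)) :=
    lintegral_enorm_mean_sub_le hXm hXν hind hTc.stronglyMeasurable (by positivity)
      hF.memLp_weight (norm_tangentTensor_le hF hΦ hN) hN
  calc ∫⁻ s, ‖netE F β N (θ N s T) - Q T‖ₑ ∂P
      ≤ ∫⁻ s, ENNReal.ofReal G *
      (ENNReal.ofReal ((N : ℝ) ^ (-β)) * ‖∑ i : Fin N, F (X i s)‖ₑ +
        (ENNReal.ofReal (c₁ N) * ENNReal.ofReal (Wm s) +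
          ENNReal.ofReal (C * (N : ℝ) ^ δ) * ‖Fl s‖ₑ + ENNReal.ofReal (x₃ N))) ∂P :=
        lintegral_mono hpt
    _ = ENNReal.ofReal G * (ENNReal.ofReal ((N : ℝ) ^ (-β)) * ∫⁻ s, ‖∑ i : Fin N, F (X i s)‖ₑ ∂P +
        (ENNReal.ofReal (c₁ N) * ∫⁻ s, ENNReal.ofReal (Wm s) ∂P +
          ENNReal.ofReal (C * (N : ℝ) ^ δ) * ∫⁻ s, ‖Fl s‖ₑ ∂P + ENNReal.ofReal (x₃ N))) := by
        rw [lintegral_const_mul' _ _ ENNReal.ofReal_ne_top,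
          lintegral_add_left (hFmeas.const_mul _), lintegral_const_mul' _ _ ENNReal.ofReal_ne_top,
          lintegral_add_right _ measurable_const,
          lintegral_add_left (hWmeas.ennreal_ofReal.const_mul _),
          lintegral_const_mul' _ _ ENNReal.ofReal_ne_top,
          lintegral_const_mul' _ _ ENNReal.ofReal_ne_top]
        simp
    _ ≤ ENNReal.ofReal G * (ENNReal.ofReal ((N : ℝ) ^ (-β)) *
          ENNReal.ofReal (√N * √(∫ p, ‖F p‖ ^ 2 ∂ν)) +
        (ENNReal.ofReal (c₁ N) * ENNReal.ofReal W + ENNReal.ofReal (C * (N : ℝ) ^ δ) *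
          ENNReal.ofReal ((N : ℝ) ^ (-(1 / 2 : ℝ)) *
            (2 * (Fintype.card κ * (C' * (N : ℝ) ^ ε)) * (eLpNorm m 2 ν).toReal)) +
          ENNReal.ofReal (x₃ N))) := by
        rw [i2]
        exact mul_le_mul_right (add_le_add (mul_le_mul_right i1 _)
          (add_le_add (add_le_add le_rfl (mul_le_mul_right i3 _)) le_rfl)) _
    _ = _ := (ofReal_linear_combination (Real.exp_pos _).le (by positivity) (by positivity)
          (hc₁n N) hWn (by positivity) (by positivity) (hx₃n N)).symm

end Limit

/-! ### Affine differential equations with constant coefficients -/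

section Affine

variable {E : Type*} [NormedAddCommGroup E] [NormedSpace ℝ E] [CompleteSpace E]

/-- The equation `Q' = T Q + e`, `Q 0 = 0` has a global solution. -/
theorem exists_hasDerivAt_affine (T : E →L[ℝ] E) (e : E) :
    ∃ Q : ℝ → E, Q 0 = 0 ∧ ∀ t, HasDerivAt Q (T (Q t) + e) t := by
  -- The inhomogeneous equation becomes linear on E × ℝ with an extra coordinate frozen at 1 and
  -- multiplying e; an operator exponential solves it.
  let B : E × ℝ →L[ℝ] E × ℝ := (T.comp (ContinuousLinearMap.fst ℝ E ℝ) +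
    (ContinuousLinearMap.snd ℝ E ℝ).smulRight e).prod 0
  let y : ℝ → E × ℝ := fun t => NormedSpace.exp (t • B) (0, 1)
  have hy : ∀ t, HasDerivAt y (B (y t)) t := fun t => by
    have h := (hasDerivAt_exp_smul_const' (𝕂 := ℝ) B t)
    exact h.clm_apply (hasDerivAt_const t ((0, 1) : E × ℝ)) |>.congr_deriv (by simp [y])
  have hy0 : y 0 = (0, 1) := by simp [y]
  have h2 : ∀ t, (y t).2 = 1 := by
    intro t
    have hd : ∀ r, HasDerivAt (fun r => (y r).2) 0 r := fun r => by
      exact (ContinuousLinearMap.snd ℝ E ℝ).hasFDerivAt.comp_hasDerivAt r (hy r)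
    have := is_const_of_deriv_eq_zero (fun r => (hd r).differentiableAt) (fun r => (hd r).deriv) t 0
    simpa [hy0] using this
  refine ⟨fun t => (y t).1, by simp [hy0], fun t => ?_⟩
  have := (ContinuousLinearMap.fst ℝ E ℝ).hasFDerivAt.comp_hasDerivAt t (hy t)
  simpa [B, h2 t, Function.comp_def] using this

/-- Solutions of `Q' = T Q + e` on `[0, ∞)` are unique. -/
theorem eq_of_hasDerivWithinAt_affine (T : E →L[ℝ] E) (e : E) {Q Q' : ℝ → E} (h0 : Q 0 = Q' 0)
    (hQ : ∀ t, 0 ≤ t → HasDerivWithinAt Q (T (Q t) + e) (Ici 0) t)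
    (hQ' : ∀ t, 0 ≤ t → HasDerivWithinAt Q' (T (Q' t) + e) (Ici 0) t) {t : ℝ} (ht : 0 ≤ t) :
    Q t = Q' t := by
  have hd : ∀ r, 0 ≤ r → HasDerivWithinAt (fun r => Q r - Q' r)
      ((T (Q r) + e) - (T (Q' r) + e)) (Ici 0) r := fun r hr => (hQ r hr).sub (hQ' r hr)
  have := eq_zero_of_abs_deriv_le_mul_abs_self_of_eq_zero_right (a := 0) (b := t) (K := ‖T‖)
    (fun r hr => ((hd r hr.1).continuousWithinAt.mono Icc_subset_Ici_self))
    (fun r hr => (hd r hr.1).mono (Ici_subset_Ici.2 hr.1)) (by simp [h0])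
    (fun r _ => by rw [add_sub_add_right_eq_sub, ← map_sub]; exact T.le_opNorm _)
    t (right_mem_Icc.2 ht)
  exact sub_eq_zero.1 this

/-- A solution whose velocity stays in a closed subspace stays in it. -/
theorem mem_of_hasDerivAt_mem {V : Submodule ℝ E} (hV : IsClosed (V : Set E)) {Q v : ℝ → E}
    (h0 : Q 0 = 0) (hQ : ∀ t, HasDerivAt Q (v t) t) (hv : ∀ t, v t ∈ V) (t : ℝ) : Q t ∈ V := by
  -- In the quotient by V, normed because V is closed, the curve has zero derivative.
  have hd : ∀ r, HasDerivAt (fun r => V.mkQL (Q r)) 0 r := fun r => by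
    have := V.mkQL.hasFDerivAt.comp_hasDerivAt r (hQ r)
    have hz : V.mkQL (v r) = 0 := (Submodule.Quotient.mk_eq_zero V).2 (hv r)
    rw [hz] at this
    exact this
  have := is_const_of_deriv_eq_zero (fun r => (hd r).differentiableAt) (fun r => (hd r).deriv) t 0
  simp only [h0, map_zero] at this
  exact (Submodule.Quotient.mk_eq_zero V).1 this

end Affine

/-! ### Calculus for the hidden units -/

section Calculus

variable {d : ℕ}

theorem differentiable_of_two {f : Space d → ℝ} (hf : ContDiff ℝ 2 f) : Differentiable ℝ f :=
  hf.differentiable (by norm_num)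

theorem ContDiff.partialD {f : Space d → ℝ} {n : WithTop ℕ∞} (hf : ContDiff ℝ (n + 1) f)
    (i : Fin d) : ContDiff ℝ n (partialD i f) :=
  (hf.fderiv_right le_rfl).clm_apply contDiff_const

theorem ContDiff.partialD_of_two {f : Space d → ℝ} (hf : ContDiff ℝ 2 f)
    (i : Fin d) : ContDiff ℝ 1 (_root_.partialD i f) :=
  ContDiff.partialD (n := 1) (by simpa [one_add_one_eq_two] using hf) i

theorem differentiable_partialD {f : Space d → ℝ} (hf : ContDiff ℝ 2 f) (i : Fin d) :
    Differentiable ℝ (partialD i f) :=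
  (hf.partialD_of_two i).differentiable (by norm_num)

theorem partialD_add {f g : Space d → ℝ} (hf : Differentiable ℝ f) (hg : Differentiable ℝ g)
    (i : Fin d) : partialD i (fun x => f x + g x) = fun x => partialD i f x + partialD i g x := by
  ext x
  simp [partialD, fderiv_fun_add (hf x) (hg x)]

theorem partialD_const_mul {f : Space d → ℝ} (hf : Differentiable ℝ f) (c : ℝ) (i : Fin d) :
    partialD i (fun x => c * f x) = fun x => c * partialD i f x := by
  ext x
  simp [partialD, fderiv_const_mul (hf x)]

theorem partialD_mul {f g : Space d → ℝ} (hf : Differentiable ℝ f) (hg : Differentiable ℝ g)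
    (i : Fin d) : partialD i (fun x => f x * g x) =
      fun x => f x * partialD i g x + g x * partialD i f x := by
  ext x
  simp [partialD, fderiv_fun_mul (hf x) (hg x)]

theorem classicalD_add {f g : Space d → ℝ} (hf : ContDiff ℝ 2 f) (hg : ContDiff ℝ 2 g)
    (α : MIdx d) : classicalD α (fun x => f x + g x) =
      fun x => classicalD α f x + classicalD α g x := by
  rcases α with _ | i | ⟨⟨i, j⟩, hij⟩
  · rfl
  · exact partialD_add (differentiable_of_two hf) (differentiable_of_two hg) i
  · simp only [classicalD]
    rw [partialD_add (differentiable_of_two hf) (differentiable_of_two hg),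
      partialD_add (differentiable_partialD hf j) (differentiable_partialD hg j)]

theorem classicalD_const_mul {f : Space d → ℝ} (hf : ContDiff ℝ 2 f) (c : ℝ) (α : MIdx d) :
    classicalD α (fun x => c * f x) = fun x => c * classicalD α f x := by
  rcases α with _ | i | ⟨⟨i, j⟩, hij⟩
  · rfl
  · exact partialD_const_mul (differentiable_of_two hf) c i
  · simp only [classicalD]
    rw [partialD_const_mul (differentiable_of_two hf),
      partialD_const_mul (differentiable_partialD hf j)]

theorem classicalD_zero (α : MIdx d) : classicalD α (fun _ : Space d => (0 : ℝ)) = fun _ => 0 := by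
  have := classicalD_const_mul (d := d) (f := fun _ => 0) contDiff_const 0 α
  simpa using this

theorem classicalD_sum {ι : Type*} (s : Finset ι) {f : ι → Space d → ℝ}
    (hf : ∀ i, ContDiff ℝ 2 (f i)) (α : MIdx d) :
    classicalD α (fun x => ∑ i ∈ s, f i x) = fun x => ∑ i ∈ s, classicalD α (f i) x := by
  classical
  induction s using Finset.induction_on with
  | empty => simpa using classicalD_zero α
  | insert a s ha ih =>
    simp only [Finset.sum_insert ha]
    rw [classicalD_add (hf a) (ContDiff.sum fun i _ => hf i), ih]

theorem continuous_classicalD {f : Space d → ℝ} (hf : ContDiff ℝ 2 f) (α : MIdx d) :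
    Continuous (classicalD α f) := by
  rcases α with _ | i | ⟨⟨i, j⟩, hij⟩
  · exact hf.continuous
  · exact (hf.partialD_of_two i).continuous
  · exact (ContDiff.partialD (n := 0) (by simpa using hf.partialD_of_two j) i).continuous

/-- `x ↦ x_k η(x)`. -/
def coordMul (k : Fin d) (η : Space d → ℝ) : Space d → ℝ := fun x => x k * η x

theorem contDiff_coord (k : Fin d) {n : WithTop ℕ∞} : ContDiff ℝ n fun x : Space d => x k :=
  (EuclideanSpace.proj (𝕜 := ℝ) (ι := Fin d) k).contDiff

theorem ContDiff.coordMul {η : Space d → ℝ} {n : WithTop ℕ∞} (hη : ContDiff ℝ n η) (k : Fin d) :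
    ContDiff ℝ n (coordMul k η) :=
  (contDiff_coord k).mul hη

theorem partialD_coord (i k : Fin d) (x : Space d) :
    partialD i (fun x : Space d => x k) x = if k = i then 1 else 0 := by
  have : (fun x : Space d => x k) = EuclideanSpace.proj (𝕜 := ℝ) (ι := Fin d) k := rfl
  rw [partialD, this, ContinuousLinearMap.fderiv]
  simp

theorem partialD_coordMul {η : Space d → ℝ} (hη : Differentiable ℝ η) (i k : Fin d) :
    partialD i (coordMul k η) = fun x => coordMul k (partialD i η) x +
      (if k = i then 1 else 0) * η x := by
  have h := partialD_mul (f := fun x : Space d => x k) (g := η)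
    ((contDiff_coord k (n := 1)).differentiable (by norm_num)) hη i
  ext x
  rw [show coordMul k η = fun x => x k * η x from rfl, h]
  beta_reduce
  rw [partialD_coord]
  simp only [coordMul]; ring

/-- The block `η(x) τ(w · x + b)`. -/
def block (η : Space d → ℝ) (τ : ℝ → ℝ) (w : Fin d → ℝ) (b : ℝ) (x : Space d) : ℝ :=
  η x * τ (∑ k, w k * x k + b)

theorem contDiff_affine (w : Fin d → ℝ) (b : ℝ) {n : WithTop ℕ∞} :
    ContDiff ℝ n fun x : Space d => ∑ k, w k * x k + b :=
  (ContDiff.sum fun k _ => contDiff_const.mul (contDiff_coord k)).add contDiff_const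

theorem partialD_affine (w : Fin d → ℝ) (b : ℝ) (i : Fin d) (x : Space d) :
    partialD i (fun x : Space d => ∑ k, w k * x k + b) x = w i := by
  have h1 := classicalD_sum (d := d) Finset.univ (f := fun k x => w k * x k)
    (fun k => contDiff_const.mul (contDiff_coord k)) (.inr (.inl i))
  have h2 := partialD_add (d := d) (f := fun x => ∑ k, w k * x k) (g := fun _ => b)
    ((ContDiff.sum (n := 1) fun k _ => contDiff_const.mul (contDiff_coord k)).differentiable
      (by norm_num)) (differentiable_const b) i
  simp only [classicalD] at h1
  rw [h2, h1]
  have h3 : ∀ k, partialD i (fun x : Space d => w k * x k) x = w k * if k = i then 1 else 0 := by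
    intro k
    rw [partialD_const_mul ((contDiff_coord k (n := 1)).differentiable (by norm_num))]
    beta_reduce
    rw [partialD_coord]
  simp only [h3]
  simp [partialD]

theorem ContDiff.block {η : Space d → ℝ} {τ : ℝ → ℝ} {n : WithTop ℕ∞} (hη : ContDiff ℝ n η)
    (hτ : ContDiff ℝ n τ) (w : Fin d → ℝ) (b : ℝ) : ContDiff ℝ n (block η τ w b) :=
  hη.mul (hτ.comp (contDiff_affine w b))

/-- Blocks are stable under differentiation: the derivative falls on η or on τ, and in the second
case produces a factor w_i. All later growth bounds come from counting these factors. -/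
theorem partialD_block {η : Space d → ℝ} {τ : ℝ → ℝ} (hη : Differentiable ℝ η)
    (hτ : Differentiable ℝ τ) (w : Fin d → ℝ) (b : ℝ) (i : Fin d) :
    partialD i (block η τ w b) =
      fun x => block (partialD i η) τ w b x + w i * block η (deriv τ) w b x := by
  have ha : Differentiable ℝ fun x : Space d => ∑ k, w k * x k + b :=
    (contDiff_affine w b (n := 1)).differentiable (by norm_num)
  have h := partialD_mul (f := η) (g := fun x => τ (∑ k, w k * x k + b)) hη (hτ.comp ha) i
  ext x
  rw [show block η τ w b = fun x => η x * τ (∑ k, w k * x k + b) from rfl, h]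
  have h2 : partialD i (fun x : Space d => τ (∑ k, w k * x k + b)) x =
      deriv τ (∑ k, w k * x k + b) * w i := by
    have h3 := partialD_affine w b i x
    unfold partialD at h3 ⊢
    have := ((hτ _).hasDerivAt.comp_hasFDerivAt x (ha x).hasFDerivAt).fderiv
    simp only [Function.comp_def] at this
    rw [this, _root_.smul_apply, h3, smul_eq_mul]
  beta_reduce
  rw [h2]
  simp only [block]; ring

theorem contDiff_deriv {τ : ℝ → ℝ} {n : ℕ} (hτ : ContDiff ℝ (n + 1 : ℕ) τ) :
    ContDiff ℝ n (deriv τ) := by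
  have : ContDiff ℝ ((n : WithTop ℕ∞) + 1) τ := by exact_mod_cast hτ
  exact (contDiff_succ_iff_deriv.1 this).2.2

theorem partialD_partialD_block {η : Space d → ℝ} {τ : ℝ → ℝ} (hη : ContDiff ℝ 2 η)
    (hτ : ContDiff ℝ 2 τ) (w : Fin d → ℝ) (b : ℝ) (i j : Fin d) :
    partialD i (partialD j (block η τ w b)) = fun x =>
      block (partialD i (partialD j η)) τ w b x + w i * block (partialD j η) (deriv τ) w b x +
      w j * (block (partialD i η) (deriv τ) w b x + w i * block η (deriv (deriv τ)) w b x) := by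
  have hτ1 : ContDiff ℝ 1 (deriv τ) := contDiff_deriv (n := 1) hτ
  have d1 : Differentiable ℝ (block (partialD j η) τ w b) :=
    ((hη.partialD_of_two j).block (hτ.of_le (by norm_num)) w b).differentiable (by norm_num)
  have d2 : Differentiable ℝ (block η (deriv τ) w b) :=
    ((hη.of_le (by norm_num)).block hτ1 w b).differentiable (by norm_num)
  rw [partialD_block (differentiable_of_two hη) (hτ.differentiable (by norm_num)),
    partialD_add d1 (d2.const_mul (w j)), partialD_const_mul d2,
    partialD_block (differentiable_partialD hη j) (hτ.differentiable (by norm_num)),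
    partialD_block (differentiable_of_two hη) (hτ1.differentiable (by norm_num))]

theorem partialD_partialD_coordMul {η : Space d → ℝ} (hη : ContDiff ℝ 2 η) (i j k : Fin d) :
    partialD i (partialD j (coordMul k η)) = fun x => coordMul k (partialD i (partialD j η)) x +
      (if k = i then 1 else 0) * partialD j η x + (if k = j then 1 else 0) * partialD i η x := by
  rw [partialD_coordMul (differentiable_of_two hη),
    partialD_add (((hη.partialD_of_two j).coordMul k).differentiable (by norm_num))
      ((differentiable_of_two hη).const_mul _),
    partialD_const_mul (differentiable_of_two hη), partialD_coordMul (differentiable_partialD hη j)]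

/-- Differentiation of the block along a path in the parameter space. -/
theorem hasDerivAt_classicalD_block {η : Space d → ℝ} {τ : ℝ → ℝ} (hη : ContDiff ℝ 2 η)
    (hτ : ContDiff ℝ 3 τ) {w : ℝ → Fin d → ℝ} {b : ℝ → ℝ} {w' : Fin d → ℝ} {b' t : ℝ}
    (hw : ∀ k, HasDerivAt (fun s => w s k) (w' k) t) (hb : HasDerivAt b b' t) (α : MIdx d)
    (x : Space d) :
    HasDerivAt (fun s => classicalD α (block η τ (w s) (b s)) x)
      (∑ k, w' k * classicalD α (block (coordMul k η) (deriv τ) (w t) (b t)) x +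
        b' * classicalD α (block η (deriv τ) (w t) (b t)) x) t := by
  have hu : HasDerivAt (fun s => ∑ k, w s k * x k + b s) (∑ k, w' k * x k + b') t :=
    (HasDerivAt.fun_sum fun k _ => (hw k).mul_const (x k)).add hb
  have hτ2 : ContDiff ℝ 2 τ := hτ.of_le (by norm_num)
  have hτ' : ContDiff ℝ 2 (deriv τ) := contDiff_deriv (n := 2) hτ
  have hτ'' : ContDiff ℝ 1 (deriv (deriv τ)) := contDiff_deriv (n := 1) hτ'
  have hd : Differentiable ℝ τ := hτ.differentiable (by norm_num)
  have hd' : Differentiable ℝ (deriv τ) := hτ'.differentiable (by norm_num)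
  have hd'' : Differentiable ℝ (deriv (deriv τ)) := hτ''.differentiable (by norm_num)
  have c0 := (hd (∑ k, w t k * x k + b t)).hasDerivAt.comp t hu
  have c1 := (hd' (∑ k, w t k * x k + b t)).hasDerivAt.comp t hu
  have c2 := (hd'' (∑ k, w t k * x k + b t)).hasDerivAt.comp t hu
  simp only [Function.comp_def] at c0 c1 c2
  have hηd := differentiable_of_two hη
  rcases α with _ | i | ⟨⟨i, j⟩, hij⟩
  · simp only [classicalD, block, coordMul]
    refine (c0.const_mul (η x)).congr_deriv ?_
    rw [mul_add, mul_add, Finset.mul_sum, Finset.mul_sum]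
    congr 1
    · exact Finset.sum_congr rfl fun k _ => by ring
    · ring
  · simp only [classicalD, partialD_block hηd hd, partialD_block hηd hd',
      fun k => partialD_block ((hη.coordMul k).differentiable (by norm_num)) hd',
      fun k => partialD_coordMul hηd i k]
    simp only [block, coordMul]
    refine ((c0.const_mul (partialD i η x)).add ((hw i).mul (c1.const_mul (η x)))).congr_deriv ?_
    -- The Kronecker deltas produced by differentiating x_k η select k = i; they match the
    -- derivative of the explicit factor w_i. The second-order case below has the same structure.
    have e : ∀ a₁ a₂ a₃ : ℝ, ∑ k, w' k * ((x k * a₁ + (if k = i then 1 else 0) * η x) * a₂ +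
        w t i * (x k * η x * a₃)) = (∑ k, w' k * x k) * (a₁ * a₂ + w t i * η x * a₃) +
          w' i * (η x * a₂) := by
      intro a₁ a₂ a₃
      have : ∀ k, w' k * ((x k * a₁ + (if k = i then 1 else 0) * η x) * a₂ +
        w t i * (x k * η x * a₃)) = w' k * x k * (a₁ * a₂ + w t i * η x * a₃) +
          if k = i then w' k * (η x * a₂) else 0 := by
        intro k; split_ifs <;> ring
      simp only [this, Finset.sum_add_distrib, ← Finset.sum_mul, Finset.sum_ite_eq',
        Finset.mem_univ, if_true]
    rw [e]; ring
  · simp only [classicalD, partialD_partialD_block hη hτ2, partialD_partialD_block hη hτ',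
      fun k => partialD_partialD_block (hη.coordMul k) hτ',
      fun k => partialD_partialD_coordMul hη i j k]
    simp only [fun k i => partialD_coordMul hηd i k]
    simp only [block, coordMul]
    refine (((c0.const_mul (partialD i (partialD j η) x)).add
      ((hw i).mul (c1.const_mul (partialD j η x)))).add ((hw j).mul
        ((c1.const_mul (partialD i η x)).add ((hw i).mul (c2.const_mul (η x)))))).congr_deriv ?_
    have e : ∀ a₁ a₂ a₃ s₁ s₂ s₃ : ℝ,
        ∑ k, w' k * ((x k * a₁ + (if k = i then 1 else 0) * a₂ + (if k = j then 1 else 0) * a₃) * s₁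
          + w t i * ((x k * a₂ + (if k = j then 1 else 0) * η x) * s₂)
          + w t j * ((x k * a₃ + (if k = i then 1 else 0) * η x) * s₂ +
            w t i * (x k * η x * s₃))) =
        (∑ k, w' k * x k) * (a₁ * s₁ + w t i * (a₂ * s₂) + w t j * (a₃ * s₂ + w t i * (η x * s₃))) +
          w' i * (a₂ * s₁ + w t j * (η x * s₂)) + w' j * (a₃ * s₁ + w t i * (η x * s₂)) := by
      intro a₁ a₂ a₃ s₁ s₂ s₃
      have : ∀ k, w' k * ((x k * a₁ + (if k = i then 1 else 0) * a₂ +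
            (if k = j then 1 else 0) * a₃) * s₁
          + w t i * ((x k * a₂ + (if k = j then 1 else 0) * η x) * s₂)
          + w t j * ((x k * a₃ + (if k = i then 1 else 0) * η x) * s₂ +
            w t i * (x k * η x * s₃))) =
          w' k * x k * (a₁ * s₁ + w t i * (a₂ * s₂) + w t j * (a₃ * s₂ + w t i * (η x * s₃))) +
          (if k = i then w' k * (a₂ * s₁ + w t j * (η x * s₂)) else 0) +
          (if k = j then w' k * (a₃ * s₁ + w t i * (η x * s₂)) else 0) := by
        intro k; split_ifs <;> ring
      simp only [this, Finset.sum_add_distrib, ← Finset.sum_mul, Finset.sum_ite_eq',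
        Finset.mem_univ, if_true]
    simp only [Pi.add_apply, Pi.mul_apply]
    rw [e]; ring

/-- At most two derivatives fall on τ, each bringing a component of w; hence growth of degree two in
w, uniformly in b and with constants taken at the point x. -/
theorem abs_classicalD_block_le {η : Space d → ℝ} {τ : ℝ → ℝ} (hη : ContDiff ℝ 2 η)
    (hτ : ContDiff ℝ 2 τ) {x : Space d} {Cη Cτ : ℝ} (hCη : ∀ α, |classicalD α η x| ≤ Cη)
    (h0 : ∀ u, |τ u| ≤ Cτ) (h1 : ∀ u, |deriv τ u| ≤ Cτ) (h2 : ∀ u, |deriv (deriv τ) u| ≤ Cτ)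
    (w : Fin d → ℝ) (b : ℝ) (α : MIdx d) :
    |classicalD α (block η τ w b) x| ≤ Cη * Cτ * (1 + ∑ k, |w k|) ^ 2 := by
  have hd : Differentiable ℝ τ := hτ.differentiable (by norm_num)
  have hηd := differentiable_of_two hη
  have hCη0 : 0 ≤ Cη := (abs_nonneg _).trans (hCη (.inl ()))
  have hCτ0 : 0 ≤ Cτ := (abs_nonneg _).trans (h0 0)
  have hw : ∀ i, |w i| ≤ ∑ k, |w k| := fun i =>
    Finset.single_le_sum (f := fun k => |w k|) (fun _ _ => abs_nonneg _) (Finset.mem_univ i)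
  set W := ∑ k, |w k| with hW
  have hW0 : 0 ≤ W := Finset.sum_nonneg fun _ _ => abs_nonneg _
  have hmul : ∀ {y z : ℝ}, |y| ≤ Cη → |z| ≤ Cτ → |y * z| ≤ Cη * Cτ := fun hy hz => by
    rw [abs_mul]; gcongr
  have hK : 0 ≤ Cη * Cτ := by positivity
  rcases α with _ | i | ⟨⟨i, j⟩, hij⟩
  · have := hmul (hCη (.inl ())) (h0 (∑ k, w k * x k + b))
    refine this.trans ?_
    nlinarith [mul_nonneg hK hW0, mul_nonneg hK (sq_nonneg W)]
  · simp only [classicalD, partialD_block hηd hd]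
    have e1 : |block (partialD i η) τ w b x| ≤ Cη * Cτ := hmul (hCη (.inr (.inl i))) (h0 _)
    have e2 : |block η (deriv τ) w b x| ≤ Cη * Cτ := hmul (hCη (.inl ())) (h1 _)
    have e3 : |w i * block η (deriv τ) w b x| ≤ W * (Cη * Cτ) := by
      rw [abs_mul]; gcongr; exact hw i
    have := abs_add_le (block (partialD i η) τ w b x) (w i * block η (deriv τ) w b x)
    nlinarith [mul_nonneg hK hW0, mul_nonneg hK (sq_nonneg W)]
  · simp only [classicalD, partialD_partialD_block hη hτ]
    have e1 : |block (partialD i (partialD j η)) τ w b x| ≤ Cη * Cτ :=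
      hmul (hCη (.inr (.inr ⟨(i, j), hij⟩))) (h0 _)
    have e2 : |block (partialD j η) (deriv τ) w b x| ≤ Cη * Cτ := hmul (hCη (.inr (.inl j))) (h1 _)
    have e3 : |block (partialD i η) (deriv τ) w b x| ≤ Cη * Cτ := hmul (hCη (.inr (.inl i))) (h1 _)
    have e4 : |block η (deriv (deriv τ)) w b x| ≤ Cη * Cτ := hmul (hCη (.inl ())) (h2 _)
    have e5 : |w i * block (partialD j η) (deriv τ) w b x| ≤ W * (Cη * Cτ) := by
      rw [abs_mul]; gcongr; exact hw i
    have e6 : |w i * block η (deriv (deriv τ)) w b x| ≤ W * (Cη * Cτ) := by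
      rw [abs_mul]; gcongr; exact hw i
    have e7 : |w j * (block (partialD i η) (deriv τ) w b x +
        w i * block η (deriv (deriv τ)) w b x)| ≤ W * (Cη * Cτ + W * (Cη * Cτ)) := by
      rw [abs_mul]
      gcongr
      · exact hw j
      · exact (abs_add_le _ _).trans (add_le_add e3 e6)
    have := abs_add_three (block (partialD i (partialD j η)) τ w b x)
      (w i * block (partialD j η) (deriv τ) w b x)
      (w j * (block (partialD i η) (deriv τ) w b x + w i * block η (deriv (deriv τ)) w b x))
    nlinarith [mul_nonneg hK hW0, mul_nonneg hK (sq_nonneg W)]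

end Calculus

/-! ### Parameter estimates for one hidden unit, uniform in space. -/

section Units

variable {d : ℕ}

theorem IsCb.contDiff_two {E : Type*} [NormedAddCommGroup E] [NormedSpace ℝ E] {n : ℕ} {f : E → ℝ}
    (h : IsCb n f) (hn : 2 ≤ n) : ContDiff ℝ 2 f :=
  h.1.of_le (by exact_mod_cast hn)

theorem IsCb.of_le {E : Type*} [NormedAddCommGroup E] [NormedSpace ℝ E] {n m : ℕ} {f : E → ℝ}
    (h : IsCb n f) (hm : m ≤ n) : IsCb m f :=
  ⟨h.1.of_le (by exact_mod_cast hm), fun k hk => h.2 k (hk.trans hm)⟩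

theorem IsCb.deriv {n : ℕ} {τ : ℝ → ℝ} (h : IsCb (n + 1) τ) : IsCb n (deriv τ) := by
  refine ⟨contDiff_deriv h.1, fun m hm => ?_⟩
  obtain ⟨C, hC⟩ := h.2 (m + 1) (by omega)
  refine ⟨C, fun x => ?_⟩
  have := hC x
  rwa [norm_iteratedFDeriv_eq_norm_iteratedDeriv, iteratedDeriv_succ',
    ← norm_iteratedFDeriv_eq_norm_iteratedDeriv] at this

theorem IsCb.exists_bound {n : ℕ} {τ : ℝ → ℝ} (h : IsCb n τ) : ∃ C, ∀ x, |τ x| ≤ C := by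
  obtain ⟨C, hC⟩ := h.2 0 (Nat.zero_le _)
  exact ⟨C, fun x => by simpa using hC x⟩

theorem exists_bound_classicalD {Ω : Set (Space d)} (hΩ : Bornology.IsBounded Ω) {η : Space d → ℝ}
    (hη : ContDiff ℝ 2 η) : ∃ C, 0 ≤ C ∧ ∀ x ∈ Ω, ∀ α, |classicalD α η x| ≤ C := by
  have h : ∀ α : MIdx d, ∃ C, ∀ x ∈ closure Ω, ‖classicalD α η x‖ ≤ C := fun α =>
    hΩ.isCompact_closure.exists_bound_of_continuousOn (continuous_classicalD hη α).continuousOn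
  choose C hC using h
  refine ⟨∑ α, |C α|, Finset.sum_nonneg fun _ _ => abs_nonneg _, fun x hx α => ?_⟩
  calc |classicalD α η x| ≤ |C α| := (hC α x (subset_closure hx)).trans (le_abs_self _)
    _ ≤ _ := Finset.single_le_sum (f := fun α => |C α|) (fun _ _ => abs_nonneg _)
      (Finset.mem_univ α)

/-- The weight `(1 + |c|) (1 + ∑ |w_k|)²`. -/
def parWeight (p : Par d → ℝ) : ℝ :=
  (1 + |p (.inl ())|) * (1 + ∑ k, |p (.inr (.inl k))|) ^ 2

theorem one_le_parWeight (p : Par d → ℝ) : 1 ≤ parWeight p := by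
  have h1 : (1 : ℝ) ≤ 1 + |p (.inl ())| := by linarith [abs_nonneg (p (.inl ()))]
  have h2 : (1 : ℝ) ≤ 1 + ∑ k, |p (.inr (.inl k))| := by
    linarith [Finset.sum_nonneg (s := Finset.univ) fun (k : Fin d) _ =>
      abs_nonneg (p (.inr (.inl k)))]
  exact one_le_mul_of_one_le_of_one_le h1 (one_le_pow₀ h2)

theorem parWeight_nonneg (p : Par d → ℝ) : 0 ≤ parWeight p :=
  zero_le_one.trans (one_le_parWeight p)

theorem continuous_parWeight : Continuous (parWeight (d := d)) := by
  unfold parWeight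
  fun_prop

/-- Weights at distance at most 1 are comparable, so bounds along a segment can be expressed by the
weight at one endpoint. -/
theorem parWeight_le {p p' : Par d → ℝ} (h : ‖p' - p‖ ≤ 1) :
    parWeight p' ≤ 2 * (1 + d) ^ 2 * parWeight p := by
  have hk : ∀ k, |p' k| ≤ |p k| + 1 := fun k => by
    have h1 : |p' k - p k| ≤ 1 := (norm_le_pi_norm (p' - p) k).trans h
    have h2 := abs_sub_abs_le_abs_sub (p' k) (p k)
    linarith
  have hs : ∑ k, |p' (.inr (.inl k))| ≤ ∑ k, |p (.inr (.inl k))| + d := by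
    calc _ ≤ ∑ k : Fin d, (|p (.inr (.inl k))| + 1) := Finset.sum_le_sum fun k _ => hk _
      _ = _ := by simp [Finset.sum_add_distrib]
  have hW : 0 ≤ ∑ k, |p (.inr (.inl k))| := Finset.sum_nonneg fun _ _ => abs_nonneg _
  have hW' : 0 ≤ ∑ k, |p' (.inr (.inl k))| := Finset.sum_nonneg fun _ _ => abs_nonneg _
  have hc := hk (.inl ())
  have hc0 := abs_nonneg (p (.inl ()))
  unfold parWeight
  calc _ ≤ (2 * (1 + |p (.inl ())|)) * ((1 + d) * (1 + ∑ k, |p (.inr (.inl k))|)) ^ 2 := by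
        gcongr
        · linarith
        · have : (0 : ℝ) ≤ d * ∑ k, |p (.inr (.inl k))| := by positivity
          nlinarith
    _ = _ := by ring

/-- The function `(a₀ + a₁ c) η(x) τ(w · x + b)`. -/
def unitFn (a₀ a₁ : ℝ) (η : Space d → ℝ) (τ : ℝ → ℝ) (p : Par d → ℝ) (x : Space d) : ℝ :=
  (a₀ + a₁ * p (.inl ())) * block η τ (fun k => p (.inr (.inl k))) (p (.inr (.inr ()))) x

theorem contDiff_unitFn {η : Space d → ℝ} {τ : ℝ → ℝ} {n : WithTop ℕ∞} (hη : ContDiff ℝ n η)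
    (hτ : ContDiff ℝ n τ) (a₀ a₁ : ℝ) (p : Par d → ℝ) : ContDiff ℝ n (unitFn a₀ a₁ η τ p) :=
  contDiff_const.mul (hη.block hτ _ _)

theorem classicalD_unitFn {η : Space d → ℝ} {τ : ℝ → ℝ} (hη : ContDiff ℝ 2 η)
    (hτ : ContDiff ℝ 2 τ) (a₀ a₁ : ℝ) (p : Par d → ℝ) (α : MIdx d) (x : Space d) :
    classicalD α (unitFn a₀ a₁ η τ p) x = (a₀ + a₁ * p (.inl ())) *
      classicalD α (block η τ (fun k => p (.inr (.inl k))) (p (.inr (.inr ())))) x :=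
  congrFun (classicalD_const_mul (hη.block hτ _ _) _ α) x

/-- Differentiation of a unit along a path in the parameter space. -/
theorem hasDerivAt_classicalD_unitFn {η : Space d → ℝ} {τ : ℝ → ℝ} (hη : ContDiff ℝ 2 η)
    (hτ : ContDiff ℝ 3 τ) (a₀ a₁ : ℝ) {q : ℝ → Par d → ℝ} {q' : Par d → ℝ} {t : ℝ}
    (hq : ∀ k, HasDerivAt (fun s => q s k) (q' k) t) (α : MIdx d) (x : Space d) :
    HasDerivAt (fun s => classicalD α (unitFn a₀ a₁ η τ (q s)) x)
      (a₁ * q' (.inl ()) * classicalD α (unitFn 1 0 η τ (q t)) x +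
        (∑ k, q' (.inr (.inl k)) *
          classicalD α (unitFn a₀ a₁ (coordMul k η) (deriv τ) (q t)) x +
        q' (.inr (.inr ())) * classicalD α (unitFn a₀ a₁ η (deriv τ) (q t)) x)) t := by
  have hτ2 : ContDiff ℝ 2 τ := hτ.of_le (by norm_num)
  have hτ' : ContDiff ℝ 2 (deriv τ) := contDiff_deriv (n := 2) hτ
  simp only [classicalD_unitFn hη hτ2, classicalD_unitFn hη hτ',
    fun k => classicalD_unitFn (hη.coordMul k) hτ']
  have h1 := hasDerivAt_classicalD_block hη hτ (w := fun s k => q s (.inr (.inl k)))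
    (b := fun s => q s (.inr (.inr ()))) (fun k => hq (.inr (.inl k))) (hq (.inr (.inr ()))) α x
  have h2 := (((hq (.inl ())).const_mul a₁).const_add a₀).mul h1
  refine h2.congr_deriv ?_
  rw [mul_add, Finset.mul_sum]
  have : ∀ k, (a₀ + a₁ * q t (.inl ())) * (q' (.inr (.inl k)) * classicalD α (block (coordMul k η)
      (deriv τ) (fun k => q t (.inr (.inl k))) (q t (.inr (.inr ())))) x) =
      q' (.inr (.inl k)) * ((a₀ + a₁ * q t (.inl ())) * classicalD α (block (coordMul k η)
      (deriv τ) (fun k => q t (.inr (.inl k))) (q t (.inr (.inr ())))) x) := fun k => by ring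
  simp only [this]
  ring

theorem exists_bound_unitFn {Ω : Set (Space d)} (hΩ : Bornology.IsBounded Ω) {η : Space d → ℝ}
    {τ : ℝ → ℝ} (hη : ContDiff ℝ 2 η) (hτ : IsCb 2 τ) {a₀ a₁ : ℝ} (h₀ : |a₀| ≤ 1) (h₁ : |a₁| ≤ 1) :
    ∃ C, 0 ≤ C ∧ ∀ p, ∀ x ∈ Ω, ∀ α, |classicalD α (unitFn a₀ a₁ η τ p) x| ≤ C * parWeight p := by
  obtain ⟨Cη, hCη0, hCη⟩ := exists_bound_classicalD hΩ hη
  obtain ⟨C0, hC0⟩ := hτ.exists_bound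
  obtain ⟨C1, hC1⟩ := (IsCb.deriv hτ).exists_bound
  obtain ⟨C2, hC2⟩ := (IsCb.deriv (IsCb.deriv hτ)).exists_bound
  have hC00 : 0 ≤ C0 := (abs_nonneg _).trans (hC0 0)
  have hC10 : 0 ≤ C1 := (abs_nonneg _).trans (hC1 0)
  have hC20 : 0 ≤ C2 := (abs_nonneg _).trans (hC2 0)
  refine ⟨Cη * (C0 + C1 + C2), by positivity, fun p x hx α => ?_⟩
  rw [classicalD_unitFn hη hτ.1, abs_mul]
  have h := abs_classicalD_block_le hη hτ.1 (Cτ := C0 + C1 + C2) (hCη x hx)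
    (fun u => (hC0 u).trans (by linarith)) (fun u => (hC1 u).trans (by linarith))
    (fun u => (hC2 u).trans (by linarith)) (fun k => p (.inr (.inl k))) (p (.inr (.inr ()))) α
  have h2 : |a₀ + a₁ * p (.inl ())| ≤ 1 + |p (.inl ())| := by
    refine (abs_add_le _ _).trans (add_le_add h₀ ?_)
    rw [abs_mul]
    nlinarith [abs_nonneg (p (.inl ())), abs_nonneg a₁]
  calc _ ≤ (1 + |p (.inl ())|) * (Cη * (C0 + C1 + C2) * (1 + ∑ k, |p (.inr (.inl k))|) ^ 2) := by
        gcongr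
    _ = _ := by unfold parWeight; ring

theorem hasDerivAt_segment (p h : Par d → ℝ) (t : ℝ) (k : Par d) :
    HasDerivAt (fun s : ℝ => (p + s • h) k) (h k) t := by
  simpa using ((hasDerivAt_id t).mul_const (h k)).const_add (p k)

theorem norm_segment_sub_le {p h : Par d → ℝ} {s : ℝ} (hs : s ∈ Icc (0 : ℝ) 1) :
    ‖p + s • h - p‖ ≤ ‖h‖ := by
  rw [add_sub_cancel_left, norm_smul, Real.norm_of_nonneg hs.1]
  exact mul_le_of_le_one_left (norm_nonneg _) hs.2

/-- Mean value inequality along the segment: the parameter derivatives are again of the form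
`unitFn`, with τ replaced by its derivative, which costs one order of smoothness. For τ = σ' this
requires four bounded derivatives of σ. -/
theorem exists_lipschitz_unitFn {Ω : Set (Space d)} (hΩ : Bornology.IsBounded Ω) {η : Space d → ℝ}
    {τ : ℝ → ℝ} (hη : ContDiff ℝ 2 η) (hτ : IsCb 3 τ) {a₀ a₁ : ℝ} (h₀ : |a₀| ≤ 1) (h₁ : |a₁| ≤ 1) :
    ∃ C, 0 ≤ C ∧ ∀ p p', ‖p' - p‖ ≤ 1 → ∀ x ∈ Ω, ∀ α,
      |classicalD α (unitFn a₀ a₁ η τ p') x - classicalD α (unitFn a₀ a₁ η τ p) x| ≤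
        C * parWeight p * ‖p' - p‖ := by
  obtain ⟨Cc, hCc0, hCc⟩ := exists_bound_unitFn hΩ hη (hτ.of_le (by norm_num)) (a₀ := 1) (a₁ := 0)
    (by simp) (by simp)
  obtain ⟨Cb, hCb0, hCb⟩ := exists_bound_unitFn hΩ hη (IsCb.deriv hτ) h₀ h₁
  have hw := fun k => exists_bound_unitFn hΩ (hη.coordMul k) (IsCb.deriv hτ) h₀ h₁
  choose Cw hCw0 hCw using hw
  set C := Cc + (∑ k, Cw k + Cb) with hC
  have hsum : 0 ≤ ∑ k, Cw k := Finset.sum_nonneg fun k _ => hCw0 k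
  have hC0 : 0 ≤ C := by positivity
  refine ⟨C * (2 * (1 + d) ^ 2), by positivity, fun p p' hpp x hx α => ?_⟩
  set h := p' - p with hh
  have hder := fun t => hasDerivAt_classicalD_unitFn hη hτ.1 a₀ a₁
    (fun k => hasDerivAt_segment p h t k) α x
  have key := (convex_Icc (0 : ℝ) 1).norm_image_sub_le_of_norm_hasDerivWithin_le
    (C := C * (2 * (1 + d) ^ 2) * parWeight p * ‖h‖)
    (fun t _ => (hder t).hasDerivWithinAt) ?_ (left_mem_Icc.2 zero_le_one)
    (right_mem_Icc.2 zero_le_one)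
  · simpa [hh] using key
  intro t ht
  have hwt := parWeight_le ((norm_segment_sub_le (p := p) (h := h) ht).trans hpp)
  have hwn := parWeight_nonneg (p + t • h)
  have hk : ∀ k, |h k| ≤ ‖h‖ := fun k => norm_le_pi_norm h k
  have e1 : |a₁ * h (.inl ()) * classicalD α (unitFn 1 0 η τ (p + t • h)) x| ≤
      ‖h‖ * (Cc * parWeight (p + t • h)) := by
    rw [abs_mul, abs_mul]
    have := hCc (p + t • h) x hx α
    gcongr
    calc |a₁| * |h (.inl ())| ≤ 1 * ‖h‖ := by gcongr; exact hk _
      _ = _ := one_mul _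
  have e2 : |∑ k, h (.inr (.inl k)) *
      classicalD α (unitFn a₀ a₁ (coordMul k η) (deriv τ) (p + t • h)) x| ≤
      ‖h‖ * ((∑ k, Cw k) * parWeight (p + t • h)) := by
    refine (Finset.abs_sum_le_sum_abs _ _).trans ?_
    rw [Finset.sum_mul, Finset.mul_sum]
    refine Finset.sum_le_sum fun k _ => ?_
    rw [abs_mul]
    have := hCw k (p + t • h) x hx α
    gcongr
    exact hk _
  have e3 : |h (.inr (.inr ())) * classicalD α (unitFn a₀ a₁ η (deriv τ) (p + t • h)) x| ≤
      ‖h‖ * (Cb * parWeight (p + t • h)) := by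
    rw [abs_mul]
    have := hCb (p + t • h) x hx α
    gcongr
    exact hk _
  rw [Real.norm_eq_abs]
  refine (abs_add_le _ _).trans ?_
  have e4 := abs_add_le (∑ k, h (.inr (.inl k)) *
      classicalD α (unitFn a₀ a₁ (coordMul k η) (deriv τ) (p + t • h)) x)
      (h (.inr (.inr ())) * classicalD α (unitFn a₀ a₁ η (deriv τ) (p + t • h)) x)
  calc _ ≤ ‖h‖ * (C * parWeight (p + t • h)) := by rw [hC]; linarith
    _ ≤ ‖h‖ * (C * (2 * (1 + d) ^ 2 * parWeight p)) := by gcongr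
    _ = _ := by ring

/-- The partial derivative of `η(x) c σ(w · x + b)` with respect to the `k`-th parameter. -/
noncomputable def unitD (η : Space d → ℝ) (σ : ℝ → ℝ) : Par d → (Par d → ℝ) → Space d → ℝ
  | .inl _ => unitFn 1 0 η σ
  | .inr (.inl k) => unitFn 0 1 (coordMul k η) (deriv σ)
  | .inr (.inr _) => unitFn 0 1 η (deriv σ)

theorem contDiff_unitD {η : Space d → ℝ} {σ : ℝ → ℝ} (hη : ContDiff ℝ 2 η) (hσ : ContDiff ℝ 3 σ)
    (k : Par d) (p : Par d → ℝ) : ContDiff ℝ 2 (unitD η σ k p) := by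
  have hσ' : ContDiff ℝ 2 (deriv σ) := contDiff_deriv (n := 2) hσ
  rcases k with _ | k | _
  · exact contDiff_unitFn hη (hσ.of_le (by norm_num)) _ _ _
  · exact contDiff_unitFn (hη.coordMul k) hσ' _ _ _
  · exact contDiff_unitFn hη hσ' _ _ _

theorem hasDerivAt_classicalD_unit {η : Space d → ℝ} {σ : ℝ → ℝ} (hη : ContDiff ℝ 2 η)
    (hσ : ContDiff ℝ 3 σ) {q : ℝ → Par d → ℝ} {q' : Par d → ℝ} {t : ℝ}
    (hq : ∀ k, HasDerivAt (fun s => q s k) (q' k) t) (α : MIdx d) (x : Space d) :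
    HasDerivAt (fun s => classicalD α (unitFn 0 1 η σ (q s)) x)
      (∑ k, q' k * classicalD α (unitD η σ k (q t)) x) t := by
  refine (hasDerivAt_classicalD_unitFn hη hσ 0 1 hq α x).congr_deriv ?_
  simp [Fintype.sum_sum_type, unitD]

theorem exists_bound_unitD {Ω : Set (Space d)} (hΩ : Bornology.IsBounded Ω) {η : Space d → ℝ}
    {σ : ℝ → ℝ} (hη : ContDiff ℝ 2 η) (hσ : IsCb 4 σ) :
    ∃ C, 0 ≤ C ∧ (∀ p, ∀ x ∈ Ω, ∀ α, |classicalD α (unitFn 0 1 η σ p) x| ≤ C * parWeight p) ∧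
      (∀ k p, ∀ x ∈ Ω, ∀ α, |classicalD α (unitD η σ k p) x| ≤ C * parWeight p) ∧
      ∀ k p p', ‖p' - p‖ ≤ 1 → ∀ x ∈ Ω, ∀ α,
        |classicalD α (unitD η σ k p') x - classicalD α (unitD η σ k p) x| ≤
          C * parWeight p * ‖p' - p‖ := by
  have hσ' : IsCb 3 (deriv σ) := IsCb.deriv hσ
  obtain ⟨C1, hC10, hC1⟩ := exists_bound_unitFn hΩ hη (hσ.of_le (by norm_num)) (a₀ := 0) (a₁ := 1)
    (by simp) (by simp)
  have h2 : ∀ k : Par d, ∃ C, 0 ≤ C ∧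
      ∀ p, ∀ x ∈ Ω, ∀ α, |classicalD α (unitD η σ k p) x| ≤ C * parWeight p := by
    rintro (_ | k | _)
    · exact exists_bound_unitFn hΩ hη (hσ.of_le (by norm_num)) (by simp) (by simp)
    · exact exists_bound_unitFn hΩ (hη.coordMul k) (hσ'.of_le (by norm_num)) (by simp) (by simp)
    · exact exists_bound_unitFn hΩ hη (hσ'.of_le (by norm_num)) (by simp) (by simp)
  have h3 : ∀ k : Par d, ∃ C, 0 ≤ C ∧ ∀ p p', ‖p' - p‖ ≤ 1 → ∀ x ∈ Ω, ∀ α,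
        |classicalD α (unitD η σ k p') x - classicalD α (unitD η σ k p) x| ≤
          C * parWeight p * ‖p' - p‖ := by
    rintro (_ | k | _)
    · exact exists_lipschitz_unitFn hΩ hη (hσ.of_le (by norm_num)) (by simp) (by simp)
    · exact exists_lipschitz_unitFn hΩ (hη.coordMul k) hσ' (by simp) (by simp)
    · exact exists_lipschitz_unitFn hΩ hη hσ' (by simp) (by simp)
  choose C2 hC20 hC2 using h2
  choose C3 hC30 hC3 using h3
  have hs2 : 0 ≤ ∑ k, C2 k := Finset.sum_nonneg fun k _ => hC20 k
  have hs3 : 0 ≤ ∑ k, C3 k := Finset.sum_nonneg fun k _ => hC30 k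
  have hl2 : ∀ k, C2 k ≤ ∑ k, C2 k := fun k =>
    Finset.single_le_sum (fun k _ => hC20 k) (Finset.mem_univ k)
  have hl3 : ∀ k, C3 k ≤ ∑ k, C3 k := fun k =>
    Finset.single_le_sum (fun k _ => hC30 k) (Finset.mem_univ k)
  refine ⟨C1 + ∑ k, C2 k + ∑ k, C3 k, by positivity, fun p x hx α => ?_, fun k p x hx α => ?_,
    fun k p p' hpp x hx α => ?_⟩ <;> have hw := parWeight_nonneg p
  · refine (hC1 p x hx α).trans ?_
    gcongr
    linarith
  · refine (hC2 k p x hx α).trans ?_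
    gcongr
    linarith [hl2 k]
  · refine (hC3 k p p' hpp x hx α).trans ?_
    gcongr
    linarith [hl3 k]

/-- The first order Taylor expansion in the parameters, uniformly in `x`. -/
theorem abs_taylor_unit_le {Ω : Set (Space d)} {η : Space d → ℝ} {σ : ℝ → ℝ} (hη : ContDiff ℝ 2 η)
    (hσ : ContDiff ℝ 3 σ) {C : ℝ}
    (hC : ∀ k p p', ‖p' - p‖ ≤ 1 → ∀ x ∈ Ω, ∀ α,
        |classicalD α (unitD η σ k p') x - classicalD α (unitD η σ k p) x| ≤
          C * parWeight p * ‖p' - p‖) (hC0 : 0 ≤ C) {p h : Par d → ℝ} (hh : ‖h‖ ≤ 1) {x : Space d}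
    (hx : x ∈ Ω) (α : MIdx d) :
    |classicalD α (unitFn 0 1 η σ (p + h)) x - classicalD α (unitFn 0 1 η σ p) x -
      ∑ k, h k * classicalD α (unitD η σ k p) x| ≤
        Fintype.card (Par d) * (C * parWeight p) * ‖h‖ ^ 2 := by
  set D := ∑ k, h k * classicalD α (unitD η σ k p) x with hD
  -- After subtracting the linear part, the derivative along the segment is a difference of first
  -- derivatives, of size ‖h‖², and the mean value inequality applies on [0, 1].
  have hder : ∀ t, HasDerivAt (fun s : ℝ => classicalD α (unitFn 0 1 η σ (p + s • h)) x - s * D)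
      (∑ k, h k * classicalD α (unitD η σ k (p + t • h)) x - D) t := fun t => by
    have h1 := hasDerivAt_classicalD_unit hη hσ (fun k => hasDerivAt_segment p h t k) α x
    exact (h1.sub ((hasDerivAt_id t).mul_const D)).congr_deriv (by rw [one_mul])
  have key := (convex_Icc (0 : ℝ) 1).norm_image_sub_le_of_norm_hasDerivWithin_le
    (C := Fintype.card (Par d) * (C * parWeight p) * ‖h‖ ^ 2)
    (fun t _ => (hder t).hasDerivWithinAt) ?_ (left_mem_Icc.2 zero_le_one)
    (right_mem_Icc.2 zero_le_one)
  · have e : ∀ a b : ℝ, a - 1 * D - (b - 0 * D) = a - b - D := fun a b => by ring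
    simp only [one_smul, zero_smul, add_zero, e] at key
    simpa using key
  intro t ht
  have hseg := norm_segment_sub_le (p := p) (h := h) ht
  have hw := parWeight_nonneg p
  rw [hD, ← Finset.sum_sub_distrib, Real.norm_eq_abs]
  refine (Finset.abs_sum_le_sum_abs _ _).trans ?_
  calc _ ≤ ∑ k : Par d, ‖h‖ * (C * parWeight p * ‖h‖) := by
        refine Finset.sum_le_sum fun k _ => ?_
        rw [← mul_sub, abs_mul]
        gcongr
        · exact norm_le_pi_norm h k
        · exact (hC k p _ (hseg.trans hh) x hx α).trans (by gcongr)
    _ = _ := by simp only [Finset.sum_const, Finset.card_univ, nsmul_eq_mul]; ring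

end Units

/-! ### Functions as elements of `L²` -/

section L2

variable {X : Type*} [MeasurableSpace X] {μ : Measure X}

open Classical in
/-- The class of `f` in `L²(μ)` if `f` is square integrable, and `0` otherwise. -/
noncomputable def toL2 (μ : Measure X) (f : X → ℝ) : Lp ℝ 2 μ :=
  if h : MemLp f 2 μ then h.toLp f else 0

theorem toL2_eq {f : X → ℝ} (h : MemLp f 2 μ) : toL2 μ f = h.toLp f := dif_pos h

theorem coeFn_toL2 {f : X → ℝ} (h : MemLp f 2 μ) : toL2 μ f =ᵐ[μ] f := by
  rw [toL2_eq h]; exact h.coeFn_toLp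

theorem toL2_add {f g : X → ℝ} (hf : MemLp f 2 μ) (hg : MemLp g 2 μ) :
    toL2 μ (fun x => f x + g x) = toL2 μ f + toL2 μ g := by
  rw [toL2_eq hf, toL2_eq hg, show toL2 μ (fun x => f x + g x) = _ from toL2_eq (hf.add hg)]; rfl

theorem toL2_const_mul {f : X → ℝ} (hf : MemLp f 2 μ) (c : ℝ) :
    toL2 μ (fun x => c * f x) = c • toL2 μ f := by
  rw [toL2_eq hf, toL2_eq (hf.const_mul c)]; rfl

theorem toL2_coeFn (u : Lp ℝ 2 μ) : toL2 μ u = u := by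
  rw [toL2_eq (Lp.memLp u), Lp.toLp_coeFn]

theorem toL2_congr {f g : X → ℝ} (h : f =ᵐ[μ] g) : toL2 μ f = toL2 μ g := by
  by_cases hf : MemLp f 2 μ
  · rw [toL2_eq hf, toL2_eq (hf.ae_eq h)]
    exact (MemLp.toLp_eq_toLp_iff _ _).2 h
  · have hg : ¬ MemLp g 2 μ := fun hg => hf (hg.ae_eq h.symm)
    simp [toL2, hf, hg]

theorem enorm_toL2_sub {f : X → ℝ} (hf : MemLp f 2 μ) (u : Lp ℝ 2 μ) :
    ‖toL2 μ f - u‖ₑ = eLpNorm (fun x => f x - u x) 2 μ := by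
  rw [Lp.enorm_def]
  refine eLpNorm_congr_ae ?_
  filter_upwards [Lp.coeFn_sub (toL2 μ f) u, coeFn_toL2 hf] with x h1 h2
  rw [h1, Pi.sub_apply, h2]

theorem inner_toL2 {f g : X → ℝ} (hf : MemLp f 2 μ) (hg : MemLp g 2 μ) :
    inner ℝ (toL2 μ f) (toL2 μ g) = ∫ x, g x * f x ∂μ := by
  rw [L2.inner_def]
  refine integral_congr_ae ?_
  filter_upwards [coeFn_toL2 hf, coeFn_toL2 hg] with x h1 h2
  rw [h1, h2]; rfl

/-- Multiplication by a bounded function on `L²`. -/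
noncomputable def mulL2 {a : X → ℝ} (ha : Measurable a) {k : ℝ} (hk : ∀ᵐ x ∂μ, |a x| ≤ k) :
    Lp ℝ 2 μ →L[ℝ] Lp ℝ 2 μ :=
  have hm : ∀ u : Lp ℝ 2 μ, MemLp (fun x => a x * u x) 2 μ := fun u =>
    (Lp.memLp u).of_le_mul (ha.aestronglyMeasurable.mul (Lp.aestronglyMeasurable u))
      (hk.mono fun x hx => by rw [norm_mul]; gcongr; exact hx)
  LinearMap.mkContinuous
    { toFun := fun u => toL2 μ fun x => a x * u x
      map_add' := fun u v => by
        rw [← toL2_add (hm u) (hm v)]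
        refine toL2_congr ?_
        filter_upwards [Lp.coeFn_add u v] with x hx
        rw [hx, Pi.add_apply, mul_add]
      map_smul' := fun c u => by
        rw [RingHom.id_apply, ← toL2_const_mul (hm u)]
        refine toL2_congr ?_
        filter_upwards [Lp.coeFn_smul c u] with x hx
        rw [hx, Pi.smul_apply, smul_eq_mul]; ring } k fun u => by
    refine Lp.norm_le_mul_norm_of_ae_le_mul ?_
    filter_upwards [coeFn_toL2 (hm u), hk] with x h1 h2
    simp only [LinearMap.coe_mk, AddHom.coe_mk]
    rw [h1, norm_mul]
    gcongr
    exact h2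

theorem mulL2_apply {a : X → ℝ} (ha : Measurable a) {k : ℝ} (hk : ∀ᵐ x ∂μ, |a x| ≤ k)
    (u : Lp ℝ 2 μ) : mulL2 ha hk u =ᵐ[μ] fun x => a x * u x :=
  coeFn_toL2 ((Lp.memLp u).of_le_mul (ha.aestronglyMeasurable.mul (Lp.aestronglyMeasurable u))
      (hk.mono fun x hx => by rw [norm_mul]; gcongr; exact hx))

/-- Composition with `h` on `L²`. -/
noncomputable def compL2 (μ : Measure X) (h : ℝ → ℝ) (u : Lp ℝ 2 μ) : Lp ℝ 2 μ :=
  toL2 μ fun x => h (u x)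

theorem memLp_comp {h : ℝ → ℝ} (hL : ∀ x y, |h x - h y| ≤ |x - y|) (h0 : h 0 = 0) {f : X → ℝ}
    (hf : MemLp f 2 μ) : MemLp (fun x => h (f x)) 2 μ := by
  have hc : Continuous h := (LipschitzWith.of_dist_le_mul (K := 1) fun x y => by
    simpa [Real.dist_eq] using hL x y).continuous
  refine hf.of_le (hc.comp_aestronglyMeasurable hf.1) (Eventually.of_forall fun x => ?_)
  simpa [h0] using hL (f x) 0

/-- The pointwise properties pass to L²: the sup bound gains the factor μ(X)^(1/2) since μ is
finite, and convergence to the identity is dominated, the error at v being at most 2|v|. -/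
theorem isClipFamily_compL2 [IsFiniteMeasure μ] {c γ : ℝ} (hc : 0 ≤ c) {h : ℕ → ℝ → ℝ}
    (hL : ∀ N, 1 ≤ N → ∀ x y, |h N x - h N y| ≤ |x - y|) (h0 : ∀ N, 1 ≤ N → h N 0 = 0)
    (hb : ∀ N : ℕ, 1 ≤ N → ∀ x, |h N x| ≤ c * (N : ℝ) ^ γ)
    (ht : ∀ x, Tendsto (fun N => h N x) atTop (𝓝 x)) :
    ∃ C, IsClipFamily C γ fun N => compL2 μ (h N) := by
  have hm : ∀ N, 1 ≤ N → ∀ u : Lp ℝ 2 μ, MemLp (fun x => h N (u x)) 2 μ := fun N hN u =>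
    memLp_comp (hL N hN) (h0 N hN) (Lp.memLp u)
  refine ⟨μ.real univ ^ ((2 : ℝ≥0∞).toReal)⁻¹ * c, ⟨fun N hN => ?_, fun N hN => ?_, fun N hN v => ?_,
    fun v => ?_⟩⟩
  · refine LipschitzWith.of_dist_le_mul fun u v => ?_
    rw [dist_eq_norm, dist_eq_norm, NNReal.coe_one, one_mul]
    refine Lp.norm_le_norm_of_ae_le ?_
    filter_upwards [Lp.coeFn_sub (compL2 μ (h N) u) (compL2 μ (h N) v), Lp.coeFn_sub u v,
      coeFn_toL2 (hm N hN u), coeFn_toL2 (hm N hN v)] with x h1 h2 h3 h4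
    rw [h1, h2, Pi.sub_apply, Pi.sub_apply, compL2, compL2, h3, h4]
    exact hL N hN _ _
  · have : (fun x => h N ((0 : Lp ℝ 2 μ) x)) =ᵐ[μ] (0 : Lp ℝ 2 μ) := by
      filter_upwards [Lp.coeFn_zero ℝ 2 μ] with x hx
      rw [hx, Pi.zero_apply, h0 N hN]
    rw [compL2, toL2_congr this, toL2_coeFn]
  · rw [mul_assoc]
    refine Lp.norm_le_of_ae_bound (by positivity) ?_
    filter_upwards [coeFn_toL2 (hm N hN v)] with x hx
    rw [compL2, hx]
    exact hb N hN _
  · rw [Lp.tendsto_Lp_iff_tendsto_eLpNorm']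
    have hlim : Tendsto (fun N => ∫⁻ x, ‖h N (v x) - v x‖ₑ ^ (2 : ℝ) ∂μ) atTop (𝓝 0) := by
      have hdom : ∫⁻ x, (2 * ‖v x‖ₑ) ^ (2 : ℝ) ∂μ ≠ ⊤ := by
        have h1 := (Lp.memLp v).2
        rw [eLpNorm_lt_top_iff_lintegral_rpow_enorm_lt_top (by norm_num) (by norm_num)] at h1
        simp_rw [ENNReal.mul_rpow_of_nonneg _ _ (zero_le_two : (0 : ℝ) ≤ 2)]
        rw [lintegral_const_mul' _ _ (ENNReal.rpow_ne_top_of_nonneg (by norm_num) (by norm_num))]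
        exact ENNReal.mul_ne_top (ENNReal.rpow_ne_top_of_nonneg (by norm_num) (by norm_num))
          (by simpa using h1.ne)
      have := tendsto_lintegral_filter_of_dominated_convergence (μ := μ) (l := atTop)
        (F := fun (N : ℕ) x => ‖h N (v x) - v x‖ₑ ^ (2 : ℝ)) (f := fun _ => 0)
        (fun x => (2 * ‖v x‖ₑ) ^ (2 : ℝ)) ?_ ?_ hdom ?_
      · simpa using this
      · filter_upwards [eventually_ge_atTop 1] with N hN
        have hc : Continuous (h N) := (LipschitzWith.of_dist_le_mul (K := 1) fun x y => by
          simpa [Real.dist_eq] using hL N hN x y).continuous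
        have hv : Measurable v := (Lp.stronglyMeasurable v).measurable
        exact (((hc.measurable.comp hv).sub hv).enorm).pow_const _
      · filter_upwards [eventually_ge_atTop 1] with N hN
        refine Eventually.of_forall fun x => ?_
        gcongr
        have h1 : ‖h N (v x)‖ₑ ≤ ‖v x‖ₑ := by
          rw [enorm_le_iff_norm_le]
          simpa [h0 N hN] using hL N hN (v x) 0
        rw [two_mul]
        exact enorm_sub_le.trans (add_le_add h1 le_rfl)
      · refine Eventually.of_forall fun x => ?_
        have h1 : Tendsto (fun N => ‖h N (v x) - v x‖ₑ) atTop (𝓝 0) := by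
          have := ((ht (v x)).sub_const (v x)).enorm
          simpa using this
        have h3 := (ENNReal.continuous_rpow_const (y := (2 : ℝ))).tendsto 0 |>.comp h1
        simpa [Function.comp_def] using h3
    have h2 : Tendsto (fun N => eLpNorm (fun x => h N (v x) - v x) 2 μ) atTop (𝓝 0) := by
      simp_rw [eLpNorm_eq_lintegral_rpow_enorm_toReal (p := 2) two_ne_zero ENNReal.ofNat_ne_top]
      have := (ENNReal.continuous_rpow_const (y := (1 / 2 : ℝ))).tendsto 0 |>.comp hlim
      simpa [Function.comp_def] using this
    refine h2.congr' ?_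
    filter_upwards [eventually_ge_atTop 1] with N hN
    refine eLpNorm_congr_ae ?_
    filter_upwards [coeFn_toL2 (hm N hN v)] with x hx
    rw [Pi.sub_apply, compL2, hx]

end L2

/-! ### Jets in `L²` -/

section Jets

variable {d : ℕ} {Ω : Set (Space d)} {μ : Measure (Space d)}

/-- The Hilbert space of families `(u_α)_{|α| ≤ 2}` in `L²(μ)`. -/
abbrev JetH {d : ℕ} (μ : Measure (Space d)) := PiLp 2 (fun _ : MIdx d => Lp ℝ 2 μ)

/-- The family of derivatives of `f`. -/
noncomputable def jet (μ : Measure (Space d)) (f : Space d → ℝ) : JetH μ :=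
  WithLp.toLp 2 fun α => toL2 μ (classicalD α f)

theorem jet_apply (f : Space d → ℝ) (α : MIdx d) : jet μ f α = toL2 μ (classicalD α f) := rfl

theorem norm_jetH_le [IsFiniteMeasure μ] {v : JetH μ} {M : ℝ} (hM : 0 ≤ M)
    (hv : ∀ α, ∀ᵐ x ∂μ, |v α x| ≤ M) :
    ‖v‖ ≤ Fintype.card (MIdx d) * μ.real univ ^ ((2 : ℝ≥0∞).toReal)⁻¹ * M := by
  have h1 : ∀ α, ‖v α‖ ≤ μ.real univ ^ ((2 : ℝ≥0∞).toReal)⁻¹ * M := fun α =>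
    Lp.norm_le_of_ae_bound hM (hv α)
  calc ‖v‖ ≤ ∑ α, ‖v α‖ := by
        rw [PiLp.norm_eq_of_L2]
        refine Real.sqrt_le_iff.2 ⟨Finset.sum_nonneg fun _ _ => norm_nonneg _, ?_⟩
        exact Finset.sum_sq_le_sq_sum_of_nonneg fun _ _ => norm_nonneg _
    _ ≤ ∑ _α : MIdx d, μ.real univ ^ ((2 : ℝ≥0∞).toReal)⁻¹ * M :=
        Finset.sum_le_sum fun α _ => h1 α
    _ = _ := by rw [Finset.sum_const, Finset.card_univ, nsmul_eq_mul, mul_assoc]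

theorem memLp_of_continuous [IsFiniteMeasure μ] (hΩ : Bornology.IsBounded Ω)
    (hμ : ∀ᵐ x ∂μ, x ∈ Ω) {f : Space d → ℝ} (hf : Continuous f) : MemLp f 2 μ := by
  obtain ⟨C, hC⟩ := hΩ.isCompact_closure.exists_bound_of_continuousOn hf.continuousOn
  exact MemLp.of_bound hf.aestronglyMeasurable C (hμ.mono fun x hx => hC x (subset_closure hx))

theorem memLp_classicalD [IsFiniteMeasure μ] (hΩ : Bornology.IsBounded Ω)
    (hμ : ∀ᵐ x ∂μ, x ∈ Ω) {f : Space d → ℝ} (hf : ContDiff ℝ 2 f) (α : MIdx d) :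
    MemLp (classicalD α f) 2 μ :=
  memLp_of_continuous hΩ hμ (continuous_classicalD hf α)

theorem jet_add [IsFiniteMeasure μ] (hΩ : Bornology.IsBounded Ω) (hμ : ∀ᵐ x ∂μ, x ∈ Ω)
    {f g : Space d → ℝ} (hf : ContDiff ℝ 2 f) (hg : ContDiff ℝ 2 g) :
    jet μ (fun x => f x + g x) = jet μ f + jet μ g := by
  ext1 α
  simp only [jet, PiLp.add_apply, classicalD_add hf hg]
  exact toL2_add (memLp_classicalD hΩ hμ hf α) (memLp_classicalD hΩ hμ hg α)

theorem jet_const_mul [IsFiniteMeasure μ] (hΩ : Bornology.IsBounded Ω) (hμ : ∀ᵐ x ∂μ, x ∈ Ω)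
    {f : Space d → ℝ} (hf : ContDiff ℝ 2 f) (c : ℝ) : jet μ (fun x => c * f x) = c • jet μ f := by
  ext1 α
  simp only [jet, PiLp.smul_apply, classicalD_const_mul hf]
  exact toL2_const_mul (memLp_classicalD hΩ hμ hf α) c

theorem jet_zero [IsFiniteMeasure μ] (hΩ : Bornology.IsBounded Ω) (hμ : ∀ᵐ x ∂μ, x ∈ Ω) :
    jet μ (fun _ => 0) = 0 := by
  simpa using jet_const_mul hΩ hμ (f := fun _ => (0 : ℝ)) contDiff_const 0

theorem jet_sub [IsFiniteMeasure μ] (hΩ : Bornology.IsBounded Ω) (hμ : ∀ᵐ x ∂μ, x ∈ Ω)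
    {f g : Space d → ℝ} (hf : ContDiff ℝ 2 f) (hg : ContDiff ℝ 2 g) :
    jet μ (fun x => f x - g x) = jet μ f - jet μ g := by
  have h1 : (fun x => f x - g x) = fun x => f x + (-1) * g x := by ext x; ring
  rw [h1, jet_add hΩ hμ hf (contDiff_const.mul hg), jet_const_mul hΩ hμ hg]
  simp [sub_eq_add_neg]

theorem jet_sum [IsFiniteMeasure μ] (hΩ : Bornology.IsBounded Ω) (hμ : ∀ᵐ x ∂μ, x ∈ Ω)
    {ι : Type*} (s : Finset ι) {f : ι → Space d → ℝ} (hf : ∀ i, ContDiff ℝ 2 (f i)) :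
    jet μ (fun x => ∑ i ∈ s, f i x) = ∑ i ∈ s, jet μ (f i) := by
  classical
  induction s using Finset.induction_on with
  | empty => simpa using jet_zero hΩ hμ
  | insert a s ha ih =>
    simp only [Finset.sum_insert ha]
    rw [jet_add hΩ hμ (hf a) (ContDiff.sum fun i _ => hf i), ih]

theorem norm_jet_le [IsFiniteMeasure μ] (hΩ : Bornology.IsBounded Ω) (hμ : ∀ᵐ x ∂μ, x ∈ Ω)
    {f : Space d → ℝ} (hf : ContDiff ℝ 2 f) {M : ℝ} (hM : 0 ≤ M)
    (hfM : ∀ x ∈ Ω, ∀ α, |classicalD α f x| ≤ M) :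
    ‖jet μ f‖ ≤ Fintype.card (MIdx d) * μ.real univ ^ ((2 : ℝ≥0∞).toReal)⁻¹ * M := by
  refine norm_jetH_le hM fun α => ?_
  filter_upwards [hμ, coeFn_toL2 (memLp_classicalD hΩ hμ hf α)] with x hx h1
  rw [jet_apply, h1]
  exact hfM x hx α

theorem classicalD_sub {f g : Space d → ℝ} (hf : ContDiff ℝ 2 f) (hg : ContDiff ℝ 2 g)
    (α : MIdx d) : classicalD α (fun x => f x - g x) =
      fun x => classicalD α f x - classicalD α g x := by
  have h1 : (fun x => f x - g x) = fun x => f x + (-1) * g x := by ext x; ring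
  rw [h1, classicalD_add hf (contDiff_const.mul hg), classicalD_const_mul hg]
  ext x; ring

/-- The differential operator on jets. -/
noncomputable def jetOp {a : MIdx d → Space d → ℝ} (ha : ∀ α, Measurable (a α)) {k : ℝ}
    (hk : ∀ α, ∀ᵐ x ∂μ, |a α x| ≤ k) : JetH μ →L[ℝ] Lp ℝ 2 μ :=
  ∑ α, (mulL2 (ha α) (hk α)).comp (PiLp.proj 2 (fun _ : MIdx d => Lp ℝ 2 μ) α)

theorem jetOp_apply {a : MIdx d → Space d → ℝ} (ha : ∀ α, Measurable (a α)) {k : ℝ}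
    (hk : ∀ α, ∀ᵐ x ∂μ, |a α x| ≤ k) (v : JetH μ) :
    jetOp ha hk v =ᵐ[μ] fun x => pdeSymbol a x (fun α => v α x) := by
  have h1 : jetOp ha hk v = ∑ α, mulL2 (ha α) (hk α) (v α) := by
    simp [jetOp, _root_.sum_apply]
  rw [h1]
  filter_upwards [Lp.coeFn_finsetSum Finset.univ fun α => mulL2 (ha α) (hk α) (v α),
    eventually_all.2 fun α => mulL2_apply (ha α) (hk α) (v α)] with x h2 h3
  rw [h2, Finset.sum_apply]
  exact Finset.sum_congr rfl fun α _ => h3 α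

theorem jetOp_jet [IsFiniteMeasure μ] (hΩ : Bornology.IsBounded Ω) (hμ : ∀ᵐ x ∂μ, x ∈ Ω)
    {a : MIdx d → Space d → ℝ} (ha : ∀ α, Measurable (a α)) {k : ℝ}
    (hk : ∀ α, ∀ᵐ x ∂μ, |a α x| ≤ k) {f : Space d → ℝ} (hf : ContDiff ℝ 2 f) :
    jetOp ha hk (jet μ f) =ᵐ[μ] pdeOp a f := by
  filter_upwards [jetOp_apply ha hk (jet μ f),
    eventually_all.2 fun α => coeFn_toL2 (memLp_classicalD hΩ hμ hf α)] with x h1 h2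
  rw [h1, pdeOp]
  congr 1
  exact funext fun α => h2 α

theorem LipschitzCondition.exists_bound {a : MIdx d → Space d → ℝ} (h : LipschitzCondition Ω a)
    (hμ : ∀ᵐ x ∂μ, x ∈ Ω) : ∃ k, ∀ α, ∀ᵐ x ∂μ, |a α x| ≤ k := by
  classical
  obtain ⟨k, _, hk⟩ := h
  refine ⟨k, fun α => hμ.mono fun x hx => ?_⟩
  -- Comparing a unit vector with 0 isolates the single coefficient a_α(x).
  have := hk x hx (Pi.single α 1) 0
  simpa only [pdeSymbol, Pi.single_apply, mul_ite, mul_one, mul_zero, Finset.sum_ite_eq',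
    Finset.mem_univ, if_true, Pi.zero_apply, Finset.sum_const_zero, sub_zero, abs_ite, abs_one,
    abs_zero, apply_ite abs] using this

/-! ### The feature map of the network -/

/-- Derivative bounds uniform on Ω become bounds in the jet norm because μ is finite.
Differentiability in the jet norm follows from the Taylor remainder, quadratic in h and uniform in
space. -/
theorem isFeatureMap_unit [IsFiniteMeasure μ] (hΩ : Bornology.IsBounded Ω) (hμ : ∀ᵐ x ∂μ, x ∈ Ω)
    {η : Space d → ℝ} (hη : ContDiff ℝ 2 η) {σ : ℝ → ℝ} (hσ : IsCb 4 σ)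
    {ν : Measure (Par d → ℝ)} (hν : MemLp (parWeight (d := d)) 2 ν)
    (hmean : ∫ p, jet μ (unitFn 0 1 η σ p) ∂ν = 0) :
    ∃ C, 1 ≤ C ∧ IsFeatureMap ν (fun p => jet μ (unitFn 0 1 η σ p))
      (fun k p => jet μ (unitD η σ k p)) (fun p => C * parWeight p) := by
  obtain ⟨C₀, hC₀, hF, hJ, hL⟩ := exists_bound_unitD hΩ hη hσ
  have hσ3 : ContDiff ℝ 3 σ := hσ.1.of_le (by norm_num)
  have hσ2 : ContDiff ℝ 2 σ := hσ.1.of_le (by norm_num)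
  have cF : ∀ p, ContDiff ℝ 2 (unitFn 0 1 η σ p) := contDiff_unitFn hη hσ2 0 1
  have cJ : ∀ k p, ContDiff ℝ 2 (unitD η σ k p) := contDiff_unitD hη hσ3
  set K : ℝ := Fintype.card (MIdx d) * μ.real univ ^ ((2 : ℝ≥0∞).toReal)⁻¹ with hK
  have hK0 : 0 ≤ K := by positivity
  -- The summand 1 guarantees a weight of at least 1; K converts sup bounds into bounds of the jet
  -- norm.
  set C : ℝ := 1 + K * C₀ with hC
  have hC1 : 1 ≤ C := by rw [hC]; have := mul_nonneg hK0 hC₀; linarith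
  have hKC : ∀ p : Par d → ℝ, K * (C₀ * parWeight p) ≤ C * parWeight p := fun p => by
    have := parWeight_nonneg p
    rw [← mul_assoc]
    gcongr
    linarith
  have hder : ∀ p, HasFDerivAt (fun p => jet μ (unitFn 0 1 η σ p))
      (∑ k, (ContinuousLinearMap.proj (R := ℝ) (φ := fun _ : Par d => ℝ) k).smulRight
        (jet μ (unitD η σ k p))) p := by
    intro p
    rw [hasFDerivAt_iff_isLittleO_nhds_zero]
    have hO : (fun h : Par d → ℝ => jet μ (unitFn 0 1 η σ (p + h)) - jet μ (unitFn 0 1 η σ p) -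
        (∑ k, (ContinuousLinearMap.proj (R := ℝ) (φ := fun _ : Par d => ℝ) k).smulRight
          (jet μ (unitD η σ k p))) h) =O[𝓝 0] fun h : Par d → ℝ => ‖h‖ ^ 2 := by
      refine Asymptotics.IsBigO.of_bound (K * (Fintype.card (Par d) * (C₀ * parWeight p))) ?_
      filter_upwards [Metric.closedBall_mem_nhds (0 : Par d → ℝ) one_pos] with h hh
      rw [mem_closedBall_zero_iff] at hh
      have hw := parWeight_nonneg p
      have cS : ContDiff ℝ 2 fun x => ∑ k, h k * unitD η σ k p x :=
        ContDiff.sum fun k _ => contDiff_const.mul (cJ k p)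
      have heq : jet μ (unitFn 0 1 η σ (p + h)) - jet μ (unitFn 0 1 η σ p) -
        (∑ k, (ContinuousLinearMap.proj (R := ℝ) (φ := fun _ : Par d => ℝ) k).smulRight
          (jet μ (unitD η σ k p))) h = jet μ (fun x => unitFn 0 1 η σ (p + h) x -
            unitFn 0 1 η σ p x - ∑ k, h k * unitD η σ k p x) := by
        rw [jet_sub hΩ hμ ((cF _).sub (cF _)) cS, jet_sub hΩ hμ (cF _) (cF _),
          jet_sum hΩ hμ _ fun k => contDiff_const.mul (cJ k p)]
        simp only [_root_.sum_apply, ContinuousLinearMap.smulRight_apply,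
          ContinuousLinearMap.proj_apply, jet_const_mul hΩ hμ (cJ _ p)]
      rw [heq, norm_pow, norm_norm, mul_assoc]
      refine (norm_jet_le hΩ hμ (((cF _).sub (cF _)).sub cS)
        (M := Fintype.card (Par d) * (C₀ * parWeight p) * ‖h‖ ^ 2) (by positivity)
        fun x hx α => ?_)
      rw [classicalD_sub ((cF _).sub (cF _)) cS, classicalD_sub (cF _) (cF _),
        classicalD_sum _ fun k => contDiff_const.mul (cJ k p)]
      simp only [classicalD_const_mul (cJ _ p)]
      exact abs_taylor_unit_le hη hσ3 hL hC₀ hh hx α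
    exact hO.trans_isLittleO (Asymptotics.isLittleO_norm_pow_id one_lt_two)
  have hwm : MemLp (fun p => C * parWeight (d := d) p) 2 ν := hν.const_mul C
  refine ⟨C, hC1, hder, fun p => ?_, fun k p => ?_, fun k p p' hpp => ?_,
    continuous_const.mul continuous_parWeight, hwm, ?_, hmean⟩
  · exact one_le_mul_of_one_le_of_one_le hC1 (one_le_parWeight p)
  · have := parWeight_nonneg p
    exact (norm_jet_le hΩ hμ (cJ k p) (by positivity) (hJ k p)).trans (hKC p)
  · have hw := parWeight_nonneg p
    rw [← jet_sub hΩ hμ (cJ k p') (cJ k p)]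
    refine (norm_jet_le hΩ hμ ((cJ k p').sub (cJ k p)) (M := C₀ * parWeight p * ‖p' - p‖)
      (by positivity) fun x hx α => ?_).trans ?_
    · rw [classicalD_sub (cJ k p') (cJ k p)]
      exact hL k p p' hpp x hx α
    · rw [← mul_assoc]
      exact mul_le_mul_of_nonneg_right (hKC p) (norm_nonneg _)
  · refine hwm.mono' (Continuous.aestronglyMeasurable (continuous_iff_continuousAt.2 fun p =>
      (hder p).continuousAt)) (Eventually.of_forall fun p => ?_)
    have := parWeight_nonneg p
    exact (norm_jet_le hΩ hμ (cF p) (by positivity) (hF p)).trans (hKC p)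

end Jets

/-! ### The Sobolev space as a closed subspace of the space of jets -/

section Sobolev

variable {d : ℕ} {Ω : Set (Space d)} {μ : Measure (Space d)}

theorem HasBoundedLogDensity.ae_mem (h : HasBoundedLogDensity μ Ω) (hΩ : IsOpen Ω) :
    ∀ᵐ x ∂μ, x ∈ Ω :=
  h.1.ae_le (ae_restrict_mem hΩ.measurableSet)

/-- The density of μ is bounded below by exp(-C). Hence L²(μ) embeds continuously in L² of Lebesgue
measure on Ω, and pairing with a test function is continuous on L²(μ). -/
theorem HasBoundedLogDensity.exists_le_smul [IsFiniteMeasure μ] (h : HasBoundedLogDensity μ Ω) :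
    ∃ c : ℝ≥0∞, c ≠ ⊤ ∧ volume.restrict Ω ≤ c • μ := by
  obtain ⟨h1, h2, C, hC⟩ := h
  refine ⟨ENNReal.ofReal (Real.exp C), ENNReal.ofReal_ne_top, ?_⟩
  -- Positivity needs its own argument: `Real.log 0 = 0` satisfies the bound on the logarithm. It
  -- comes from the equivalence of the two measures.
  have hpos : ∀ᵐ x ∂(volume.restrict Ω), 0 < μ.rnDeriv (volume.restrict Ω) x :=
    h2.ae_le (Measure.rnDeriv_pos h1)
  have hle : ∀ᵐ x ∂(volume.restrict Ω),
      1 ≤ ENNReal.ofReal (Real.exp C) * μ.rnDeriv (volume.restrict Ω) x := by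
    filter_upwards [hC, hpos, Measure.rnDeriv_lt_top μ (volume.restrict Ω)] with x hx hx0 hxt
    have ht : 0 < (μ.rnDeriv (volume.restrict Ω) x).toReal := ENNReal.toReal_pos hx0.ne' hxt.ne
    have h3 : Real.exp (-C) ≤ (μ.rnDeriv (volume.restrict Ω) x).toReal := by
      rw [← Real.le_log_iff_exp_le ht]
      exact (abs_le.1 hx).1
    rw [← ENNReal.ofReal_toReal hxt.ne, ← ENNReal.ofReal_mul (Real.exp_pos _).le,
      ← ENNReal.ofReal_one]
    refine ENNReal.ofReal_le_ofReal ?_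
    calc (1 : ℝ) = Real.exp C * Real.exp (-C) := by rw [← Real.exp_add]; simp
      _ ≤ _ := by gcongr
  conv_rhs => rw [← Measure.withDensity_rnDeriv_eq μ (volume.restrict Ω) h1]
  rw [← withDensity_smul _ (Measure.measurable_rnDeriv _ _)]
  calc volume.restrict Ω = (volume.restrict Ω).withDensity 1 := by rw [withDensity_one]
    _ ≤ _ := withDensity_mono hle

theorem IsTestFunction.contDiff_two {φ : Space d → ℝ} (h : IsTestFunction Ω φ) : ContDiff ℝ 2 φ :=
  contDiff_infty.1 h.1 2

theorem isTestFunction_zero : IsTestFunction Ω (fun _ => 0) :=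
  ⟨contDiff_const, HasCompactSupport.zero, by
    rw [show (fun _ : Space d => (0 : ℝ)) = 0 from rfl, tsupport_eq_empty_iff.2 rfl]
    exact empty_subset _⟩

theorem IsTestFunction.add {φ χ : Space d → ℝ} (h : IsTestFunction Ω φ) (h' : IsTestFunction Ω χ) :
    IsTestFunction Ω fun x => φ x + χ x :=
  ⟨h.1.add h'.1, h.2.1.add h'.2.1, (tsupport_add φ χ).trans (union_subset h.2.2 h'.2.2)⟩

theorem IsTestFunction.const_mul {φ : Space d → ℝ} (h : IsTestFunction Ω φ) (c : ℝ) :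
    IsTestFunction Ω fun x => c * φ x :=
  ⟨contDiff_const.mul h.1, h.2.1.mul_left,
    (closure_mono fun x hx => by
      simp only [Function.mem_support] at hx ⊢
      exact right_ne_zero_of_mul hx).trans h.2.2⟩

/-- The functional `u ↦ ∫_Ω u φ` on `L²(μ)`. -/
noncomputable def testFunctional [IsFiniteMeasure μ] {c : ℝ≥0∞} (hc : c ≠ ⊤)
    (hle : volume.restrict Ω ≤ c • μ) (φ : Space d → ℝ) : Lp ℝ 2 μ →L[ℝ] ℝ :=
  (innerSL ℝ (toL2 (volume.restrict Ω) φ)).comp (Lp.LpToLpOfMeasureLeSMul hc hle)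

theorem testFunctional_apply [IsFiniteMeasure μ] {c : ℝ≥0∞} (hc : c ≠ ⊤)
    (hle : volume.restrict Ω ≤ c • μ) {φ : Space d → ℝ} (hφ : MemLp φ 2 (volume.restrict Ω))
    (u : Lp ℝ 2 μ) : testFunctional hc hle φ u = ∫ x in Ω, u x * φ x := by
  simp only [testFunctional, ContinuousLinearMap.comp_apply, innerSL_apply_apply]
  rw [L2.inner_def]
  refine integral_congr_ae ?_
  filter_upwards [coeFn_toL2 hφ, Lp.coeFn_LpToLpOfMeasureLeSMul hc hle u] with x h1 h2
  rw [h1, h2]; rfl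

theorem memLp_volume_of_continuous (hΩo : IsOpen Ω) (hΩ : Bornology.IsBounded Ω)
    {f : Space d → ℝ} (hf : Continuous f) : MemLp f 2 (volume.restrict Ω) := by
  have : IsFiniteMeasure (volume.restrict Ω) := ⟨by
    rw [Measure.restrict_apply_univ]; exact hΩ.measure_lt_top⟩
  exact memLp_of_continuous hΩ (ae_restrict_mem hΩo.measurableSet) hf

/-- The same family of functions in `JetL2 μ` and in `JetH μ`. -/
noncomputable def jetEquiv (μ : Measure (Space d)) : JetH μ ≃L[ℝ] JetL2 μ :=
  (PiLp.continuousLinearEquiv 2 ℝ fun _ : MIdx d => Lp ℝ 2 μ).trans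
    (PiLp.continuousLinearEquiv 1 ℝ fun _ : MIdx d => Lp ℝ 2 μ).symm

theorem jetEquiv_apply (v : JetH μ) (α : MIdx d) : jetEquiv μ v α = v α := rfl

/-- Approximation in the first order norm by test functions, for elements of `L²`. -/
theorem enorm_sub_toL2 {φ : Space d → ℝ} {α : MIdx d} (hφ : MemLp (classicalD α φ) 2 μ)
    (u : Lp ℝ 2 μ) :
    eLpNorm (fun x => u x - classicalD α φ x) 2 μ = ‖u - toL2 μ (classicalD α φ)‖ₑ := by
  rw [← enorm_neg, neg_sub, enorm_toL2_sub hφ, ← eLpNorm_neg]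
  congr 1
  ext x
  simp

/-- Expressed by continuous linear functionals, the weak derivative condition is visibly linear and
closed. -/
theorem mem_H2_iff [IsFiniteMeasure μ] (hΩo : IsOpen Ω) (hΩ : Bornology.IsBounded Ω) {c : ℝ≥0∞}
    (hc : c ≠ ⊤) (hle : volume.restrict Ω ≤ c • μ) (u : JetL2 μ) :
    u ∈ H2 Ω μ ↔ ∀ α φ, IsTestFunction Ω φ → testFunctional hc hle (classicalD α φ) (u (.inl ())) =
      (-1) ^ α.order * testFunctional hc hle φ (u α) := by
  refine forall_congr' fun α => forall_congr' fun φ => forall_congr' fun hφ => ?_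
  rw [testFunctional_apply hc hle (memLp_volume_of_continuous hΩo hΩ
    (continuous_classicalD hφ.contDiff_two α)), testFunctional_apply hc hle
    (memLp_volume_of_continuous hΩo hΩ hφ.1.continuous)]

theorem mem_H2zero_iff [IsFiniteMeasure μ] (hΩ : Bornology.IsBounded Ω) (hμ : ∀ᵐ x ∂μ, x ∈ Ω)
    (u : JetL2 μ) : u ∈ H2zero Ω μ ↔ u ∈ H2 Ω μ ∧ ∀ ε : ℝ≥0∞, 0 < ε →
      ∃ φ : Space d → ℝ, IsTestFunction Ω φ ∧
        ∀ α : MIdx d, α.order ≤ 1 → ‖u α - toL2 μ (classicalD α φ)‖ₑ < ε := by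
  refine and_congr_right fun _ => forall_congr' fun ε => forall_congr' fun _ =>
    exists_congr fun φ => and_congr_right fun hφ => forall_congr' fun α => ?_
  rw [enorm_sub_toL2 (memLp_classicalD hΩ hμ hφ.contDiff_two α)]

/-- `H²_{(0)}` as a subspace of the Hilbert space of jets. -/
noncomputable def H2zeroSub [IsFiniteMeasure μ] (hΩo : IsOpen Ω) (hΩ : Bornology.IsBounded Ω)
    (hd : HasBoundedLogDensity μ Ω) : Submodule ℝ (JetH μ) where
  carrier := {v | jetEquiv μ v ∈ H2zero Ω μ}
  add_mem' {u v} hu hv := by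
    obtain ⟨c, hc, hle⟩ := hd.exists_le_smul
    have hμ := hd.ae_mem hΩo
    simp only [Set.mem_ofPred_eq, mem_H2zero_iff hΩ hμ, mem_H2_iff hΩo hΩ hc hle, jetEquiv_apply]
      at hu hv ⊢
    refine ⟨fun α φ hφ => ?_, fun ε hε => ?_⟩
    · rw [PiLp.add_apply, PiLp.add_apply, map_add, map_add, hu.1 α φ hφ, hv.1 α φ hφ, mul_add]
    · have hε2 : 0 < ε / 2 := ENNReal.half_pos hε.ne'
      obtain ⟨φ, hφ, h1⟩ := hu.2 _ hε2
      obtain ⟨χ, hχ, h2⟩ := hv.2 _ hε2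
      refine ⟨_, hφ.add hχ, fun α hα => ?_⟩
      rw [classicalD_add hφ.contDiff_two hχ.contDiff_two,
        toL2_add (memLp_classicalD hΩ hμ hφ.contDiff_two α)
          (memLp_classicalD hΩ hμ hχ.contDiff_two α), PiLp.add_apply, add_sub_add_comm]
      calc _ ≤ _ := enorm_add_le _ _
        _ < ε / 2 + ε / 2 := ENNReal.add_lt_add (h1 α hα) (h2 α hα)
        _ = ε := ENNReal.add_halves ε
  zero_mem' := by
    obtain ⟨c, hc, hle⟩ := hd.exists_le_smul
    have hμ := hd.ae_mem hΩo
    simp only [Set.mem_ofPred_eq, mem_H2zero_iff hΩ hμ, mem_H2_iff hΩo hΩ hc hle, jetEquiv_apply]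
    refine ⟨fun α φ hφ => by simp, fun ε hε => ⟨_, isTestFunction_zero, fun α _ => ?_⟩⟩
    have h0 := congrArg (fun v : JetH μ => v α) (jet_zero hΩ hμ)
    simp only [jet_apply] at h0
    rw [h0]
    simpa using hε
  smul_mem' r u hu := by
    obtain ⟨c, hc, hle⟩ := hd.exists_le_smul
    have hμ := hd.ae_mem hΩo
    simp only [Set.mem_ofPred_eq, mem_H2zero_iff hΩ hμ, mem_H2_iff hΩo hΩ hc hle, jetEquiv_apply]
      at hu ⊢
    refine ⟨fun α φ hφ => ?_, fun ε hε => ?_⟩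
    · rw [PiLp.smul_apply, PiLp.smul_apply, map_smul, map_smul, hu.1 α φ hφ]
      simp only [smul_eq_mul]; ring
    · have hr : ‖r‖ₑ + 1 ≠ ⊤ := by simp
      have hr0 : ‖r‖ₑ + 1 ≠ 0 := by simp
      obtain ⟨φ, hφ, h1⟩ := hu.2 (ε / (‖r‖ₑ + 1)) (ENNReal.div_pos hε.ne' hr)
      refine ⟨_, hφ.const_mul r, fun α hα => ?_⟩
      rw [classicalD_const_mul hφ.contDiff_two,
        toL2_const_mul (memLp_classicalD hΩ hμ hφ.contDiff_two α), PiLp.smul_apply, ← smul_sub,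
        enorm_smul]
      calc ‖r‖ₑ * ‖u α - toL2 μ (classicalD α φ)‖ₑ
          ≤ (‖r‖ₑ + 1) * ‖u α - toL2 μ (classicalD α φ)‖ₑ := by gcongr; exact le_self_add
        _ < (‖r‖ₑ + 1) * (ε / (‖r‖ₑ + 1)) := by
            exact (ENNReal.mul_lt_mul_iff_right hr0 hr).2 (h1 α hα)
        _ ≤ ε := ENNReal.mul_div_le

theorem mem_H2zeroSub [IsFiniteMeasure μ] (hΩo : IsOpen Ω) (hΩ : Bornology.IsBounded Ω)
    (hd : HasBoundedLogDensity μ Ω) (v : JetH μ) :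
    v ∈ H2zeroSub hΩo hΩ hd ↔ jetEquiv μ v ∈ H2zero Ω μ := Iff.rfl

/-- Closedness is what lets Bochner integrals and solutions of differential equations remain in the
space. The weak derivative relations are closed conditions, and approximability by test functions
passes to limits by halving ε. -/
theorem isClosed_H2zeroSub [IsFiniteMeasure μ] (hΩo : IsOpen Ω) (hΩ : Bornology.IsBounded Ω)
    (hd : HasBoundedLogDensity μ Ω) : IsClosed (H2zeroSub hΩo hΩ hd : Set (JetH μ)) := by
  obtain ⟨c, hc, hle⟩ := hd.exists_le_smul
  have hμ := hd.ae_mem hΩo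
  refine isClosed_of_closure_subset fun v hv => ?_
  have hcont : ∀ α, Continuous fun v : JetH μ => v α := fun α => PiLp.continuous_apply 2 _ α
  rw [SetLike.mem_coe, mem_H2zeroSub, mem_H2zero_iff hΩ hμ]
  constructor
  · have hcl : IsClosed {v : JetH μ | jetEquiv μ v ∈ H2 Ω μ} := by
      simp only [mem_H2_iff hΩo hΩ hc hle, jetEquiv_apply, ofPred_forall]
      refine isClosed_iInter fun α => isClosed_iInter fun φ => isClosed_iInter fun _ => ?_
      exact isClosed_eq ((testFunctional hc hle _).continuous.comp (hcont _))
        (continuous_const.mul ((testFunctional hc hle _).continuous.comp (hcont _)))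
    exact closure_minimal (fun u hu => hu.1) hcl hv
  · intro ε hε
    have hε2 : 0 < ε / 2 := ENNReal.half_pos hε.ne'
    obtain ⟨u, hu, huv⟩ := EMetric.mem_closure_iff.1 hv _ hε2
    rw [SetLike.mem_coe, mem_H2zeroSub, mem_H2zero_iff hΩ hμ] at hu
    obtain ⟨φ, hφ, h1⟩ := hu.2 _ hε2
    refine ⟨φ, hφ, fun α hα => ?_⟩
    have h2 : ‖v α - u α‖ₑ < ε / 2 := by
      refine lt_of_le_of_lt ?_ huv
      rw [edist_eq_enorm_sub, ← PiLp.sub_apply]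
      exact PiLp.enorm_apply_le (v - u) α
    have h3 := h1 α hα
    rw [jetEquiv_apply] at h3 ⊢
    calc ‖v α - toL2 μ (classicalD α φ)‖ₑ
        = ‖(v α - u α) + (u α - toL2 μ (classicalD α φ))‖ₑ := by rw [sub_add_sub_cancel]
      _ ≤ _ := enorm_add_le _ _
      _ < ε / 2 + ε / 2 := ENNReal.add_lt_add h2 h3
      _ = ε := ENNReal.add_halves ε

/-- Weak derivatives are unique. -/
theorem H2.eq_of_ae_eq [IsFiniteMeasure μ] (hΩo : IsOpen Ω) (hΩ : Bornology.IsBounded Ω)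
    (hd : HasBoundedLogDensity μ Ω) {u v : JetL2 μ} (hu : u ∈ H2 Ω μ) (hv : v ∈ H2 Ω μ)
    (h : u (.inl ()) = v (.inl ())) : u = v := by
  obtain ⟨c, hc, hle⟩ := hd.exists_le_smul
  rw [mem_H2_iff hΩo hΩ hc hle] at hu hv
  ext1 α
  have hfin : IsFiniteMeasure (volume.restrict Ω) := ⟨by
    rw [Measure.restrict_apply_univ]; exact hΩ.measure_lt_top⟩
  have hmem : MemLp (u α - v α : Lp ℝ 2 μ) 2 (volume.restrict Ω) :=
    (Lp.memLp (u α - v α)).of_measure_le_smul hc hle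
  have hint : IntegrableOn (u α - v α : Lp ℝ 2 μ) Ω volume := hmem.integrable (by norm_num)
  have hz : ∀ᵐ x ∂volume, x ∈ Ω → (u α - v α : Lp ℝ 2 μ) x = 0 := by
    refine hΩo.ae_eq_zero_of_integral_contDiff_smul_eq_zero hint.locallyIntegrableOn ?_
    intro φ h1 h2 h3
    have hφ : IsTestFunction Ω φ := ⟨h1, h2, h3⟩
    have h4 : testFunctional hc hle φ (u α - v α) = 0 := by
      have h5 := hu α φ hφ
      rw [h, hv α φ hφ] at h5
      have h6 : testFunctional hc hle φ (v α) = testFunctional hc hle φ (u α) :=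
        mul_left_cancel₀ (pow_ne_zero _ (by norm_num)) h5
      rw [map_sub, h6, sub_self]
    rw [testFunctional_apply hc hle (memLp_volume_of_continuous hΩo hΩ h1.continuous)] at h4
    rw [← h4, ← setIntegral_eq_integral_of_forall_compl_eq_zero (s := Ω)]
    · exact integral_congr_ae (Eventually.of_forall fun x => by simp [mul_comm])
    · intro x hx
      rw [image_eq_zero_of_notMem_tsupport fun hx' => hx (h3 hx'), zero_smul]
  have hz' : ∀ᵐ x ∂μ, (u α - v α : Lp ℝ 2 μ) x = 0 :=
    hd.1.ae_le ((ae_restrict_iff' hΩo.measurableSet).2 hz)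
  have : u α - v α = 0 := by
    rw [Lp.eq_zero_iff_ae_eq_zero]
    exact hz'
  exact sub_eq_zero.1 this

end Sobolev

/-! ### Smooth functions vanishing on the boundary -/

section Boundary

variable {d : ℕ} {Ω : Set (Space d)} {μ : Measure (Space d)}

theorem continuous_partialD {f : Space d → ℝ} (hf : ContDiff ℝ 1 f) (i : Fin d) :
    Continuous (partialD i f) :=
  (hf.continuous_fderiv one_ne_zero).clm_apply continuous_const

theorem partialD_comm {f : Space d → ℝ} (hf : ContDiff ℝ 2 f) (i j : Fin d) (x : Space d) :
    partialD i (partialD j f) x = partialD j (partialD i f) x := by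
  have hd : Differentiable ℝ (fderiv ℝ f) :=
    (hf.fderiv_right (m := 1) (by norm_num)).differentiable one_ne_zero
  have h : ∀ i j, partialD i (partialD j f) x =
      fderiv ℝ (fderiv ℝ f) x (EuclideanSpace.single i 1) (EuclideanSpace.single j 1) := by
    intro i j
    unfold partialD
    rw [fderiv_clm_apply (hd x) (differentiableAt_const _)]
    simp
  rw [h, h]
  exact (hf.contDiffAt.isSymmSndFDerivAt (by simp)) _ _

theorem HasCompactSupport.partialD {φ : Space d → ℝ} (h : HasCompactSupport φ) (i : Fin d) :
    HasCompactSupport (partialD i φ) :=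
  h.fderiv_apply ℝ _

theorem tsupport_partialD_subset (φ : Space d → ℝ) (i : Fin d) :
    tsupport (partialD i φ) ⊆ tsupport φ :=
  (closure_mono fun x hx => by
    simp only [Function.mem_support, _root_.partialD] at hx ⊢
    intro h0
    exact hx (by rw [h0]; rfl)).trans (tsupport_fderiv_subset ℝ (f := φ))

/-- Integration by parts. -/
theorem integral_mul_partialD {f φ : Space d → ℝ} (hf : ContDiff ℝ 1 f) (hφ : ContDiff ℝ 1 φ)
    (hs : HasCompactSupport φ) (i : Fin d) :
    ∫ x, f x * partialD i φ x = -∫ x, partialD i f x * φ x := by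
  refine integral_mul_fderiv_eq_neg_fderiv_mul_of_integrable ?_ ?_ ?_
    (fun x _ => hf.differentiable one_ne_zero x) (fun x _ => hφ.differentiable one_ne_zero x)
  · exact ((continuous_partialD hf i).mul hφ.continuous).integrable_of_hasCompactSupport hs.mul_left
  · exact (hf.continuous.mul (continuous_partialD hφ i)).integrable_of_hasCompactSupport
      (hs.partialD i).mul_left
  · exact (hf.continuous.mul hφ.continuous).integrable_of_hasCompactSupport hs.mul_left

theorem setIntegral_mul_eq_integral {u φ : Space d → ℝ} (h : tsupport φ ⊆ Ω) :
    ∫ x in Ω, u x * φ x = ∫ x, u x * φ x :=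
  setIntegral_eq_integral_of_forall_compl_eq_zero fun x hx => by
    rw [image_eq_zero_of_notMem_tsupport fun hx' => hx (h hx'), mul_zero]

/-- Classical derivatives are weak derivatives. -/
theorem isWeakD_classicalD {f : Space d → ℝ} (hf : ContDiff ℝ 2 f) (α : MIdx d) :
    IsWeakD Ω α f (classicalD α f) := by
  intro φ hφ
  have hf1 : ContDiff ℝ 1 f := hf.of_le (by norm_num)
  have hφ2 := hφ.contDiff_two
  have hφ1 : ContDiff ℝ 1 φ := hφ2.of_le (by norm_num)
  have hts : ∀ i, tsupport (partialD i φ) ⊆ Ω := fun i =>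
    (tsupport_partialD_subset φ i).trans hφ.2.2
  rcases α with _ | i | ⟨⟨i, j⟩, hij⟩
  · simp [classicalD, MIdx.order]
  · simp only [classicalD, MIdx.order, pow_one]
    rw [setIntegral_mul_eq_integral (hts i), setIntegral_mul_eq_integral hφ.2.2,
      integral_mul_partialD hf1 hφ1 hφ.2.1, neg_one_mul]
  · simp only [classicalD, MIdx.order, even_two, Even.neg_pow, one_pow, one_mul]
    rw [setIntegral_mul_eq_integral ((tsupport_partialD_subset _ i).trans (hts j)),
      setIntegral_mul_eq_integral hφ.2.2,
      integral_mul_partialD hf1 (hφ2.partialD_of_two j) (hφ.2.1.partialD j),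
      integral_mul_partialD (hf.partialD_of_two i) hφ1 hφ.2.1, neg_neg]
    -- Two integrations by parts return the derivatives in the opposite order; symmetry of second
    -- derivatives restores it.
    simp only [partialD_comm hf j i]

/-- A zero with nonzero derivative is isolated, in particular from the right, and a set of reals has
at most countably many points isolated from the right within it. -/
theorem countable_setOfPred_eq_zero_and_deriv_ne_zero {h h' : ℝ → ℝ}
    (hd : ∀ s, HasDerivAt h (h' s) s) : {s | h s = 0 ∧ h' s ≠ 0}.Countable := by
  refine (countable_setOfPred_isolated_right_within (s := {s | h s = 0 ∧ h' s ≠ 0})).mono ?_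
  intro s hs
  refine ⟨hs, ?_⟩
  have h1 := (hd s).eventually_ne (c := 0) hs.2
  rw [← empty_mem_iff_bot]
  have h2 : ∀ᶠ z in 𝓝[{s | h s = 0 ∧ h' s ≠ 0} ∩ Ioi s] s, h z ≠ 0 :=
    h1.filter_mono (nhdsWithin_mono _ fun z hz => (ne_of_gt hz.2 : z ≠ s))
  filter_upwards [h2, self_mem_nhdsWithin] with z hz hz'
  exact hz hz'.1.1

/-- The gradient vanishes almost everywhere on the zero set. -/
theorem ae_partialD_eq_zero {f : Space d → ℝ} (hf : ContDiff ℝ 1 f) (i : Fin d) :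
    ∀ᵐ x ∂(volume : Measure (Space d)), f x = 0 → partialD i f x = 0 := by
  let L : ℝ →ₗ[ℝ] Space d := LinearMap.toSpanSingleton ℝ (Space d) (EuclideanSpace.single i 1)
  have hL : ∀ s : ℝ, L s = s • EuclideanSpace.single i 1 := fun s => rfl
  have hm : MeasurableSet {x | f x = 0 → partialD i f x = 0} := by
    have h1 : MeasurableSet {x | f x = 0} := measurableSet_eq_fun hf.continuous.measurable
      measurable_const
    have h2 : MeasurableSet {x | partialD i f x = 0} :=
      measurableSet_eq_fun (continuous_partialD hf i).measurable measurable_const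
    convert h1.compl.union h2 using 1
    ext x
    simp [imp_iff_not_or]
  -- Fubini along lines in direction e_i: on each line the exceptional set is countable, hence null.
  refine ae_mem_of_ae_add_linearMap_mem L (volume : Measure ℝ) volume hm fun y => ?_
  have hder : ∀ s : ℝ, HasDerivAt (fun s => f (y + L s)) (partialD i f (y + L s)) s := by
    intro s
    have h1 : HasDerivAt (fun s : ℝ => y + L s) (EuclideanSpace.single i 1) s := by
      simp only [hL]
      simpa using ((hasDerivAt_id s).smul_const (EuclideanSpace.single i (1 : ℝ))).const_add y
    exact ((hf.differentiable one_ne_zero _).hasFDerivAt).comp_hasDerivAt s h1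
  have h0 := (countable_setOfPred_eq_zero_and_deriv_ne_zero hder).measure_zero volume
  rw [ae_iff]
  exact measure_mono_null (fun s (hs : ¬(f (y + L s) = 0 → _)) => Classical.not_imp.1 hs) h0

/-- Approximation of a compactly supported `C¹` function by test functions. -/
theorem exists_isTestFunction_near (hΩo : IsOpen Ω) {v : Space d → ℝ} (hv : ContDiff ℝ 1 v)
    (hs : HasCompactSupport v) (hsub : tsupport v ⊆ Ω) {ε : ℝ} (hε : 0 < ε) :
    ∃ φ, IsTestFunction Ω φ ∧ (∀ x, |v x - φ x| ≤ ε) ∧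
      ∀ i x, |partialD i v x - partialD i φ x| ≤ ε := by
  obtain ⟨r, hr, hrΩ⟩ := hs.isCompact.exists_cthickening_subset_open hΩo hsub
  have hu : ∀ w : Space d → ℝ, Continuous w → HasCompactSupport w →
      ∃ δ > 0, ∀ x y, dist x y < δ → dist (w x) (w y) < ε := fun w hw hws => by
    have h := hws.uniformContinuous_of_continuous hw
    obtain ⟨δ, hδ, h1⟩ := Metric.uniformContinuous_iff.1 h ε hε
    exact ⟨δ, hδ, fun x y hxy => h1 hxy⟩
  obtain ⟨δ₀, hδ₀, h₀⟩ := hu v hv.continuous hs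
  choose δ₁ hδ₁ h₁ using fun i => hu (partialD i v) (continuous_partialD hv i) (hs.partialD i)
  -- The mollification radius must keep the support inside Ω and be small for the uniform continuity
  -- of v and of all its first derivatives.
  have hpos : ∃ δ > 0, δ ≤ r ∧ δ ≤ δ₀ ∧ ∀ i, δ ≤ δ₁ i := by
    have : ∀ᶠ δ in 𝓝[>] (0 : ℝ), δ ≤ r ∧ δ ≤ δ₀ ∧ ∀ i, δ ≤ δ₁ i := by
      have hle : ∀ a : ℝ, 0 < a → ∀ᶠ δ in 𝓝[>] (0 : ℝ), δ ≤ a := fun a ha =>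
        mem_nhdsWithin_of_mem_nhds (Iic_mem_nhds ha)
      exact (hle r hr).and ((hle δ₀ hδ₀).and (eventually_all.2 fun i => hle _ (hδ₁ i)))
    obtain ⟨δ, h1, h2⟩ := (this.and self_mem_nhdsWithin).exists
    exact ⟨δ, h2, h1⟩
  obtain ⟨δ, hδ, hδr, hδ0, hδ1⟩ := hpos
  let B : ContDiffBump (0 : Space d) := ⟨δ / 2, δ, half_pos hδ, half_lt_self hδ⟩
  let φ : Space d → ℝ := convolution (B.normed volume) v (ContinuousLinearMap.lsmul ℝ ℝ) volume
  have hBi : LocallyIntegrable (B.normed (volume : Measure (Space d))) volume :=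
    B.continuous_normed.locallyIntegrable
  have hφd : ∀ i x, partialD i φ x = convolution (B.normed volume) (partialD i v)
      (ContinuousLinearMap.lsmul ℝ ℝ) volume x := fun i x => by
    have h1 := hs.hasFDerivAt_convolution_right (𝕜 := ℝ) (ContinuousLinearMap.lsmul ℝ ℝ)
      (f := B.normed (volume : Measure (Space d))) (μ := volume) hBi hv x
    have h2 : partialD i φ x = _ := congrArg (fun T => T (EuclideanSpace.single i 1)) h1.fderiv
    rw [h2]
    exact convolution_precompR_apply _ hBi (hs.fderiv ℝ) (hv.continuous_fderiv one_ne_zero) x _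
  have hsupp : Function.support φ ⊆ Metric.cthickening δ (tsupport v) := by
    refine (support_convolution_subset _).trans ?_
    rw [B.support_normed_eq]
    rintro _ ⟨a, ha, b, hb, rfl⟩
    refine Metric.mem_cthickening_of_dist_le _ b _ _ (subset_tsupport _ hb) ?_
    simpa [dist_eq_norm] using (mem_ball_zero_iff.1 ha).le
  have hts : tsupport φ ⊆ Metric.cthickening δ (tsupport v) :=
    closure_minimal hsupp Metric.isClosed_cthickening
  refine ⟨φ, ⟨?_, ?_, ?_⟩, fun x => ?_, fun i x => ?_⟩
  · exact B.hasCompactSupport_normed.contDiff_convolution_left (n := ⊤) _ B.contDiff_normed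
      hv.continuous.locallyIntegrable
  · exact HasCompactSupport.of_support_subset_isCompact hs.isCompact.cthickening hsupp
  · exact hts.trans ((Metric.cthickening_mono hδr _).trans hrΩ)
  · rw [abs_sub_comm, ← Real.dist_eq]
    exact ContDiffBump.dist_normed_convolution_le hv.continuous.aestronglyMeasurable
      fun y hy => (h₀ y x (lt_of_lt_of_le hy hδ0)).le
  · rw [abs_sub_comm, ← Real.dist_eq, hφd]
    exact ContDiffBump.dist_normed_convolution_le (continuous_partialD hv i).aestronglyMeasurable
      fun y hy => (h₁ i y x (lt_of_lt_of_le hy (hδ1 i))).le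

/-- A smooth function which vanishes near `0` and is the identity near infinity. -/
theorem exists_smooth_truncation : ∃ G : ℝ → ℝ, ContDiff ℝ 1 G ∧ (∀ s, |s| ≤ 1 → G s = 0) ∧
    (∀ s, |G s| ≤ |s|) ∧ (∀ s, 2 < |s| → G s = s ∧ deriv G s = 1) ∧ deriv G 0 = 0 ∧
    ∃ M, ∀ s, |deriv G s| ≤ M := by
  -- The transition factor is 0 for |s| ≤ 1 and 1 for s² ≥ 2, in particular for |s| > 2.
  let G : ℝ → ℝ := fun s => s * Real.smoothTransition (s ^ 2 - 1)
  have hG : ContDiff ℝ 1 G :=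
    contDiff_id.mul ((Real.smoothTransition.contDiff (n := 1)).comp
      ((contDiff_id.pow 2).sub contDiff_const))
  have h0 : ∀ s, |s| ≤ 1 → G s = 0 := fun s hs => by
    have : s ^ 2 - 1 ≤ 0 := by nlinarith [abs_nonneg s, sq_abs s]
    simp only [G, Real.smoothTransition.zero_of_nonpos this, mul_zero]
  have h2 : ∀ s, 2 < |s| → G s = s := fun s hs => by
    have : 1 ≤ s ^ 2 - 1 := by nlinarith [abs_nonneg s, sq_abs s]
    simp only [G, Real.smoothTransition.one_of_one_le this, mul_one]
  have h2' : ∀ s, 2 < |s| → deriv G s = 1 := fun s hs => by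
    have : G =ᶠ[𝓝 s] id := by
      filter_upwards [(isOpen_lt continuous_const continuous_abs).mem_nhds hs] with z hz
      exact h2 z hz
    rw [this.deriv_eq, deriv_id]
  refine ⟨G, hG, h0, fun s => ?_, fun s hs => ⟨h2 s hs, h2' s hs⟩, ?_, ?_⟩
  · rw [abs_mul, abs_of_nonneg (Real.smoothTransition.nonneg _)]
    exact mul_le_of_le_one_right (abs_nonneg _) (Real.smoothTransition.le_one _)
  · have : G =ᶠ[𝓝 0] fun _ => 0 := by
      filter_upwards [Metric.ball_mem_nhds (0 : ℝ) one_pos] with z hz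
      exact h0 z (by simpa using (mem_ball_zero_iff.1 hz).le)
    rw [this.deriv_eq, deriv_const]
  · obtain ⟨M, hM⟩ := (isCompact_Icc (a := (-2 : ℝ)) (b := 2)).exists_bound_of_continuousOn
      (hG.continuous_deriv le_rfl).continuousOn
    refine ⟨max M 1, fun s => ?_⟩
    by_cases hs : |s| ≤ 2
    · exact (hM s (abs_le.1 hs)).trans (le_max_left _ _)
    · rw [h2' s (not_le.1 hs), abs_one]
      exact le_max_right _ _

theorem tendsto_eLpNorm_of_bounded [IsFiniteMeasure μ] {u : ℕ → Space d → ℝ} {M : ℝ}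
    (hm : ∀ n, AEStronglyMeasurable (u n) μ) (hM : ∀ n, ∀ᵐ x ∂μ, |u n x| ≤ M)
    (ht : ∀ᵐ x ∂μ, Tendsto (fun n => u n x) atTop (𝓝 0)) :
    Tendsto (fun n => eLpNorm (u n) 2 μ) atTop (𝓝 0) := by
  have h1 : Tendsto (fun n => ∫⁻ x, ‖u n x‖ₑ ^ (2 : ℝ) ∂μ) atTop (𝓝 0) := by
    have := tendsto_lintegral_filter_of_dominated_convergence' (μ := μ) (l := atTop)
      (F := fun n x => ‖u n x‖ₑ ^ (2 : ℝ)) (f := fun _ => 0)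
      (fun _ => ENNReal.ofReal M ^ (2 : ℝ)) (Eventually.of_forall fun n => (hm n).enorm.pow_const _)
      (Eventually.of_forall fun n => ?_) ?_ ?_
    · simpa using this
    · filter_upwards [hM n] with x hx
      gcongr
      rw [← ofReal_norm]
      exact ENNReal.ofReal_le_ofReal hx
    · rw [lintegral_const]
      exact ENNReal.mul_ne_top (ENNReal.rpow_ne_top_of_nonneg (by norm_num) ENNReal.ofReal_ne_top)
        (measure_ne_top _ _)
    · filter_upwards [ht] with x hx
      have h3 : Tendsto (fun n => ‖u n x‖ₑ) atTop (𝓝 0) := by simpa using hx.enorm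
      have h4 := (ENNReal.continuous_rpow_const (y := (2 : ℝ))).tendsto 0 |>.comp h3
      simpa [Function.comp_def] using h4
  simp_rw [eLpNorm_eq_lintegral_rpow_enorm_toReal (p := 2) two_ne_zero ENNReal.ofNat_ne_top]
  have := (ENNReal.continuous_rpow_const (y := (1 / 2 : ℝ))).tendsto 0 |>.comp h1
  simpa [Function.comp_def] using this

/-- The truncation vanishes where |n f| ≤ 1. The part of the closure of Ω with |n f| ≥ 1 is compact
and misses the boundary, where f = 0, so extension by zero is C¹ and compactly supported in Ω
whatever the shape of ∂Ω. -/
theorem exists_truncation (hΩ : Bornology.IsBounded Ω) (hΩo : IsOpen Ω) {f : Space d → ℝ}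
    (hf : ContDiff ℝ 1 f) (h0 : ∀ x ∈ frontier Ω, f x = 0) {G : ℝ → ℝ} (hG : ContDiff ℝ 1 G)
    (hG0 : ∀ s, |s| ≤ 1 → G s = 0) {n : ℝ} (hn : 0 < n) :
    ∃ v : Space d → ℝ, ContDiff ℝ 1 v ∧ HasCompactSupport v ∧ tsupport v ⊆ Ω ∧
      (∀ x ∈ Ω, v x = n⁻¹ * G (n * f x)) ∧
      ∀ x ∈ Ω, ∀ i, partialD i v x = deriv G (n * f x) * partialD i f x := by
  classical
  let w : Space d → ℝ := fun x => n⁻¹ * G (n * f x)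
  have hw : ContDiff ℝ 1 w := contDiff_const.mul (hG.comp (contDiff_const.mul hf))
  let v : Space d → ℝ := Ω.indicator w
  let K : Set (Space d) := closure Ω ∩ {x | 1 ≤ |n * f x|}
  have hKc : IsCompact K := hΩ.isCompact_closure.inter_right
    (isClosed_le continuous_const (continuous_const.mul hf.continuous).abs)
  have hKΩ : K ⊆ Ω := by
    rintro x ⟨hx, hx1⟩
    by_contra hxΩ
    have : x ∈ frontier Ω := ⟨hx, by rwa [hΩo.interior_eq]⟩
    have h1 : (1 : ℝ) ≤ |n * f x| := hx1
    rw [h0 x this] at h1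
    norm_num at h1
  have hvK : ∀ x, x ∉ K → v x = 0 := by
    intro x hx
    by_cases hxΩ : x ∈ Ω
    · have h1 : ¬ 1 ≤ |n * f x| := fun h => hx ⟨subset_closure hxΩ, h⟩
      simp only [v, indicator_of_mem hxΩ, w, hG0 _ (not_le.1 h1).le, mul_zero]
    · exact indicator_of_notMem hxΩ _
  have hvs : Function.support v ⊆ K := fun x hx => by
    by_contra h
    exact hx (hvK x h)
  have hve : ∀ x ∈ Ω, v =ᶠ[𝓝 x] w := fun x hx => by
    filter_upwards [hΩo.mem_nhds hx] with y hy
    exact indicator_of_mem hy _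
  refine ⟨v, ?_, HasCompactSupport.of_support_subset_isCompact hKc hvs,
    (closure_minimal hvs hKc.isClosed).trans hKΩ, fun x hx => indicator_of_mem hx _,
    fun x hx i => ?_⟩
  · refine contDiff_iff_contDiffAt.2 fun x => ?_
    by_cases hx : x ∈ Ω
    · exact hw.contDiffAt.congr_of_eventuallyEq (hve x hx)
    · have : v =ᶠ[𝓝 x] fun _ => 0 := by
        filter_upwards [hKc.isClosed.isOpen_compl.mem_nhds fun h => hx (hKΩ h)] with y hy
        exact hvK y hy
      exact contDiffAt_const.congr_of_eventuallyEq this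
  · have hfx := (hf.differentiable one_ne_zero x).hasFDerivAt
    have h1 : HasFDerivAt (fun x => n * f x) (n • fderiv ℝ f x) x := hfx.const_mul n
    have h2 : HasDerivAt G (deriv G (n * f x)) (n * f x) :=
      (hG.differentiable one_ne_zero _).hasDerivAt
    have h3 : HasFDerivAt w (n⁻¹ • deriv G (n * f x) • n • fderiv ℝ f x) x :=
      (h2.comp_hasFDerivAt x h1).const_mul n⁻¹
    unfold partialD
    rw [(hve x hx).fderiv_eq, h3.fderiv]
    simp only [_root_.smul_apply, smul_eq_mul]
    field_simp

/-- A `C²` function which vanishes on the boundary belongs to `H²_{(0)}`. -/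
theorem jet_mem_H2zeroSub [IsFiniteMeasure μ] (hΩo : IsOpen Ω) (hΩ : Bornology.IsBounded Ω)
    (hd : HasBoundedLogDensity μ Ω) {f : Space d → ℝ} (hf : ContDiff ℝ 2 f)
    (h0 : ∀ x ∈ frontier Ω, f x = 0) : jet μ f ∈ H2zeroSub hΩo hΩ hd := by
  have hμ := hd.ae_mem hΩo
  have hf1 : ContDiff ℝ 1 f := hf.of_le (by norm_num)
  have hjet : ∀ α, jetEquiv μ (jet μ f) α =ᵐ[μ] classicalD α f := fun α =>
    coeFn_toL2 (memLp_classicalD hΩ hμ hf α)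
  rw [mem_H2zeroSub]
  refine ⟨fun α φ hφ => ?_, fun ε hε => ?_⟩
  · have h1 : ∀ α, ∀ᵐ x ∂(volume.restrict Ω), jetEquiv μ (jet μ f) α x = classicalD α f x :=
      fun α => hd.2.1.ae_le (hjet α)
    have e1 : ∀ (γ : MIdx d) (χ : Space d → ℝ), ∫ x in Ω, jetEquiv μ (jet μ f) γ x * χ x =
        ∫ x in Ω, classicalD γ f x * χ x :=
      fun γ χ => integral_congr_ae ((h1 γ).mono fun x hx => by simp only [hx])
    rw [e1, e1]
    exact isWeakD_classicalD hf α φ hφ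
  obtain ⟨G, hG, hG0, hGle, hG2, hGd0, M, hM⟩ := exists_smooth_truncation
  have hM0 : 0 ≤ M := (abs_nonneg _).trans (hM 0)
  choose v hv hvs hvt hvΩ hvd using fun n : ℕ =>
    exists_truncation hΩ hΩo hf1 h0 hG hG0 (n := (n : ℝ) + 1) (by positivity)
  obtain ⟨C, hC0, hC⟩ := exists_bound_classicalD hΩ hf
  have hbig : ∀ x, f x ≠ 0 → ∀ᶠ n : ℕ in atTop, 2 < |((n : ℝ) + 1) * f x| := fun x hx => by
    have hx' := abs_pos.2 hx
    filter_upwards [eventually_gt_atTop ⌈2 / |f x|⌉₊] with n hn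
    have h1 : 2 / |f x| < n := (Nat.le_ceil _).trans_lt (by exact_mod_cast hn)
    rw [div_lt_iff₀ hx'] at h1
    rw [abs_mul, abs_of_pos (by positivity : (0 : ℝ) < (n : ℝ) + 1)]
    nlinarith
  have hlim0 : Tendsto (fun n => eLpNorm (fun x => f x - v n x) 2 μ) atTop (𝓝 0) := by
    refine tendsto_eLpNorm_of_bounded (M := 2 * C)
      (fun n => (hf.continuous.sub (hv n).continuous).aestronglyMeasurable) (fun n => ?_) ?_
    · filter_upwards [hμ] with x hx
      have h1 : |f x| ≤ C := hC x hx (.inl ())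
      have hn : (0 : ℝ) < (n : ℝ) + 1 := by positivity
      have h2 : |v n x| ≤ |f x| := by
        rw [hvΩ n x hx, abs_mul, abs_of_pos (inv_pos.2 hn), inv_mul_le_iff₀ hn]
        refine (hGle _).trans ?_
        rw [abs_mul, abs_of_pos hn]
      linarith [abs_sub (f x) (v n x)]
    · filter_upwards [hμ] with x hx
      refine tendsto_const_nhds.congr' ?_
      by_cases hfx : f x = 0
      · filter_upwards with n
        rw [hvΩ n x hx, hfx, mul_zero, hG0 0 (by simp), mul_zero, sub_zero]
      · filter_upwards [hbig x hfx] with n hn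
        rw [hvΩ n x hx, (hG2 _ hn).1, inv_mul_cancel_left₀ (by positivity), sub_self]
  have hlim1 : ∀ i, Tendsto (fun n => eLpNorm (fun x => partialD i f x - partialD i (v n) x) 2 μ)
      atTop (𝓝 0) := fun i => by
    refine tendsto_eLpNorm_of_bounded (M := C + M * C)
      (fun n => ((continuous_partialD hf1 i).sub
        (continuous_partialD (hv n) i)).aestronglyMeasurable) (fun n => ?_) ?_
    · filter_upwards [hμ] with x hx
      have h1 : |partialD i f x| ≤ C := hC x hx (.inr (.inl i))
      have h2 : |partialD i (v n) x| ≤ M * C := by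
        rw [hvd n x hx, abs_mul]
        exact mul_le_mul (hM _) h1 (abs_nonneg _) hM0
      linarith [abs_sub (partialD i f x) (partialD i (v n) x)]
    -- On the zero set of f the truncations have zero gradient, so convergence there requires that
    -- the gradient of f vanish almost everywhere on this set.
    · have hz : ∀ᵐ x ∂μ, f x = 0 → partialD i f x = 0 :=
        hd.1.ae_le (ae_restrict_of_ae (ae_partialD_eq_zero hf1 i))
      filter_upwards [hμ, hz] with x hx hxz
      refine tendsto_const_nhds.congr' ?_
      by_cases hfx : f x = 0
      · filter_upwards with n
        rw [hvd n x hx, hxz hfx, mul_zero, sub_zero]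
      · filter_upwards [hbig x hfx] with n hn
        rw [hvd n x hx, (hG2 _ hn).2, one_mul, sub_self]
  have hε2 : 0 < ε / 2 := ENNReal.half_pos hε.ne'
  obtain ⟨n, hn0, hn1⟩ := ((hlim0.eventually (gt_mem_nhds hε2)).and
    (eventually_all.2 fun i => (hlim1 i).eventually (gt_mem_nhds hε2))).exists
  -- A sup-norm error κ costs at most κ μ(univ)^(1/2) in L²; κ makes the mollification error less
  -- than ε / 2.
  have hκ : ∃ κ : ℝ, 0 < κ ∧
      μ univ ^ ((2 : ℝ≥0∞).toReal)⁻¹ * ENNReal.ofReal κ < ε / 2 := by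
    have h1 : Tendsto (fun κ : ℝ => μ univ ^ ((2 : ℝ≥0∞).toReal)⁻¹ * ENNReal.ofReal κ)
        (𝓝[>] 0) (𝓝 0) := by
      have h2 : Tendsto (fun κ : ℝ => ENNReal.ofReal κ) (𝓝[>] 0) (𝓝 0) := by
        have := (ENNReal.continuous_ofReal.tendsto (0 : ℝ)).mono_left
          (nhdsWithin_le_nhds (s := Ioi 0))
        simpa using this
      have := ENNReal.Tendsto.const_mul h2
        (Or.inr (ENNReal.rpow_ne_top_of_nonneg (y := ((2 : ℝ≥0∞).toReal)⁻¹) (by norm_num)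
          (measure_ne_top μ univ)))
      simpa using this
    obtain ⟨κ, h3, h4⟩ := ((h1.eventually (gt_mem_nhds hε2)).and self_mem_nhdsWithin).exists
    exact ⟨κ, h4, h3⟩
  obtain ⟨κ, hκ0, hκ⟩ := hκ
  obtain ⟨φ, hφ, hφ0, hφ1⟩ := exists_isTestFunction_near hΩo (hv n) (hvs n) (hvt n) hκ0
  have hfin : ∀ u w z : Space d → ℝ, Continuous u → Continuous w → Continuous z →
      eLpNorm (fun x => u x - w x) 2 μ < ε / 2 → (∀ x, |w x - z x| ≤ κ) →
      eLpNorm (fun x => u x - z x) 2 μ < ε := by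
    intro u w z hu hw hz h1 h2
    have h3 : eLpNorm (fun x => w x - z x) 2 μ < ε / 2 :=
      (eLpNorm_le_of_ae_bound (Eventually.of_forall h2)).trans_lt hκ
    calc eLpNorm (fun x => u x - z x) 2 μ
        = eLpNorm ((fun x => u x - w x) + fun x => w x - z x) 2 μ := by
          congr 1; ext x; simp
      _ ≤ _ := eLpNorm_add_le (hu.sub hw).aestronglyMeasurable (hw.sub hz).aestronglyMeasurable
          one_le_two
      _ < ε / 2 + ε / 2 := ENNReal.add_lt_add h1 h3
      _ = ε := ENNReal.add_halves ε
  refine ⟨φ, hφ, fun α hα => ?_⟩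
  have hcongr : eLpNorm (fun x => jetEquiv μ (jet μ f) α x - classicalD α φ x) 2 μ =
      eLpNorm (fun x => classicalD α f x - classicalD α φ x) 2 μ :=
    eLpNorm_congr_ae ((hjet α).mono fun x hx => by simp only [hx])
  rw [hcongr]
  have hφ1' : ContDiff ℝ 1 φ := hφ.contDiff_two.of_le (by norm_num)
  rcases α with _ | i | p
  · exact hfin f (v n) φ hf.continuous (hv n).continuous hφ.1.continuous hn0 hφ0
  · exact hfin _ (partialD i (v n)) _ (continuous_partialD hf1 i) (continuous_partialD (hv n) i)
      (continuous_partialD hφ1' i) (hn1 i) (hφ1 i)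
  · simp [MIdx.order] at hα

end Boundary

/-! ### The network and its training dynamics in terms of jets -/

section Links

variable {d : ℕ} {Ω : Set (Space d)} {μ : Measure (Space d)} {η : Space d → ℝ} {σ : ℝ → ℝ}

theorem unitFn_eq_hiddenUnit (p : Par d → ℝ) :
    unitFn 0 1 η σ p = fun z => η z * hiddenUnit σ p z := by
  ext z
  simp only [unitFn, block, hiddenUnit]
  ring

theorem network_eq_sum (β : ℝ) (N : ℕ) (θ : Fin N × Par d → ℝ) :
    network η σ β N θ = fun x => (N : ℝ) ^ (-β) * ∑ i, unitFn 0 1 η σ (unitPar θ i) x := by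
  ext x
  simp only [network, unitFn_eq_hiddenUnit, ← Finset.mul_sum]
  exact mul_left_comm _ _ _

theorem contDiff_network (hη : ContDiff ℝ 2 η) (hσ : ContDiff ℝ 2 σ) (β : ℝ) (N : ℕ)
    (θ : Fin N × Par d → ℝ) : ContDiff ℝ 2 (network η σ β N θ) := by
  rw [network_eq_sum]
  exact contDiff_const.mul (ContDiff.sum fun i _ => contDiff_unitFn hη hσ 0 1 _)

theorem jet_network [IsFiniteMeasure μ] (hΩ : Bornology.IsBounded Ω) (hμ : ∀ᵐ x ∂μ, x ∈ Ω)
    (hη : ContDiff ℝ 2 η) (hσ : ContDiff ℝ 2 σ) (β : ℝ) (N : ℕ) (θ : Fin N × Par d → ℝ) :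
    jet μ (network η σ β N θ) = netE (fun p => jet μ (unitFn 0 1 η σ p)) β N θ := by
  have h := fun i => contDiff_unitFn hη hσ 0 1 (unitPar θ i)
  rw [network_eq_sum, jet_const_mul hΩ hμ (ContDiff.sum fun i _ => h i), jet_sum hΩ hμ _ h, netE]

theorem classicalD_network (hη : ContDiff ℝ 2 η) (hσ : ContDiff ℝ 2 σ) (β : ℝ) (N : ℕ)
    (θ : Fin N × Par d → ℝ) (α : MIdx d) (x : Space d) :
    classicalD α (network η σ β N θ) x =
      (N : ℝ) ^ (-β) * ∑ i, classicalD α (unitFn 0 1 η σ (unitPar θ i)) x := by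
  have h := fun i => contDiff_unitFn hη hσ 0 1 (unitPar θ i)
  rw [network_eq_sum, classicalD_const_mul (ContDiff.sum fun i _ => h i), classicalD_sum _ h]

theorem hasDerivAt_update_apply {ι : Type*} [Fintype ι] [DecidableEq ι] (θ : ι → ℝ) (j l : ι)
    (t : ℝ) : HasDerivAt (fun s => Function.update θ j s l) (Pi.single (M := fun _ => ℝ) j 1 l) t :=
  hasDerivAt_pi.1 (hasDerivAt_update θ j t) l

theorem hasDerivAt_classicalD_update (hη : ContDiff ℝ 2 η) (hσ : ContDiff ℝ 3 σ)
    (p : Par d → ℝ) (k : Par d) (α : MIdx d) (x : Space d) :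
    HasDerivAt (fun s => classicalD α (fun z => η z * hiddenUnit σ (Function.update p k s) z) x)
      (classicalD α (unitD η σ k p) x) (p k) := by
  have h := hasDerivAt_classicalD_unit hη hσ
    (fun l => hasDerivAt_update_apply p k l (p k)) α x
  simp only [unitFn_eq_hiddenUnit] at h
  refine h.congr_deriv ?_
  rw [Finset.sum_eq_single k (fun l _ hl => by rw [Pi.single_eq_of_ne hl, zero_mul]) (by simp),
    Pi.single_eq_same, one_mul, Function.update_eq_self]

theorem parD_unit (hη : ContDiff ℝ 2 η) (hσ : ContDiff ℝ 3 σ) (p : Par d → ℝ) (k : Par d)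
    (y : Space d) : parD (fun q => η y * hiddenUnit σ q y) k p = unitD η σ k p y :=
  (hasDerivAt_classicalD_update hη hσ p k (.inl ()) y).deriv

theorem parD_pdeOp_unit (hη : ContDiff ℝ 2 η) (hσ : ContDiff ℝ 3 σ) (a : MIdx d → Space d → ℝ)
    (p : Par d → ℝ) (k : Par d) (x : Space d) :
    parD (fun q => pdeOp a (fun z => η z * hiddenUnit σ q z) x) k p = pdeOp a (unitD η σ k p) x :=
  (HasDerivAt.fun_sum fun α _ =>
    (hasDerivAt_classicalD_update hη hσ p k α x).const_mul (a α x)).deriv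

theorem parD_pdeOp_network (hη : ContDiff ℝ 2 η) (hσ : ContDiff ℝ 3 σ) (a : MIdx d → Space d → ℝ)
    (β : ℝ) (N : ℕ) (θ : Fin N × Par d → ℝ) (j : Fin N × Par d) (x : Space d) :
    parD (fun θ' => pdeOp a (network η σ β N θ') x) j θ =
      (N : ℝ) ^ (-β) * pdeOp a (unitD η σ j.2 (unitPar θ j.1)) x := by
  have hσ2 : ContDiff ℝ 2 σ := hσ.of_le (by norm_num)
  have h1 : ∀ α, HasDerivAt (fun s => classicalD α (network η σ β N (Function.update θ j s)) x)
      ((N : ℝ) ^ (-β) * classicalD α (unitD η σ j.2 (unitPar θ j.1)) x) (θ j) := fun α => by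
    simp only [classicalD_network hη hσ2]
    refine HasDerivAt.const_mul _ ?_
    have h2 : ∀ i, HasDerivAt
        (fun s => classicalD α (unitFn 0 1 η σ (unitPar (Function.update θ j s) i)) x)
        (∑ k, Pi.single (M := fun _ => ℝ) j 1 (i, k) * classicalD α (unitD η σ k (unitPar θ i)) x)
        (θ j) := fun i => by
      have h3 := hasDerivAt_classicalD_unit hη hσ
        (fun l => hasDerivAt_update_apply θ j (i, l) (θ j)) α x
      rw [show (fun l => Function.update θ j (θ j) (i, l)) = unitPar θ i by
        rw [Function.update_eq_self]; rfl] at h3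
      exact h3
    refine (HasDerivAt.fun_sum fun i _ => h2 i).congr_deriv ?_
    rw [← Fintype.sum_prod_type' (f := fun i k => Pi.single (M := fun _ => ℝ) j 1 (i, k) *
      classicalD α (unitD η σ k (unitPar θ i)) x),
      Finset.sum_eq_single j (fun l _ hl => by rw [Pi.single_eq_of_ne hl, zero_mul]) (by simp),
      Pi.single_eq_same, one_mul]
  have h4 := (HasDerivAt.fun_sum fun α (_ : α ∈ Finset.univ) => (h1 α).const_mul (a α x)).deriv
  refine Eq.trans h4 ?_
  simp only [pdeOp, pdeSymbol, Finset.mul_sum]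
  exact Finset.sum_congr rfl fun α _ => by ring

/-! ### Clipping functions -/

theorem IsClipping.abs_sub_le {γ : ℝ} {h : ℕ → ℝ → ℝ} (hh : IsClipping γ h) {N : ℕ} (hN : 1 ≤ N)
    (x y : ℝ) : |h N x - h N y| ≤ |x - y| := by
  obtain ⟨h1, -, -, -, h2⟩ := hh N hN
  have := Convex.norm_image_sub_le_of_norm_deriv_le (𝕜 := ℝ) (f := h N) (s := univ) (C := 1)
    (fun x _ => h1.1.differentiable (by norm_num) x) (fun x _ => h2 x) convex_univ
    (mem_univ y) (mem_univ x)
  simpa using this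

theorem IsClipping.map_zero {γ : ℝ} {h : ℕ → ℝ → ℝ} (hh : IsClipping γ h) {N : ℕ} (hN : 1 ≤ N) :
    h N 0 = 0 :=
  (hh N hN).2.2.2.1 0 (by rw [abs_zero]; positivity)

theorem eventually_abs_le_rpow {γ : ℝ} (hγ : 0 < γ) (x : ℝ) :
    ∀ᶠ N : ℕ in atTop, 1 ≤ N ∧ |x| ≤ (N : ℝ) ^ γ :=
  (eventually_ge_atTop 1).and
    (((tendsto_rpow_atTop hγ).comp tendsto_natCast_atTop_atTop).eventually_ge_atTop |x|)

theorem IsClipping.exists_isClipFamily [IsFiniteMeasure μ] {γ : ℝ} (hγ : 0 < γ) {h : ℕ → ℝ → ℝ}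
    (hh : IsClipping γ h) : ∃ C, IsClipFamily C γ fun N => compL2 μ (h N) :=
  isClipFamily_compL2 zero_le_two (fun _ hN => hh.abs_sub_le hN) (fun _ hN => hh.map_zero hN)
    (fun N hN => (hh N hN).2.2.1) fun x => tendsto_const_nhds.congr' <| by
      filter_upwards [eventually_abs_le_rpow hγ x] with N hN
      exact ((hh N hN.1).2.2.2.1 x hN.2).symm

/-- The clipping function `N ^ β h(N ^ (-β) x)`. -/
noncomputable def rescaledClip (β : ℝ) (N : ℕ) (h : ℝ → ℝ) (x : ℝ) : ℝ :=
  (N : ℝ) ^ β * h ((N : ℝ) ^ (-β) * x)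

theorem IsClipping.abs_rescaledClip_sub_le {γ β : ℝ} {h : ℕ → ℝ → ℝ} (hh : IsClipping γ h)
    {N : ℕ} (hN : 1 ≤ N) (x y : ℝ) :
    |rescaledClip β N (h N) x - rescaledClip β N (h N) y| ≤ |x - y| := by
  have hN0 : (0 : ℝ) < N := by exact_mod_cast hN
  unfold rescaledClip
  rw [← mul_sub, abs_mul, abs_of_pos (Real.rpow_pos_of_pos hN0 _)]
  calc _ ≤ (N : ℝ) ^ β * |(N : ℝ) ^ (-β) * x - (N : ℝ) ^ (-β) * y| := by
        exact mul_le_mul_of_nonneg_left (hh.abs_sub_le hN _ _) (by positivity)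
    _ = |x - y| := by
        rw [← mul_sub, abs_mul, abs_of_pos (Real.rpow_pos_of_pos hN0 _), ← mul_assoc,
          ← Real.rpow_add hN0, add_neg_cancel, Real.rpow_zero, one_mul]

theorem IsClipping.rescaledClip_zero {γ β : ℝ} {h : ℕ → ℝ → ℝ} (hh : IsClipping γ h)
    {N : ℕ} (hN : 1 ≤ N) : rescaledClip β N (h N) 0 = 0 := by
  rw [rescaledClip, mul_zero, hh.map_zero hN, mul_zero]

/-- Parameter derivatives of the network carry N^(-β). Extracting this factor from the clipped value
moves the level from N^(ε-β) to N^ε, which tends to infinity, so the clipping disappears in the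
limit even though ε - β < 0. -/
theorem IsClipping.exists_isClipFamily_rescaled [IsFiniteMeasure μ] {ε β : ℝ} (hε : 0 < ε)
    {h : ℕ → ℝ → ℝ} (hh : IsClipping (ε - β) h) :
    ∃ C, IsClipFamily C ε fun N => compL2 μ (rescaledClip β N (h N)) := by
  refine isClipFamily_compL2 zero_le_two (fun _ hN => hh.abs_rescaledClip_sub_le hN)
    (fun _ hN => hh.rescaledClip_zero hN) (fun N hN x => ?_) fun x =>
      tendsto_const_nhds.congr' ?_
  · have hN0 : (0 : ℝ) < N := by exact_mod_cast hN
    rw [rescaledClip, abs_mul, abs_of_pos (Real.rpow_pos_of_pos hN0 _)]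
    calc _ ≤ (N : ℝ) ^ β * (2 * (N : ℝ) ^ (ε - β)) := by
          gcongr
          exact (hh N hN).2.2.1 _
      _ = 2 * ((N : ℝ) ^ β * (N : ℝ) ^ (ε - β)) := by ring
      _ = _ := by rw [← Real.rpow_add hN0, add_sub_cancel]
  · filter_upwards [eventually_abs_le_rpow hε x] with N hN
    have hN0 : (0 : ℝ) < N := by exact_mod_cast hN.1
    have hb : |(N : ℝ) ^ (-β) * x| ≤ (N : ℝ) ^ (ε - β) := by
      rw [abs_mul, abs_of_pos (Real.rpow_pos_of_pos hN0 _)]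
      calc _ ≤ (N : ℝ) ^ (-β) * (N : ℝ) ^ ε := by gcongr; exact hN.2
        _ = _ := by rw [← Real.rpow_add hN0]; congr 1; ring
    rw [rescaledClip, (hh N hN.1).2.2.2.1 _ hb, ← mul_assoc, ← Real.rpow_add hN0, add_neg_cancel,
      Real.rpow_zero, one_mul]

/-- The clipped gradient as an inner product. -/
theorem clippedGrad_eq_inner [IsFiniteMeasure μ] (hΩ : Bornology.IsBounded Ω)
    (hμ : ∀ᵐ x ∂μ, x ∈ Ω) (hη : ContDiff ℝ 2 η) (hσ : ContDiff ℝ 3 σ)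
    {a : MIdx d → Space d → ℝ} (ha : ∀ α, Measurable (a α)) {k : ℝ}
    (hk : ∀ α, ∀ᵐ x ∂μ, |a α x| ≤ k) {g : Space d → ℝ} (hg : MemLp g 2 μ) {β γ γ' : ℝ}
    {ψ ϕ : ℕ → ℝ → ℝ} (hψ : IsClipping γ ψ) (hϕ : IsClipping γ' ϕ) {N : ℕ} (hN : 1 ≤ N)
    (j : Fin N × Par d) (θ : Fin N × Par d → ℝ) :
    clippedGrad μ a g η σ β (ψ N) (ϕ N) N j θ = (N : ℝ) ^ (-β) *
      inner ℝ (compL2 μ (rescaledClip β N (ϕ N))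
          (jetOp ha hk (jet μ (unitD η σ j.2 (unitPar θ j.1)))))
        (compL2 μ (ψ N)
          (jetOp ha hk (netE (fun p => jet μ (unitFn 0 1 η σ p)) β N θ) - toL2 μ g)) := by
  have hN0 : (0 : ℝ) < N := by exact_mod_cast hN
  have hσ2 : ContDiff ℝ 2 σ := hσ.of_le (by norm_num)
  rw [← jet_network hΩ hμ hη hσ2, compL2, compL2, inner_toL2
    (memLp_comp (hϕ.abs_rescaledClip_sub_le hN) (hϕ.rescaledClip_zero hN) (Lp.memLp _))
    (memLp_comp (hψ.abs_sub_le hN) (hψ.map_zero hN) (Lp.memLp _)), ← integral_const_mul,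
    clippedGrad]
  refine integral_congr_ae ?_
  filter_upwards [jetOp_jet hΩ hμ ha hk (contDiff_network hη hσ2 β N θ),
    jetOp_jet hΩ hμ ha hk (contDiff_unitD hη hσ j.2 (unitPar θ j.1)), coeFn_toL2 hg,
    Lp.coeFn_sub (jetOp ha hk (jet μ (network η σ β N θ))) (toL2 μ g)] with x h1 h2 h3 h4
  rw [h4, Pi.sub_apply, h1, h2, h3, parD_pdeOp_network hη hσ, rescaledClip]
  have : (N : ℝ) ^ (-β) * (N : ℝ) ^ β = 1 := by
    rw [← Real.rpow_add hN0, neg_add_cancel, Real.rpow_zero]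
  linear_combination (-(ψ N (pdeOp a (network η σ β N θ) x - g x) *
    ϕ N ((N : ℝ) ^ (-β) * pdeOp a (unitD η σ j.2 (unitPar θ j.1)) x))) * this

theorem IsTraining.isHilbertTraining [IsFiniteMeasure μ] (hΩ : Bornology.IsBounded Ω)
    (hμ : ∀ᵐ x ∂μ, x ∈ Ω) (hη : ContDiff ℝ 2 η) (hσ : ContDiff ℝ 3 σ)
    {a : MIdx d → Space d → ℝ} (ha : ∀ α, Measurable (a α)) {k : ℝ}
    (hk : ∀ α, ∀ᵐ x ∂μ, |a α x| ≤ k) {g : Space d → ℝ} (hg : MemLp g 2 μ) {β γ γ' : ℝ}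
    {ψ ϕ : ℕ → ℝ → ℝ} (hψ : IsClipping γ ψ) (hϕ : IsClipping γ' ϕ) {N : ℕ} (hN : 1 ≤ N)
    {θ₀ : Fin N × Par d → ℝ} {θ : ℝ → Fin N × Par d → ℝ}
    (hθ : IsTraining μ a g η σ β (ψ N) (ϕ N) N θ₀ θ) :
    IsHilbertTraining (fun p => jet μ (unitFn 0 1 η σ p)) (fun k p => jet μ (unitD η σ k p))
      (jetOp ha hk) (toL2 μ g) (compL2 μ (ψ N)) (compL2 μ (rescaledClip β N (ϕ N))) β N θ := by
  intro t ht
  refine hasDerivWithinAt_pi.2 fun j => ?_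
  rw [clippedField, ← clippedGrad_eq_inner hΩ hμ hη hσ ha hk hg hψ hϕ hN]
  exact hθ.2 t ht j

end Links

/-! ### The law of the initial parameters -/

section Initialization

variable {d : ℕ} {Ω : Set (Space d)} {μ : Measure (Space d)} {η : Space d → ℝ} {σ : ℝ → ℝ}
  {S : Type*} [MeasurableSpace S] {P : Measure S} {X : ℕ → S → Par d → ℝ}

/-- The squared weight is (1+|c|)²(1+∑|w_k|)⁴, and c is bounded: the fourth moments of w are what is
needed. -/
theorem IsInitialization.memLp_parWeight [IsProbabilityMeasure P] (hX : IsInitialization P X) :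
    MemLp (parWeight (d := d)) 2 (P.map (X 0)) := by
  have hm := hX.measurable 0
  have hmk : ∀ k, Measurable fun s => X 0 s k := fun k => (measurable_pi_apply k).comp hm
  rw [memLp_map_measure_iff continuous_parWeight.aestronglyMeasurable hm.aemeasurable]
  obtain ⟨K, hK⟩ := hX.bounded_c
  have hw : ∀ k : Fin d, MemLp (fun s => |X 0 s (.inr (.inl k))|) ((4 : ℕ) : ℝ≥0∞) P :=
      fun k => by
    rw [← integrable_norm_rpow_iff (hmk _).abs.aestronglyMeasurable (by norm_num)
      (ENNReal.natCast_ne_top 4)]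
    refine (hX.moment_w k).congr (Eventually.of_forall fun s => ?_)
    simp only [Real.norm_eq_abs, abs_abs]
    rw [ENNReal.toReal_natCast, Real.rpow_natCast]
  have hsum : MemLp (fun s => ∑ k : Fin d, |X 0 s (.inr (.inl k))|) ((4 : ℕ) : ℝ≥0∞) P :=
    memLp_finsetSum Finset.univ fun k _ => hw k
  have hs : MemLp (fun s => 1 + ∑ k : Fin d, |X 0 s (.inr (.inl k))|) ((4 : ℕ) : ℝ≥0∞) P :=
    (memLp_const (1 : ℝ)).add hsum
  have hint : Integrable (fun s => ‖1 + ∑ k : Fin d, |X 0 s (.inr (.inl k))|‖ ^ 4) P :=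
    hs.integrable_norm_pow four_ne_zero
  have hc : Measurable (parWeight ∘ X 0) := continuous_parWeight.measurable.comp hm
  rw [memLp_two_iff_integrable_sq hc.aestronglyMeasurable]
  have hc2 : Measurable fun s => (parWeight ∘ X 0) s ^ 2 := hc.pow_const 2
  refine (hint.const_mul ((1 + K) ^ 2)).mono' hc2.aestronglyMeasurable ?_
  filter_upwards [hK] with s hs
  rw [Function.comp_apply, parWeight, Real.norm_of_nonneg (by positivity), mul_pow, ← pow_mul,
    Real.norm_of_nonneg (by positivity)]
  gcongr

/-- Continuity of the derivatives of the features with respect to the parameters. -/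
theorem continuous_jet_unitD [IsFiniteMeasure μ] (hΩ : Bornology.IsBounded Ω)
    (hμ : ∀ᵐ x ∂μ, x ∈ Ω) (hη : ContDiff ℝ 2 η) (hσ : IsCb 4 σ) (k : Par d) :
    Continuous fun p => jet μ (unitD η σ k p) := by
  -- Continuity does not involve the law of the parameters; the zero measure makes the integrability
  -- conditions trivial.
  obtain ⟨C, -, hF⟩ := isFeatureMap_unit hΩ hμ hη hσ (ν := 0) (memLp_measure_zero) (by simp)
  exact hF.continuous_J k

/-- The feature is c times a function of (w, b) only; independence factors the expectation, and c
has mean zero. -/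
theorem IsInitialization.integral_jet_unitFn [IsFiniteMeasure μ] (hΩ : Bornology.IsBounded Ω)
    (hμ : ∀ᵐ x ∂μ, x ∈ Ω) (hη : ContDiff ℝ 2 η) (hσ : IsCb 4 σ) (hX : IsInitialization P X) :
    ∫ p, jet μ (unitFn 0 1 η σ p) ∂(P.map (X 0)) = 0 := by
  have hm := hX.measurable 0
  -- The coordinate c is filled in with 0; its value is irrelevant because `unitFn 1 0` does not
  -- depend on c.
  let ext : (Fin d ⊕ Unit → ℝ) → Par d → ℝ := fun z => Sum.elim (fun _ => 0) z
  have hext : Continuous ext := continuous_pi fun k => by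
    rcases k with _ | k
    · exact continuous_const
    · exact continuous_apply k
  have hG : Continuous fun z => jet μ (unitFn 1 0 η σ (ext z)) :=
    (continuous_jet_unitD hΩ hμ hη hσ (.inl ())).comp hext
  have hF : Continuous fun p => jet μ (unitFn 0 1 η σ p) := by
    obtain ⟨C, -, hF⟩ := isFeatureMap_unit hΩ hμ hη hσ (ν := 0) (memLp_measure_zero) (by simp)
    exact hF.continuous_F
  have heq : ∀ p : Par d → ℝ, jet μ (unitFn 0 1 η σ p) =
      p (.inl ()) • jet μ (unitFn 1 0 η σ (ext fun k => p (.inr k))) := fun p => by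
    rw [← jet_const_mul hΩ hμ (contDiff_unitFn hη (hσ.contDiff_two (by norm_num)) _ _ _)]
    congr 1
    ext x
    simp [unitFn, ext]
  rw [integral_map hm.aemeasurable hF.aestronglyMeasurable]
  simp only [heq]
  have h := hX.indep_c.integral_fun_comp_smul_comp (𝕜 := ℝ) (f := id)
    (g := fun z => jet μ (unitFn 1 0 η σ (ext z)))
    ((measurable_pi_apply (Sum.inl ())).comp hm).aemeasurable
    (measurable_pi_lambda _ fun k => (measurable_pi_apply (Sum.inr k)).comp hm).aemeasurable
    aestronglyMeasurable_id hG.aestronglyMeasurable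
  simp only [id] at h
  rw [h, hX.mean_c, zero_smul]

end Initialization

/-! ### The mean tangent kernel as an integral operator -/

section Kernel

/-- A Bochner integral in `L²` is represented by the pointwise integrals. -/
theorem coeFn_integral_ae_eq {X Y : Type*} [MeasurableSpace X] [MeasurableSpace Y] {μ : Measure X}
    [IsFiniteMeasure μ] {ν : Measure Y} [IsFiniteMeasure ν] {G : Y → Lp ℝ 2 μ} {u : Y → X → ℝ}
    (hG : Integrable G ν) (hu : Integrable (Function.uncurry u) (ν.prod μ))
    (hGu : ∀ p, G p =ᵐ[μ] u p) : (∫ p, G p ∂ν : Lp ℝ 2 μ) =ᵐ[μ] fun x => ∫ p, u p x ∂ν := by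
  refine Integrable.ae_eq_of_forall_setIntegral_eq _ _ ((Lp.memLp _).integrable one_le_two)
    hu.integral_prod_right fun s hs hμs => ?_
  have hus : Integrable (Function.uncurry u) (ν.prod (μ.restrict s)) :=
    hu.mono_measure (Measure.prod_mono le_rfl Measure.restrict_le_self)
  rw [← L2.inner_indicatorConstLp_one (𝕜 := ℝ) hs hμs.ne,
    ← integral_inner hG, ← integral_integral_swap hus]
  refine integral_congr_ae (Eventually.of_forall fun p => ?_)
  beta_reduce
  rw [L2.inner_indicatorConstLp_one (𝕜 := ℝ) hs hμs.ne]
  exact integral_congr_ae (ae_restrict_of_ae (hGu p))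

variable {d : ℕ} {Ω : Set (Space d)} {μ : Measure (Space d)} {η : Space d → ℝ} {σ : ℝ → ℝ}

theorem continuous_classicalD_unitD (hη : ContDiff ℝ 2 η) (hσ : IsCb 4 σ) (k : Par d) (α : MIdx d)
    (x : Space d) : Continuous fun p => classicalD α (unitD η σ k p) x := by
  -- The estimates are applied to the bounded set {x}, which gives continuity at every point x of
  -- the whole space.
  obtain ⟨C, -, -, -, hC⟩ := exists_bound_unitD (Bornology.isBounded_singleton (x := x)) hη hσ
  rw [continuous_iff_continuousAt]
  intro p
  rw [ContinuousAt, tendsto_iff_norm_sub_tendsto_zero]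
  have hev : ∀ᶠ p' in 𝓝 p, ‖classicalD α (unitD η σ k p') x - classicalD α (unitD η σ k p) x‖ ≤
      C * parWeight p * ‖p' - p‖ := by
    filter_upwards [Metric.closedBall_mem_nhds p one_pos] with p' hp'
    exact hC k p p' (by rwa [← dist_eq_norm]) x rfl α
  refine squeeze_zero' (Eventually.of_forall fun _ => norm_nonneg _) hev ?_
  have : Continuous fun p' => C * parWeight p * ‖p' - p‖ := by fun_prop
  simpa using this.tendsto p

theorem measurable_classicalD_unitD (hη : ContDiff ℝ 2 η) (hσ : IsCb 4 σ) (k : Par d)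
    (α : MIdx d) : Measurable fun z : (Par d → ℝ) × Space d => classicalD α (unitD η σ k z.1) z.2 :=
  measurable_uncurry_of_continuous_of_measurable (u := fun p x => classicalD α (unitD η σ k p) x)
    (fun x => continuous_classicalD_unitD hη hσ k α x)
    fun p => (continuous_classicalD (contDiff_unitD hη (hσ.1.of_le (by norm_num)) k p) α).measurable

/-- The mean tangent kernel is the integral operator with kernel `kernelU`. -/
theorem meanOp_apply_ae_eq [IsFiniteMeasure μ] (hΩ : Bornology.IsBounded Ω)
    (hμ : ∀ᵐ x ∂μ, x ∈ Ω) (hη : ContDiff ℝ 2 η) (hσ : IsCb 4 σ)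
    {a : MIdx d → Space d → ℝ} (ha : ∀ α, Measurable (a α)) {c : ℝ}
    (hc : ∀ α, ∀ᵐ x ∂μ, |a α x| ≤ c) {ν : Measure (Par d → ℝ)} [IsFiniteMeasure ν]
    (hν : MemLp (parWeight (d := d)) 2 ν) {F : (Par d → ℝ) → JetH μ} {m : (Par d → ℝ) → ℝ}
    (hF : IsFeatureMap ν F (fun k p => jet μ (unitD η σ k p)) m) (h : Lp ℝ 2 μ) :
    (meanOp ν (fun k p => jet μ (unitD η σ k p)) (jetOp ha hc) id h) (.inl ()) =ᵐ[μ]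
      fun y => ∫ x, h x * kernelU a η σ ν x y ∂μ := by
  have hσ3 : ContDiff ℝ 3 σ := hσ.1.of_le (by norm_num)
  obtain ⟨C, hC0, -, hC, -⟩ := exists_bound_unitD hΩ hη hσ
  have cJ := contDiff_unitD hη hσ3
  have hW : Integrable (fun p => parWeight p ^ 2) ν := hν.integrable_sq
  set A := jetOp ha hc with hA
  set J : Par d → (Par d → ℝ) → JetH μ := fun k p => jet μ (unitD η σ k p) with hJ
  have hAJ : ∀ k p, A (J k p) =ᵐ[μ] pdeOp a (unitD η σ k p) := fun k p =>
    jetOp_jet hΩ hμ ha hc (cJ k p)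
  have hAm : ∀ k, Measurable fun z : (Par d → ℝ) × Space d => pdeOp a (unitD η σ k z.1) z.2 :=
    fun k => Finset.measurable_sum _ fun α _ =>
      ((ha α).comp measurable_snd).mul (measurable_classicalD_unitD hη hσ k α)
  have hAb : ∀ x ∈ Ω, (∀ α, |a α x| ≤ c) → ∀ k p,
      |pdeOp a (unitD η σ k p) x| ≤ Fintype.card (MIdx d) * (c * C) * parWeight p := by
    intro x hx hax k p
    have hc0 : 0 ≤ c := (abs_nonneg _).trans (hax (.inl ()))
    refine (Finset.abs_sum_le_sum_abs _ _).trans ?_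
    calc _ ≤ ∑ _α : MIdx d, c * (C * parWeight p) := by
          refine Finset.sum_le_sum fun α _ => ?_
          rw [abs_mul]
          exact mul_le_mul (hax α) (hC k p x hx α) (abs_nonneg _) hc0
      _ = _ := by rw [Finset.sum_const, Finset.card_univ, nsmul_eq_mul]; ring
  have hint : Integrable (fun p => ∑ k, inner ℝ (A (J k p)) h • J k p) ν := by
    have := (hF.integrable_finRankOp (A := A) continuous_id fun _ => le_rfl).apply_continuousLinearMap
      h
    simpa only [finRankOp_apply, id] using this
  let T : JetH μ →L[ℝ] Lp ℝ 2 μ := PiLp.proj 2 (fun _ : MIdx d => Lp ℝ 2 μ) (.inl ())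
  have h1 : (meanOp ν J A id h) (.inl ()) =
      ∫ p, (∑ k, inner ℝ (A (J k p)) h • J k p) (.inl ()) ∂ν := by
    rw [hF.meanOp_apply continuous_id (fun _ => le_rfl) h]
    exact (T.integral_comp_comm hint).symm
  rw [h1]
  have hint' : Integrable (fun p => (∑ k, inner ℝ (A (J k p)) h • J k p) (.inl ())) ν :=
    T.integrable_comp hint
  have hin : ∀ k p, |inner ℝ (A (J k p)) h| ≤ ‖A‖ * ‖h‖ * m p := fun k p => by
    refine (abs_real_inner_le_norm _ _).trans ?_
    calc _ ≤ ‖A‖ * m p * ‖h‖ := by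
          gcongr
          exact (A.le_opNorm _).trans (by gcongr; exact hF.norm_J_le k p)
      _ = _ := by ring
  -- The L²-valued integral over parameters is first represented by pointwise integrals in y; a
  -- second use of Fubini, at fixed y, then exchanges parameters with the variable x of the kernel.
  have h2 := coeFn_integral_ae_eq (μ := μ) (ν := ν)
    (G := fun p => (∑ k, inner ℝ (A (J k p)) h • J k p) (.inl ()))
    (u := fun p y => ∑ k, inner ℝ (A (J k p)) h * unitD η σ k p y)
    hint' ?_ ?_
  · refine h2.trans ?_
    filter_upwards [hμ] with y hy
    have hsw : Integrable (Function.uncurry fun (x : Space d) (p : Par d → ℝ) =>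
        h x * ∑ k, pdeOp a (unitD η σ k p) x * unitD η σ k p y) (μ.prod ν) := by
      have hdom : Integrable (fun z : Space d × (Par d → ℝ) => |h z.1| *
          (Fintype.card (Par d) * (Fintype.card (MIdx d) * (c * C) * C) * parWeight z.2 ^ 2))
          (μ.prod ν) :=
        (((Lp.memLp h).integrable one_le_two).abs).mul_prod (hW.const_mul _)
      refine hdom.mono' ?_ ?_
      · refine AEStronglyMeasurable.mul ?_ ?_
        · exact ((Lp.stronglyMeasurable h).measurable.comp measurable_fst).aestronglyMeasurable
        · refine Measurable.aestronglyMeasurable (Finset.measurable_sum _ fun k _ => ?_)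
          exact ((hAm k).comp measurable_swap).mul
            ((continuous_classicalD_unitD hη hσ k (.inl ()) y).measurable.comp measurable_snd)
      · have hae : ∀ᵐ x ∂μ, x ∈ Ω ∧ ∀ α, |a α x| ≤ c := hμ.and (eventually_all.2 hc)
        filter_upwards [Measure.quasiMeasurePreserving_fst.ae hae] with z hz
        simp only [Function.uncurry, norm_mul, Real.norm_eq_abs]
        refine mul_le_mul_of_nonneg_left ?_ (abs_nonneg _)
        refine (Finset.abs_sum_le_sum_abs _ _).trans ?_
        calc _ ≤ ∑ _k : Par d, (Fintype.card (MIdx d) * (c * C) * parWeight z.2) *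
              (C * parWeight z.2) := by
              refine Finset.sum_le_sum fun k _ => ?_
              rw [abs_mul]
              have h3 := hAb z.1 hz.1 hz.2 k z.2
              exact mul_le_mul h3 (hC k z.2 y hy (.inl ())) (abs_nonneg _)
                ((abs_nonneg _).trans h3)
          _ = _ := by rw [Finset.sum_const, Finset.card_univ, nsmul_eq_mul]; ring
    calc ∫ p, ∑ k, inner ℝ (A (J k p)) h * unitD η σ k p y ∂ν
        = ∫ p, ∫ x, h x * ∑ k, pdeOp a (unitD η σ k p) x * unitD η σ k p y ∂μ ∂ν := by
          refine integral_congr_ae (Eventually.of_forall fun p => ?_)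
          beta_reduce
          have h4 : ∀ k, inner ℝ (A (J k p)) h * unitD η σ k p y =
              ∫ x, h x * (pdeOp a (unitD η σ k p) x * unitD η σ k p y) ∂μ := fun k => by
            rw [L2.inner_def, ← integral_mul_const]
            refine integral_congr_ae ?_
            filter_upwards [hAJ k p] with x hx
            rw [hx]
            change h x * pdeOp a (unitD η σ k p) x * unitD η σ k p y = _
            ring
          have h5 : ∀ k, Integrable
              (fun x => h x * (pdeOp a (unitD η σ k p) x * unitD η σ k p y)) μ := fun k => by
            have h6 : Integrable (fun x => inner ℝ (A (J k p) x) (h x)) μ :=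
              L2.integrable_inner _ _
            refine (h6.mul_const (unitD η σ k p y)).congr ?_
            filter_upwards [hAJ k p] with x hx
            rw [hx]
            change h x * pdeOp a (unitD η σ k p) x * unitD η σ k p y = _
            ring
          simp only [h4, Finset.mul_sum]
          rw [integral_finsetSum _ fun k _ => h5 k]
      _ = ∫ x, ∫ p, h x * ∑ k, pdeOp a (unitD η σ k p) x * unitD η σ k p y ∂ν ∂μ :=
          (integral_integral_swap hsw).symm
      _ = ∫ x, h x * kernelU a η σ ν x y ∂μ := by
          refine integral_congr_ae (Eventually.of_forall fun x => ?_)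
          beta_reduce
          rw [integral_const_mul, kernelU]
          simp only [parD_unit hη hσ3, parD_pdeOp_unit hη hσ3]
  · have hmc : ∀ k, Continuous fun p => inner ℝ (A (J k p)) h := fun k =>
      (A.continuous.comp (hF.continuous_J k)).inner continuous_const
    have hdom : Integrable (fun z : (Par d → ℝ) × Space d =>
        Fintype.card (Par d) * (‖A‖ * ‖h‖ * C) * (m z.1 * parWeight z.1)) (ν.prod μ) :=
      Integrable.comp_fst ((hF.memLp_weight.integrable_mul hν).const_mul _) μ
    refine hdom.mono' ?_ ?_
    · refine Measurable.aestronglyMeasurable (Finset.measurable_sum _ fun k _ => ?_)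
      exact ((hmc k).measurable.comp measurable_fst).mul
        (measurable_classicalD_unitD hη hσ k (.inl ()))
    · filter_upwards [Measure.quasiMeasurePreserving_snd.ae hμ] with z hz
      refine (Finset.abs_sum_le_sum_abs _ _).trans ?_
      calc _ ≤ ∑ _k : Par d, (‖A‖ * ‖h‖ * m z.1) * (C * parWeight z.1) := by
            refine Finset.sum_le_sum fun k _ => ?_
            rw [abs_mul]
            exact mul_le_mul (hin k z.1) (hC k z.1 z.2 hz (.inl ())) (abs_nonneg _)
              ((abs_nonneg _).trans (hin k z.1))
        _ = _ := by rw [Finset.sum_const, Finset.card_univ, nsmul_eq_mul]; ring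
  · intro p
    have h7 : (∑ k, inner ℝ (A (J k p)) h • J k p) (.inl ()) =
        ∑ k, inner ℝ (A (J k p)) h • toL2 μ (unitD η σ k p) := by
      simp only [WithLp.ofLp_sum, WithLp.ofLp_smul, Finset.sum_apply, Pi.smul_apply]
      rfl
    rw [h7]
    filter_upwards [Lp.coeFn_finsetSum Finset.univ fun k =>
        inner ℝ (A (J k p)) h • toL2 μ (unitD η σ k p),
      eventually_all.2 fun k => Lp.coeFn_smul (inner ℝ (A (J k p)) h) (toL2 μ (unitD η σ k p)),
      eventually_all.2 fun k => coeFn_toL2 (memLp_classicalD hΩ hμ (cJ k p) (.inl ()))]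
      with y e1 e2 e3
    rw [e1, Finset.sum_apply]
    refine Finset.sum_congr rfl fun k _ => ?_
    rw [e2 k, Pi.smul_apply, smul_eq_mul]
    congr 1
    exact e3 k

end Kernel

/-! ### The wide limit -/

section WideLimit

variable {d : ℕ} {Ω : Set (Space d)} {μ : Measure (Space d)} {η : Space d → ℝ} {σ : ℝ → ℝ}

theorem h2Dist_eq_sum [IsFiniteMeasure μ] (hΩ : Bornology.IsBounded Ω) (hμ : ∀ᵐ x ∂μ, x ∈ Ω)
    {f : Space d → ℝ} (hf : ContDiff ℝ 2 f) (w : JetH μ) :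
    h2Dist f (jetEquiv μ w) = ∑ α, ‖(jet μ f - w) α‖ₑ :=
  Finset.sum_congr rfl fun α _ => by
    rw [PiLp.sub_apply, jet_apply, enorm_toL2_sub (memLp_classicalD hΩ hμ hf α), jetEquiv_apply]

theorem unitD_eq_zero {x : Space d} (hx : η x = 0) (k : Par d) (p : Par d → ℝ) :
    unitD η σ k p x = 0 := by
  rcases k with _ | k | _ <;> simp [unitD, unitFn, block, coordMul, hx]

/-- The value is an average, under a probability measure, of combinations of jets vanishing on the
boundary; a closed convex set contains such averages. -/
theorem meanOp_mem_H2zeroSub [IsFiniteMeasure μ] (hΩo : IsOpen Ω) (hΩ : Bornology.IsBounded Ω)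
    (hd : HasBoundedLogDensity μ Ω) (hη : ContDiff ℝ 2 η) (hη0 : ∀ x ∈ frontier Ω, η x = 0)
    (hσ : ContDiff ℝ 3 σ) {ν : Measure (Par d → ℝ)} [IsProbabilityMeasure ν]
    {F : (Par d → ℝ) → JetH μ} {m : (Par d → ℝ) → ℝ}
    (hF : IsFeatureMap ν F (fun k p => jet μ (unitD η σ k p)) m) (A : JetH μ →L[ℝ] Lp ℝ 2 μ)
    (h : Lp ℝ 2 μ) :
    meanOp ν (fun k p => jet μ (unitD η σ k p)) A id h ∈ H2zeroSub hΩo hΩ hd := by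
  rw [meanOp, ContinuousLinearMap.integral_apply
    (hF.integrable_finRankOp continuous_id fun _ => le_rfl)]
  refine (H2zeroSub hΩo hΩ hd).convex.integral_mem (isClosed_H2zeroSub hΩo hΩ hd)
    (Eventually.of_forall fun p => ?_)
    ((hF.integrable_finRankOp continuous_id fun _ => le_rfl).apply_continuousLinearMap h)
  rw [finRankOp_apply]
  exact Submodule.sum_mem _ fun k _ => Submodule.smul_mem _ _
    (jet_mem_H2zeroSub hΩo hΩ hd (contDiff_unitD hη hσ k p)
      fun x hx => unitD_eq_zero (hη0 x hx) k p)

/-- The velocity of the wide limit, in terms of the kernel. -/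
theorem neg_meanOp_ae_eq [IsFiniteMeasure μ] (hΩ : Bornology.IsBounded Ω)
    (hμ : ∀ᵐ x ∂μ, x ∈ Ω) (hη : ContDiff ℝ 2 η) (hσ : IsCb 4 σ)
    {a : MIdx d → Space d → ℝ} (ha : ∀ α, Measurable (a α)) {c : ℝ}
    (hc : ∀ α, ∀ᵐ x ∂μ, |a α x| ≤ c) {g : Space d → ℝ} (hg : MemLp g 2 μ)
    {ν : Measure (Par d → ℝ)} [IsFiniteMeasure ν]
    (hν : MemLp (parWeight (d := d)) 2 ν) {F : (Par d → ℝ) → JetH μ} {m : (Par d → ℝ) → ℝ}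
    (hF : IsFeatureMap ν F (fun k p => jet μ (unitD η σ k p)) m) (w : JetH μ) :
    (jetEquiv μ (-(meanOp ν (fun k p => jet μ (unitD η σ k p)) (jetOp ha hc) id
      (jetOp ha hc w - toL2 μ g)))) (.inl ()) =ᵐ[μ] fun y =>
      -∫ x, (pdeSymbol a x (fun α => w α x) - g x) * kernelU a η σ ν x y ∂μ := by
  rw [jetEquiv_apply, PiLp.neg_apply]
  filter_upwards [meanOp_apply_ae_eq hΩ hμ hη hσ ha hc hν hF (jetOp ha hc w - toL2 μ g),
    Lp.coeFn_neg ((meanOp ν (fun k p => jet μ (unitD η σ k p)) (jetOp ha hc) id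
      (jetOp ha hc w - toL2 μ g)) (.inl ()))] with y h1 h2
  rw [h2, Pi.neg_apply, h1]
  congr 1
  refine integral_congr_ae ?_
  filter_upwards [Lp.coeFn_sub (jetOp ha hc w) (toL2 μ g), jetOp_apply ha hc w, coeFn_toL2 hg]
    with x h3 h4 h5
  rw [h3, Pi.sub_apply, h4, h5]

end WideLimit

/-! ### Assembly: existence, uniqueness and convergence. -/

theorem mainTheorem1 {d : ℕ} (Ω : Set (Space d)) (hΩo : IsOpen Ω) (hΩb : Bornology.IsBounded Ω)
    (μ : Measure (Space d)) [IsFiniteMeasure μ] (hμ : HasBoundedLogDensity μ Ω)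
    (η : Space d → ℝ) (hη : IsCb 3 η) (hη0 : ∀ x ∈ frontier Ω, η x = 0)
    (a : MIdx d → Space d → ℝ) (ha : ∀ α, Measurable (a α)) (haL : LipschitzCondition Ω a)
    (g : Space d → ℝ) (hg : MemLp g 2 μ)
    (σ : ℝ → ℝ) (hσ : IsCb 4 σ)
    (β δ ε : ℝ) (hβ : 1 / 2 < β) (hβ1 : β < 1) (hδ : 0 < δ) (hδε : δ < ε)
    (hεδ : ε + δ < (1 - β) / 2)
    (ψ ϕ : ℕ → ℝ → ℝ) (hψ : IsClipping δ ψ) (hϕ : IsClipping (ε - β) ϕ)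
    {S : Type*} [MeasurableSpace S] (P : Measure S) [IsProbabilityMeasure P]
    (X : ℕ → S → Par d → ℝ) (hX : IsInitialization P X) :
    ∃ Q : ℝ → JetL2 μ,
      IsWideLimit Ω μ a g η σ (P.map (X 0)) Q ∧
      (∀ Q' : ℝ → JetL2 μ, IsWideLimit Ω μ a g η σ (P.map (X 0)) Q' →
        ∀ t : ℝ, 0 ≤ t → Q' t = Q t) ∧
      ∀ θ : (N : ℕ) → S → ℝ → Fin N × Par d → ℝ,
        (∀ (N : ℕ) (s : S),
          IsTraining μ a g η σ β (ψ N) (ϕ N) N (fun j => X j.1 s j.2) (θ N s)) →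
        ∀ t : ℝ, 0 ≤ t →
          (∀ N : ℕ, AEMeasurable (fun s => h2Dist (network η σ β N (θ N s t)) (Q t)) P) ∧
          Tendsto (fun N : ℕ => ∫⁻ s, h2Dist (network η σ β N (θ N s t)) (Q t) ∂P) atTop (𝓝 0) := by
  have hμΩ := hμ.ae_mem hΩo
  have hη2 : ContDiff ℝ 2 η := hη.contDiff_two (by norm_num)
  have hσ2 : ContDiff ℝ 2 σ := hσ.contDiff_two (by norm_num)
  have hσ3 : ContDiff ℝ 3 σ := hσ.1.of_le (by norm_num)
  obtain ⟨c, hc⟩ := haL.exists_bound hμΩ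
  have hprob : IsProbabilityMeasure (P.map (X 0)) :=
    Measure.isProbabilityMeasure_map (hX.measurable 0).aemeasurable
  set ν := P.map (X 0) with hνdef
  have hν : MemLp (parWeight (d := d)) 2 ν := hX.memLp_parWeight
  obtain ⟨C, -, hF⟩ := isFeatureMap_unit hΩb hμΩ hη2 hσ hν
    (hX.integral_jet_unitFn hΩb hμΩ hη2 hσ)
  set F : (Par d → ℝ) → JetH μ := fun p => jet μ (unitFn 0 1 η σ p) with hFdef
  set J : Par d → (Par d → ℝ) → JetH μ := fun k p => jet μ (unitD η σ k p) with hJdef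
  set A : JetH μ →L[ℝ] Lp ℝ 2 μ := jetOp ha hc with hAdef
  set U : Lp ℝ 2 μ →L[ℝ] JetH μ := meanOp ν J A id with hUdef
  -- The equation is put in the affine form Q' = -(U A) Q + U g.
  have hvel : ∀ w : JetH μ, (-(U.comp A)) w + U (toL2 μ g) = -(U (A w - toL2 μ g)) := fun w => by
    rw [map_sub, neg_sub, sub_eq_neg_add]
    rfl
  obtain ⟨q, hq0, hq⟩ := exists_hasDerivAt_affine (-(U.comp A)) (U (toL2 μ g))
  simp only [hvel] at hq
  have hUmem : ∀ w, -(U w) ∈ H2zeroSub hΩo hΩb hμ := fun w =>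
    Submodule.neg_mem _ (meanOp_mem_H2zeroSub hΩo hΩb hμ hη2 hη0 hσ3 hF A w)
  have hqmem : ∀ t, q t ∈ H2zeroSub hΩo hΩb hμ := mem_of_hasDerivAt_mem
    (isClosed_H2zeroSub hΩo hΩb hμ) hq0 hq fun t => hUmem _
  have hae := neg_meanOp_ae_eq hΩb hμΩ hη2 hσ ha hc hg hν hF
  refine ⟨fun t => jetEquiv μ (q t), ⟨by simp only [hq0, map_zero], fun t _ => ⟨hqmem t,
    jetEquiv μ (-(U (A (q t) - toL2 μ g))), hUmem _, ?_, hae (q t)⟩⟩, ?_, ?_⟩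
  · exact ((jetEquiv μ).toContinuousLinearMap.hasFDerivAt.comp_hasDerivAt t (hq t)).hasDerivWithinAt
  · intro Q' hQ' t ht
    have hd : ∀ r, 0 ≤ r → HasDerivWithinAt (fun r => (jetEquiv μ).symm (Q' r))
        ((-(U.comp A)) ((jetEquiv μ).symm (Q' r)) + U (toL2 μ g)) (Ici 0) r := by
      intro r hr
      obtain ⟨-, V, hV, hder, hVae⟩ := hQ'.2 r hr
      -- The definition prescribes only the function component of the velocity. Both sides lie in
      -- H², so uniqueness of weak derivatives gives equality of the whole jets.
      have hVeq : V = jetEquiv μ (-(U (A ((jetEquiv μ).symm (Q' r)) - toL2 μ g))) := by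
        refine H2.eq_of_ae_eq hΩo hΩb hμ hV.1 (hUmem _).1 (Lp.ext ?_)
        exact hVae.trans (hae ((jetEquiv μ).symm (Q' r))).symm
      rw [hvel]
      have h1 := (jetEquiv μ).symm.toContinuousLinearMap.hasFDerivAt.comp_hasDerivWithinAt r hder
      refine h1.congr_deriv ?_
      rw [hVeq]
      exact (jetEquiv μ).symm_apply_apply _
    have h2 := eq_of_hasDerivWithinAt_affine (-(U.comp A)) (U (toL2 μ g)) (Q' := q)
      (by rw [hQ'.1, map_zero, hq0]) hd
      (fun r _ => by rw [hvel]; exact (hq r).hasDerivWithinAt) ht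
    exact ((jetEquiv μ).apply_symm_apply (Q' t)).symm.trans (congrArg (jetEquiv μ) h2)
  · intro θ hθ t ht
    obtain ⟨C₁, hΨ⟩ := hψ.exists_isClipFamily (μ := μ) hδ
    obtain ⟨C₂, hΦ⟩ := hϕ.exists_isClipFamily_rescaled (μ := μ) (hδ.trans hδε)
    have hθ' : ∀ N, 1 ≤ N → ∀ s, IsHilbertTraining F J A (toL2 μ g) (compL2 μ (ψ N))
        (compL2 μ (rescaledClip β N (ϕ N))) β N (θ N s) := fun N hN s =>
      (hθ N s).isHilbertTraining hΩb hμΩ hη2 hσ3 ha hc hg hψ hϕ hN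
    have hdist : ∀ N s, h2Dist (network η σ β N (θ N s t)) (jetEquiv μ (q t)) =
        ∑ α, ‖(netE F β N (θ N s t) - q t) α‖ₑ := fun N s => by
      rw [h2Dist_eq_sum hΩb hμΩ (contDiff_network hη2 hσ2 β N _), jet_network hΩb hμΩ hη2 hσ2]
    simp only [hdist]
    have hX0 : ∀ N s, θ N s 0 = fun j => X j.1 s j.2 := fun N s => (hθ N s).1
    have hθm : ∀ N, Measurable fun s => θ N s t := fun N => by
      rcases Nat.eq_zero_or_pos N with rfl | hN
      -- For N = 0 the parameter space is a single point, so the clipping hypotheses, stated for N ≥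
      -- 1, are not needed.
      · exact measurable_of_subsingleton_codomain _
      · refine measurable_of_isHilbertTraining hF hΨ hΦ hN (hθ' N hN) ?_ ht
        simp only [hX0]
        exact measurable_pi_lambda _ fun j => (measurable_pi_apply j.2).comp (hX.measurable j.1)
    refine ⟨fun N => ?_, ?_⟩
    · have hcont : Continuous fun τ : Fin N × Par d → ℝ => ∑ α, ‖(netE F β N τ - q t) α‖ₑ :=
        continuous_finsetSum _ fun α _ => ((PiLp.continuous_apply 2 _ α).comp
          ((hF.continuous_netE β N).sub continuous_const)).enorm
      exact (hcont.measurable.comp (hθm N)).aemeasurable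
    · have hlim := tendsto_lintegral_netE_sub hF hΨ hΦ hβ hδ.le (hδ.trans hδε).le hεδ hX.measurable
        (fun i => (hX.identDistrib i).map_eq) hX.indep
        (fun N s j => congrFun (hX0 N s) j) hθ' hq0
        (fun t _ => (hq t).hasDerivWithinAt) ht
      -- The norm of H² is a sum over multi-indices; each summand is at most the Hilbert norm of the
      -- jet, hence the number of multi-indices as factor.
      have hlim' := ENNReal.Tendsto.const_mul (a := (Fintype.card (MIdx d) : ℝ≥0∞)) hlim
        (Or.inr (ENNReal.natCast_ne_top _))
      rw [mul_zero] at hlim'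
      refine tendsto_of_tendsto_of_tendsto_of_le_of_le tendsto_const_nhds hlim'
        (fun N => zero_le) fun N => ?_
      rw [← lintegral_const_mul' _ _ (ENNReal.natCast_ne_top _)]
      refine lintegral_mono fun s => ?_
      calc ∑ α, ‖(netE F β N (θ N s t) - q t) α‖ₑ
          ≤ ∑ _α : MIdx d, ‖netE F β N (θ N s t) - q t‖ₑ :=
            Finset.sum_le_sum fun α _ => PiLp.enorm_apply_le _ α
        _ = _ := by rw [Finset.sum_const, Finset.card_univ, nsmul_eq_mul]
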